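/- Consider the class of nonlinear telegraph equations $$f(x)u_{tt}=(g(x)H(u)u_x)_x+h(x)K(u)u_x ,\qquad u=u(t,x), \tag{1}$$ whose arbitrary elements $f,g,h$ (functions of $x$) and $H,K$ (functions of $u$) are smooth real-valued functions on open intervals with $f(x)g(x)H(u)\neq 0$ everywhere and $(H_u,K_u)\not\equiv(0,0)$. A \emph{usual equivalence transformation} of the class, defined on a product $D$ of eight nonempty open intervals (possibly unbounded) in the space of $(t,x,u,f,g,h,H,K)$, is a smooth map with nowhere vanishing Jacobian of the form $$(\tilde t,\tilde x,\tilde u)=(T^t,T^x,T^u)(t,x,u),\qquad (\tilde f,\tilde g,\tilde h,\tilde H,\tilde K)=(T^f,T^g,T^h,T^H,T^K)(t,x,u,f,g,h,H,K)$$ which transforms every equation (1) of the class whose arbitrary elements have domains and values given by the sides of $D$ to an equation of the same class for $\tilde u=\tilde u(\tilde t,\tilde x)$ with arbitrary elements $\tilde f(\tilde x),\tilde g(\tilde x),\tilde h(\tilde x),\tilde H(\tilde u),\tilde K(\tilde u)$, that is: the values of $T^f,T^g,T^h$ and of $T^H,T^K$ along the given arbitrary elements are functions of $\tilde x$ alone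 and of $\tilde u$ alone respectively; these functions satisfy the conditions of the class on the ranges of $T^x$ and of $T^u$; and, whenever the transformation maps the graph of a smooth function $u$ near a point to the graph of a smooth function $\tilde u$ (with $\tilde t,\tilde x$ as local coordinates on it), $u$ satisfies the original equation at this point if and only if $\tilde u$ satisfies the new one at the image point. The (local) usual equivalence group $G^\sim$ is formed by these transformations. \textbf{Theorem.} For every such $D$, the transformations in $G^\sim$ defined on $D$ are exactly the maps given on $D$ by $$\tilde t=\delta_1t+\delta_2,\quad \tilde x=X(x),\quad \tilde u=\delta_3u+\delta_4,$$ $$\tilde f=\frac{\epsilon_1\delta_1^2}{X_x}f,\quad \tilde g=\epsilon_1\epsilon_2^{-1}X_x\,g,\quad \tilde h=\epsilon_1\epsilon_3^{-1}h,\quad \tilde H=\epsilon_2H,\quad \tilde K=\epsilon_3K,$$ where $\delta_1,\dots,\delta_4$ and $\epsilon_1,\epsilon_2,\epsilon_3$ are arbitrary real constants with $\delta_1\delta_3\epsilon_1\epsilon_2\epsilon_3\neq0$, and $X$ is an arbitrary smooth function of $x$ on the $x$-side of $D$ with $X_x\neq0$ everywhere. -/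

import Mathlib

open Topology
open scoped ContDiff

namespace Telegraph

/-- The space of the variables `(t, x, u)`. -/
abbrev Base : Type := ℝ × ℝ × ℝ

/-- The space of the values `(f, g, h, H, K)` of the arbitrary elements. -/
abbrev Elem : Type := ℝ × ℝ × ℝ × ℝ × ℝ

/-- A nonempty open interval of the real line, bounded or not. -/
def IsOpenInterval (s : Set ℝ) : Prop :=
  s.Nonempty ∧ IsOpen s ∧ s.OrdConnected

/-- An open box in the space of `(t, x, u, f, g, h, H, K)`: one nonempty open interval
for each of the eight coordinates. The whole space is the box with all sides `Set.univ`. -/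
structure Box where
  It : Set ℝ
  Ix : Set ℝ
  Iu : Set ℝ
  If : Set ℝ
  Ig : Set ℝ
  Ih : Set ℝ
  IH : Set ℝ
  IK : Set ℝ
  isOpenInterval_t : IsOpenInterval It
  isOpenInterval_x : IsOpenInterval Ix
  isOpenInterval_u : IsOpenInterval Iu
  isOpenInterval_f : IsOpenInterval If
  isOpenInterval_g : IsOpenInterval Ig
  isOpenInterval_h : IsOpenInterval Ih
  isOpenInterval_H : IsOpenInterval IH
  isOpenInterval_K : IsOpenInterval IK

/-- The projection of the box on the space of `(t, x, u)`. -/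
def Box.base (D : Box) : Set Base := D.It ×ˢ D.Ix ×ˢ D.Iu

/-- The projection of the box on the space of `(f, g, h, H, K)`. -/
def Box.elem (D : Box) : Set Elem := D.If ×ˢ D.Ig ×ˢ D.Ih ×ˢ D.IH ×ˢ D.IK

/-- A tuple of arbitrary elements `f(x), g(x), h(x), H(u), K(u)`. -/
structure ArbitraryElements where
  f : ℝ → ℝ
  g : ℝ → ℝ
  h : ℝ → ℝ
  H : ℝ → ℝ
  K : ℝ → ℝ

/-- The values `(f(x), g(x), h(x), H(u), K(u))` at the point `(t, x, u)`. -/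
def ArbitraryElements.val (θ : ArbitraryElements) (p : Base) : Elem :=
  (θ.f p.2.1, θ.g p.2.1, θ.h p.2.1, θ.H p.2.2, θ.K p.2.2)

/-- `θ` is the tuple of arbitrary elements of an equation of the class, for `x` ranging over `J`
and `u` over `L`: the functions are smooth, `f g H` vanishes nowhere, and `H_u`, `K_u` are not
both identically zero. -/
structure ArbitraryElements.InClass (θ : ArbitraryElements) (J L : Set ℝ) : Prop where
  smooth_f : ContDiffOn ℝ ∞ θ.f J
  smooth_g : ContDiffOn ℝ ∞ θ.g J
  smooth_h : ContDiffOn ℝ ∞ θ.h J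
  smooth_H : ContDiffOn ℝ ∞ θ.H L
  smooth_K : ContDiffOn ℝ ∞ θ.K L
  f_ne_zero : ∀ x ∈ J, θ.f x ≠ 0
  g_ne_zero : ∀ x ∈ J, θ.g x ≠ 0
  H_ne_zero : ∀ u ∈ L, θ.H u ≠ 0
  nonlinear : ∃ u ∈ L, deriv θ.H u ≠ 0 ∨ deriv θ.K u ≠ 0

/-- The function `u = u(t, x)` satisfies, at the point `(t, x)`, the equation
`f(x) u_tt = (g(x) H(u) u_x)_x + h(x) K(u) u_x`. -/
def ArbitraryElements.HoldsAt (θ : ArbitraryElements) (u : ℝ → ℝ → ℝ) (t x : ℝ) : Prop :=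
  θ.f x * iteratedDeriv 2 (fun s => u s x) t =
    deriv (fun y => θ.g y * θ.H (u t y) * deriv (fun z => u t z) y) x
      + θ.h x * θ.K (u t x) * deriv (fun z => u t z) x

/-- A map of the space of `(t, x, u, f, g, h, H, K)` that is projectible on the space of
`(t, x, u)`: the new `(t, x, u)` are `base (t, x, u)`, and the new `(f, g, h, H, K)` are
`elem (t, x, u) (f, g, h, H, K)`. -/
structure ProjectibleMap where
  base : Base → Base
  elem : Base → Elem → Elem

/-- The map of the whole space of `(t, x, u, f, g, h, H, K)`. -/
def ProjectibleMap.total (T : ProjectibleMap) (q : Base × Elem) : Base × Elem :=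
  (T.base q.1, T.elem q.1 q.2)

/-- The new independent variables at the point of the graph of `u` over `(t, x)`. -/
def ProjectibleMap.newIndep (T : ProjectibleMap) (u : ℝ → ℝ → ℝ) (z : ℝ × ℝ) : ℝ × ℝ :=
  ((T.base (z.1, z.2, u z.1 z.2)).1, (T.base (z.1, z.2, u z.1 z.2)).2.1)

/-- The new dependent variable at the point of the graph of `u` over `(t, x)`. -/
def ProjectibleMap.newDep (T : ProjectibleMap) (u : ℝ → ℝ → ℝ) (z : ℝ × ℝ) : ℝ :=
  (T.base (z.1, z.2, u z.1 z.2)).2.2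

/-- The change of variables `T.base` on `D.base` turns the equation with arbitrary elements `θ`
for `u = u(t, x)` into the equation with arbitrary elements `θ'` for the new unknown function `v`
of the new independent variables. That is, whenever `T.base` carries the graph of a smooth
function `u` near a point to the graph of a smooth function `v` (the new independent variables
being local coordinates on the graph), the first equation holds for `u` at this point
if and only if the second one holds for `v` at the image point. -/
def ProjectibleMap.TransformsEquation (T : ProjectibleMap) (D : Box)
    (θ θ' : ArbitraryElements) : Prop :=
  ∀ (u v : ℝ → ℝ → ℝ) (t x : ℝ), (t, x, u t x) ∈ D.base →
    ContDiffAt ℝ ∞ (fun z : ℝ × ℝ => u z.1 z.2) (t, x) →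
    (fderiv ℝ (T.newIndep u) (t, x)).det ≠ 0 →
    ContDiffAt ℝ ∞ (fun z : ℝ × ℝ => v z.1 z.2) (T.newIndep u (t, x)) →
    (∀ᶠ z in 𝓝 (t, x), v (T.newIndep u z).1 (T.newIndep u z).2 = T.newDep u z) →
    (θ.HoldsAt u t x ↔ θ'.HoldsAt v (T.newIndep u (t, x)).1 (T.newIndep u (t, x)).2)

/-- `T`, with domain the box `D`, is a usual equivalence transformation of the class: it is a
nondegenerate (smooth, with nonzero Jacobian) point transformation of the space of
`(t, x, u, f, g, h, H, K)`, projectible on the space of `(t, x, u)`, and it transforms any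
equation of the class (with arbitrary elements taking values in the domain) to an equation of the
same class, whose arbitrary elements are the functions of the new `x` and of the new `u`
given by `T.elem`. -/
structure IsUsualEquivalenceTransformation (D : Box) (T : ProjectibleMap) : Prop where
  smooth : ContDiffOn ℝ ∞ T.total (D.base ×ˢ D.elem)
  nondegenerate : ∀ q ∈ D.base ×ˢ D.elem, (fderiv ℝ T.total q).det ≠ 0
  preserves : ∀ θ : ArbitraryElements, θ.InClass D.Ix D.Iu →
    (∀ p ∈ D.base, θ.val p ∈ D.elem) →
    ∃ θ' : ArbitraryElements,
      θ'.InClass ((fun p => (T.base p).2.1) '' D.base) ((fun p => (T.base p).2.2) '' D.base) ∧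
      (∀ p ∈ D.base, θ'.val (T.base p) = T.elem p (θ.val p)) ∧
      T.TransformsEquation D θ θ'

/-- The usual equivalence group of the class, as the set of the usual equivalence
transformations with domain the box `D`. -/
def usualEquivalenceGroup (D : Box) : Set ProjectibleMap :=
  {T | IsUsualEquivalenceTransformation D T}

end Telegraph

/-! Suppose first that zero lies in none of the sides for `f`, `g`, `H` (`Box.Regular`). Then smooth
functions with values in the sides are admissible arbitrary elements as soon as `K` is nonconstant
on the `u`-side, so their values at two points with different `x` (or different `u`) can be
prescribed independently. If two different `x` gave the same new `x`, the new `f, g, h` at a point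
could not react to the old ones, against the nonzero Jacobian; hence, by connectedness, the new `x`
is a function `X` of `x` (`newX_eq`). In the same way the new `u` is a function `U` of `u`
(`newU_eq`), the new `f, g, h` depend on `x, f, g, h` only, and the new `H, K` on `u, H, K` only.

The equations are then compared on test functions: quadratic polynomials in the new `t, x`, pulled
back by the implicit function theorem (`exists_preimage_equation`). The mixed derivative occurs in
no equation of the class, so the new `t` is a function `S` of `t` (`fderiv_newT`); parity in the
first `t`-derivative makes `S` and `U` affine (`deriv_deriv_eq_zero`). What remains is one relation
between the second-order coefficients and one between the first-order coefficients
(`principal_relation`, `subprincipal_relation`).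

The first-order relation contains the derivative of the new `g` along the given elements. The
derivatives of `f, g, h` in it are free, so the new `g` is `k x * g`. The second-order relation then
makes the new `H` a constant multiple of `H`. Finally the product of the new `h` and the new `K` is
a multiple of `h * K` plus a term without `h` and `K`; a product of a function of `h` and a function
of `K` leaves no room for that term, which gives `k = C * X'` and then the formulas for `h` and `K`.

If zero lies in a side for `f`, `g` or `H`, the box is cut there, the formulas hold on both halves,
and continuity on the common wall identifies the constants (`HasForm.glue`). Conversely, for maps of
this form the new equation is the old one times a nonzero factor (`HasForm.transformsEquation`). -/

namespace Telegraph

/-! ### Second-order jets of functions of one variable -/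

/-- The function `φ` is differentiable near `a`, and `d₁`, `d₂` are the values at `a` of its first
and second derivatives. -/
def HasJetAt (φ : ℝ → ℝ) (a d₁ d₂ : ℝ) : Prop :=
  ∃ φ' : ℝ → ℝ, (∀ᶠ s in 𝓝 a, HasDerivAt φ (φ' s) s) ∧ φ' a = d₁ ∧ HasDerivAt φ' d₂ a

theorem _root_.ContDiffAt.deriv_infty {φ : ℝ → ℝ} {a : ℝ} (h : ContDiffAt ℝ ∞ φ a) :
    ContDiffAt ℝ ∞ (deriv φ) a := by
  have : deriv φ = fun s => fderiv ℝ φ s 1 := by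
    ext s
    exact (fderiv_apply_one_eq_deriv (f := φ)).symm
  rw [this]
  exact (h.fderiv_right (m := ∞) (by simp)).clm_apply contDiffAt_const

namespace HasJetAt

variable {φ ψ : ℝ → ℝ} {a c d₁ d₂ e₁ e₂ : ℝ}

theorem hasDerivAt (h : HasJetAt φ a d₁ d₂) : HasDerivAt φ d₁ a := by
  obtain ⟨φ', h1, rfl, -⟩ := h
  exact h1.self_of_nhds

theorem deriv_eq (h : HasJetAt φ a d₁ d₂) : deriv φ a = d₁ := h.hasDerivAt.deriv

theorem hasDerivAt_deriv (h : HasJetAt φ a d₁ d₂) : HasDerivAt (deriv φ) d₂ a := by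
  obtain ⟨φ', h1, -, h2⟩ := h
  exact h2.congr_of_eventuallyEq (h1.mono fun s hs => hs.deriv)

theorem iteratedDeriv_two (h : HasJetAt φ a d₁ d₂) : iteratedDeriv 2 φ a = d₂ := by
  rw [iteratedDeriv_succ, iteratedDeriv_one]
  exact h.hasDerivAt_deriv.deriv

theorem fst_unique (h : HasJetAt φ a d₁ d₂) (h' : HasJetAt φ a e₁ e₂) : d₁ = e₁ :=
  h.hasDerivAt.unique h'.hasDerivAt

theorem snd_unique (h : HasJetAt φ a d₁ d₂) (h' : HasJetAt φ a e₁ e₂) : d₂ = e₂ :=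
  h.hasDerivAt_deriv.unique h'.hasDerivAt_deriv

theorem congr (h : HasJetAt φ a d₁ d₂) (e : ψ =ᶠ[𝓝 a] φ) : HasJetAt ψ a d₁ d₂ := by
  obtain ⟨φ', h1, h2, h3⟩ := h
  refine ⟨φ', ?_, h2, h3⟩
  filter_upwards [h1, e.eventuallyEq_nhds] with s hs hes
  exact hs.congr_of_eventuallyEq hes

theorem of_contDiffAt (h : ContDiffAt ℝ ∞ φ a) : HasJetAt φ a (deriv φ a) (deriv (deriv φ) a) := by
  refine ⟨deriv φ, ?_, rfl, ?_⟩
  · have h1 : ContDiffAt ℝ 1 φ a := h.of_le (by simp)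
    filter_upwards [h1.eventually (by simp)] with s hs
    exact (hs.differentiableAt (by simp)).hasDerivAt
  · exact (h.deriv_infty.differentiableAt (by simp)).hasDerivAt

theorem const (a c : ℝ) : HasJetAt (fun _ => c) a 0 0 :=
  ⟨fun _ => 0, Filter.Eventually.of_forall fun s => hasDerivAt_const s c, rfl, hasDerivAt_const a 0⟩

theorem id (a : ℝ) : HasJetAt (fun s => s) a 1 0 :=
  ⟨fun _ => 1, Filter.Eventually.of_forall fun s => hasDerivAt_id s, rfl, hasDerivAt_const a 1⟩

theorem add (h : HasJetAt φ a d₁ d₂) (h' : HasJetAt ψ a e₁ e₂) :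
    HasJetAt (fun s => φ s + ψ s) a (d₁ + e₁) (d₂ + e₂) := by
  obtain ⟨φ', h1, rfl, h3⟩ := h
  obtain ⟨ψ', k1, rfl, k3⟩ := h'
  refine ⟨fun s => φ' s + ψ' s, ?_, rfl, h3.add k3⟩
  filter_upwards [h1, k1] with s hs ks using hs.add ks

theorem mul (h : HasJetAt φ a d₁ d₂) (h' : HasJetAt ψ a e₁ e₂) :
    HasJetAt (fun s => φ s * ψ s) a (d₁ * ψ a + φ a * e₁)
      (d₂ * ψ a + 2 * d₁ * e₁ + φ a * e₂) := by
  obtain ⟨φ', h1, rfl, h3⟩ := h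
  obtain ⟨ψ', k1, rfl, k3⟩ := h'
  refine ⟨fun s => φ' s * ψ s + φ s * ψ' s, ?_, rfl, ?_⟩
  · filter_upwards [h1, k1] with s hs ks using hs.mul ks
  · exact ((h3.mul k1.self_of_nhds).add (h1.self_of_nhds.mul k3)).congr_deriv (by ring)

theorem const_mul (c : ℝ) (h : HasJetAt φ a d₁ d₂) :
    HasJetAt (fun s => c * φ s) a (c * d₁) (c * d₂) := by
  simpa using (const a c).mul h

theorem sub_const (h : HasJetAt φ a d₁ d₂) (c : ℝ) : HasJetAt (fun s => φ s - c) a d₁ d₂ := by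
  simpa [sub_eq_add_neg] using h.add (const a (-c))

theorem comp {F : ℝ → ℝ} (hF : HasJetAt F (φ a) e₁ e₂) (h : HasJetAt φ a d₁ d₂) :
    HasJetAt (fun s => F (φ s)) a (e₁ * d₁) (e₂ * d₁ ^ 2 + e₁ * d₂) := by
  have hc : ContinuousAt φ a := h.hasDerivAt.continuousAt
  obtain ⟨φ', h1, rfl, h3⟩ := h
  obtain ⟨F', k1, rfl, k3⟩ := hF
  refine ⟨fun s => F' (φ s) * φ' s, ?_, rfl, ?_⟩
  · filter_upwards [h1, hc.eventually k1] with s hs ks using ks.comp s hs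
  · exact ((k3.comp a h1.self_of_nhds).mul h3).congr_deriv (by simp only [Function.comp]; ring)

/-- The jet of a quadratic polynomial of two functions that vanish at the point. -/
theorem quadratic {ξ ρ : ℝ → ℝ} {ξ₁ ξ₂ ρ₁ ρ₂ : ℝ} (hξ : HasJetAt ξ a ξ₁ ξ₂)
    (hρ : HasJetAt ρ a ρ₁ ρ₂) (hξ0 : ξ a = 0) (hρ0 : ρ a = 0) (v₀ α β γ c κ : ℝ) :
    HasJetAt (fun y => v₀ + (β * ρ y + γ * ξ y) +
        (α / 2 * (ρ y * ρ y) + c / 2 * (ξ y * ξ y) + κ * (ρ y * ξ y))) a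
      (β * ρ₁ + γ * ξ₁)
      (β * ρ₂ + γ * ξ₂ + α * ρ₁ ^ 2 + c * ξ₁ ^ 2 + 2 * κ * ρ₁ * ξ₁) := by
  have := ((const a v₀).add ((hρ.const_mul β).add (hξ.const_mul γ))).add
    ((((hρ.mul hρ).const_mul (α / 2)).add ((hξ.mul hξ).const_mul (c / 2))).add
      ((hρ.mul hξ).const_mul κ))
  convert this using 1
  · simp only [hξ0, hρ0]; ring
  · simp only [hξ0, hρ0]; ring

end HasJetAt

/-- Expanding the divergence turns the equation at a point into an algebraic relation between
derivatives of `u`; all later comparisons of equations use this form. -/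
theorem ArbitraryElements.holdsAt_iff {θ : ArbitraryElements} {u : ℝ → ℝ → ℝ}
    {t x u₁ u₁₁ u₂ u₂₂ : ℝ} (hg : DifferentiableAt ℝ θ.g x) (hH : DifferentiableAt ℝ θ.H (u t x))
    (ht : HasJetAt (fun s => u s x) t u₁ u₁₁) (hx : HasJetAt (fun y => u t y) x u₂ u₂₂) :
    θ.HoldsAt u t x ↔ θ.f x * u₁₁ = θ.g x * θ.H (u t x) * u₂₂
      + (deriv θ.g x * θ.H (u t x) + θ.h x * θ.K (u t x)) * u₂
      + θ.g x * deriv θ.H (u t x) * u₂ ^ 2 := by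
  have h := ((hg.hasDerivAt.mul (hH.hasDerivAt.comp x hx.hasDerivAt)).mul hx.hasDerivAt_deriv)
  have h' : deriv (fun y => θ.g y * θ.H (u t y) * deriv (fun z => u t z) y) x = _ := h.deriv
  unfold ArbitraryElements.HoldsAt
  rw [h', ht.iteratedDeriv_two, hx.deriv_eq]
  simp only [Function.comp, Pi.mul_apply]
  constructor <;> intro h <;> linear_combination h

/-! ### Auxiliary facts of real analysis -/

/-- A smooth function with values in a given open interval and with prescribed values at two
points and prescribed derivative at the first one. -/
theorem exists_smooth_interpolation {J : Set ℝ} (hJ : IsOpen J) (hJ' : J.OrdConnected)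
    {x₁ x₂ : ℝ} (hx : x₁ ≠ x₂) {a₁ a₂ : ℝ} (h₁ : a₁ ∈ J) (h₂ : a₂ ∈ J) (d : ℝ) :
    ∃ φ : ℝ → ℝ, ContDiff ℝ ∞ φ ∧ (∀ x, φ x ∈ J) ∧ φ x₁ = a₁ ∧ HasDerivAt φ d x₁ ∧ φ x₂ = a₂ := by
  obtain ⟨ε, hε, hball⟩ := Metric.isOpen_iff.1 hJ a₁ h₁
  set η := ε / 2 with hη
  have hη0 : 0 < η := by positivity
  set m := Real.pi / 2 / (x₂ - x₁) with hm
  have hxx : x₂ - x₁ ≠ 0 := sub_ne_zero.2 hx.symm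
  -- `A` has slope `d` at `x₁` and stays within `η < ε` of `a₁`. `S` takes values in `[0, 1]`,
  -- vanishes at `x₁` together with its derivative, and equals 1 at `x₂` because `m * (x₂ - x₁) = π
  -- / 2`. The answer is the convex combination of `A` and `a₂` with weight `S`.
  let A : ℝ → ℝ := fun x => a₁ + η * Real.sin (d / η * (x - x₁))
  let S : ℝ → ℝ := fun x => Real.sin (m * (x - x₁)) ^ 2
  have hA : ∀ x, A x ∈ J := fun x => hball (by
    rw [Metric.mem_ball, Real.dist_eq]
    have : A x - a₁ = η * Real.sin (d / η * (x - x₁)) := by simp [A]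
    rw [this, abs_mul, abs_of_pos hη0]
    have := Real.abs_sin_le_one (d / η * (x - x₁))
    nlinarith)
  have hlin : ∀ k : ℝ, HasDerivAt (fun x => k * (x - x₁)) k x₁ := fun k => by
    simpa using ((hasDerivAt_id x₁).sub_const x₁).const_mul k
  have hA' : HasDerivAt A d x₁ := by
    refine ((((hlin (d / η)).sin).const_mul η).const_add a₁).congr_deriv ?_
    simp only [sub_self, mul_zero, Real.cos_zero]
    field_simp
  have hS' : HasDerivAt S 0 x₁ := by
    refine (((hlin m).sin).pow 2).congr_deriv ?_
    simp
  refine ⟨fun x => A x * (1 - S x) + a₂ * S x, ?_, fun x => ?_, ?_, ?_, ?_⟩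
  · simp only [A, S]
    fun_prop
  · have h0 : 0 ≤ S x := sq_nonneg _
    have h1 : S x ≤ 1 := by
      have := Real.sin_sq_le_one (m * (x - x₁))
      simpa [S] using this
    have hc : Convex ℝ J := hJ'.convex
    have := hc (hA x) h₂ (sub_nonneg.2 h1) h0 (by ring)
    simp only [smul_eq_mul] at this
    convert this using 1
    ring
  · simp [A, S]
  · refine ((hA'.mul (hS'.const_sub 1)).add (hS'.const_mul a₂)).congr_deriv ?_
    simp [S]
  · have : S x₂ = 1 := by
      simp only [S, hm]
      rw [div_mul_cancel₀ _ hxx, Real.sin_pi_div_two]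
      norm_num
    simp [this]

/-- The implicit function theorem for a scalar unknown. -/
theorem exists_implicit_function {F : (ℝ × ℝ) × ℝ → ℝ} {z₀ : ℝ × ℝ} {u₀ F₁ : ℝ}
    (hF : ContDiffAt ℝ ∞ F (z₀, u₀)) (hd : HasDerivAt (fun s => F (z₀, s)) F₁ u₀) (h0 : F₁ ≠ 0) :
    ∃ u : ℝ × ℝ → ℝ, u z₀ = u₀ ∧ ContDiffAt ℝ ∞ u z₀ ∧
      ∀ᶠ z in 𝓝 z₀, F (z, u z) = F (z₀, u₀) := by
  have hfd : HasFDerivAt F (fderiv ℝ F (z₀, u₀)) (z₀, u₀) :=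
    (hF.differentiableAt (by simp)).hasFDerivAt
  have hcomp : HasFDerivAt (fun s => F (z₀, s))
      (fderiv ℝ F (z₀, u₀) ∘L ContinuousLinearMap.inr ℝ (ℝ × ℝ) ℝ) u₀ :=
    HasFDerivAt.comp u₀ hfd (hasFDerivAt_prodMk_right z₀ u₀)
  have heq := hcomp.unique hd.hasFDerivAt
  have hinv : (fderiv ℝ F (z₀, u₀) ∘L ContinuousLinearMap.inr ℝ (ℝ × ℝ) ℝ).IsInvertible := by
    rw [heq]
    refine ⟨ContinuousLinearEquiv.unitsEquivAut ℝ (Units.mk0 F₁ h0), ?_⟩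
    ext
    simp
  exact ⟨hF.implicitFunction (by simp) hinv, hF.implicitFunction_apply_self (by simp) hinv,
    hF.contDiffAt_implicitFunction (by simp) hinv,
    hF.eventually_apply_implicitFunction (by simp) hinv⟩

/-- If the values of `F` for distinct first arguments are distinct, then `F` does not depend on
the second argument. -/
theorem eq_of_disjoint_values {E : Type*} [TopologicalSpace E] {I : Set ℝ} {S : Set E}
    {F : ℝ → E → ℝ} (hI : IsOpen I) (hS : IsPreconnected S)
    (hF : ∀ x ∈ I, ContinuousOn (F x) S) (hF' : ∀ x ∈ I, ∀ y ∈ S, ContinuousAt (fun x => F x y) x)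
    (hne : ∀ x ∈ I, ∀ x' ∈ I, x ≠ x' → ∀ y ∈ S, ∀ y' ∈ S, F x y ≠ F x' y') :
    ∀ x ∈ I, ∀ y ∈ S, ∀ y' ∈ S, F x y = F x y' := by
  suffices h : ∀ x ∈ I, ∀ y ∈ S, ∀ y' ∈ S, ¬ F x y < F x y' from fun x hx y hy y' hy' =>
    le_antisymm (not_lt.1 (h x hx y' hy' y hy)) (not_lt.1 (h x hx y hy y' hy'))
  intro x hx y hy y' hy' hlt
  obtain ⟨c, hc1, hc2⟩ := exists_between hlt
  -- The strict inequalities around `c` persist for nearby `x'`, so `F x` and `F x'` both attain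
  -- `c`, against the disjointness of their values.
  have hiv : ∀ x ∈ I, F x y < c → c < F x y' → ∃ z ∈ S, F x z = c := fun x hx h1 h2 =>
    hS.intermediate_value hy hy' (hF x hx) ⟨h1.le, h2.le⟩
  have hev : ∀ᶠ x' in 𝓝 x, x' ∈ I ∧ F x' y < c ∧ c < F x' y' :=
    (hI.eventually_mem hx).and (((hF' x hx y hy).eventually_lt_const hc1).and
      ((hF' x hx y' hy').eventually_const_lt hc2))
  obtain ⟨x', ⟨hx', h1, h2⟩, hxx'⟩ :=
    ((hev.filter_mono nhdsWithin_le_nhds).and (self_mem_nhdsWithin (s := {x}ᶜ))).exists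
  obtain ⟨z, hz, hzc⟩ := hiv x hx hc1 hc2
  obtain ⟨z', hz', hzc'⟩ := hiv x' hx' h1 h2
  exact hne x hx x' hx' (fun h => hxx' h.symm) z hz z' hz' (hzc.trans hzc'.symm)

/-! ### Arbitrary elements with prescribed values -/

/-- A smooth function with values in the set `J`. -/
structure SmoothInto (J : Set ℝ) (φ : ℝ → ℝ) : Prop where
  smooth : ContDiff ℝ ∞ φ
  mem : ∀ x, φ x ∈ J

theorem SmoothInto.const {J : Set ℝ} {a : ℝ} (ha : a ∈ J) : SmoothInto J fun _ => a :=
  ⟨contDiff_const, fun _ => ha⟩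

theorem IsOpenInterval.exists_interpolation {J : Set ℝ} (hJ : IsOpenInterval J) {x₁ x₂ : ℝ}
    (hx : x₁ ≠ x₂) {a₁ a₂ : ℝ} (h₁ : a₁ ∈ J) (h₂ : a₂ ∈ J) (d : ℝ) :
    ∃ φ : ℝ → ℝ, SmoothInto J φ ∧ φ x₁ = a₁ ∧ HasDerivAt φ d x₁ ∧ φ x₂ = a₂ := by
  obtain ⟨φ, h1, h2, h3⟩ := exists_smooth_interpolation hJ.2.1 hJ.2.2 hx h₁ h₂ d
  exact ⟨φ, ⟨h1, h2⟩, h3⟩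

theorem IsOpenInterval.exists_jet {J : Set ℝ} (hJ : IsOpenInterval J) (x : ℝ) {a : ℝ}
    (ha : a ∈ J) (d : ℝ) :
    ∃ φ : ℝ → ℝ, SmoothInto J φ ∧ φ x = a ∧ HasDerivAt φ d x := by
  obtain ⟨φ, h1, h2, h3, -⟩ := hJ.exists_interpolation (lt_add_one x).ne ha ha d
  exact ⟨φ, h1, h2, h3⟩

theorem IsOpenInterval.exists_ne_ne {J : Set ℝ} (hJ : IsOpenInterval J) (a b : ℝ) :
    ∃ c ∈ J, c ≠ a ∧ c ≠ b := by
  obtain ⟨y, hy⟩ := hJ.1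
  have hinf : J.Infinite := infinite_of_mem_nhds y (hJ.2.1.mem_nhds hy)
  obtain ⟨c, hc, hc'⟩ := hinf.exists_notMem_finset {a, b}
  simp only [Finset.mem_insert, Finset.mem_singleton, not_or] at hc'
  exact ⟨c, hc, hc'⟩

theorem IsOpenInterval.exists_ne {J : Set ℝ} (hJ : IsOpenInterval J) (a : ℝ) : ∃ c ∈ J, c ≠ a := by
  obtain ⟨c, hc, h, -⟩ := hJ.exists_ne_ne a a
  exact ⟨c, hc, h⟩

/-- The sides of the box for `f`, `g` and `H` do not contain zero. -/
structure Box.Regular (D : Box) : Prop where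
  f_ne : ∀ a ∈ D.If, a ≠ 0
  g_ne : ∀ a ∈ D.Ig, a ≠ 0
  H_ne : ∀ a ∈ D.IH, a ≠ 0

theorem Box.isOpen_base (D : Box) : IsOpen D.base :=
  D.isOpenInterval_t.2.1.prod (D.isOpenInterval_x.2.1.prod D.isOpenInterval_u.2.1)

theorem Box.isOpen_elem (D : Box) : IsOpen D.elem :=
  D.isOpenInterval_f.2.1.prod (D.isOpenInterval_g.2.1.prod (D.isOpenInterval_h.2.1.prod
    (D.isOpenInterval_H.2.1.prod D.isOpenInterval_K.2.1)))

theorem Box.mem_base {D : Box} {t x u : ℝ} (ht : t ∈ D.It) (hx : x ∈ D.Ix) (hu : u ∈ D.Iu) :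
    (t, x, u) ∈ D.base := ⟨ht, hx, hu⟩

theorem Box.mem_elem {D : Box} {f g h H K : ℝ} (hf : f ∈ D.If) (hg : g ∈ D.Ig) (hh : h ∈ D.Ih)
    (hH : H ∈ D.IH) (hK : K ∈ D.IK) : (f, g, h, H, K) ∈ D.elem := ⟨hf, hg, hh, hH, hK⟩

/-- The arbitrary elements are smooth functions with values in the sides of the box. -/
structure ArbitraryElements.SmoothInto (θ : ArbitraryElements) (D : Box) : Prop where
  f : Telegraph.SmoothInto D.If θ.f
  g : Telegraph.SmoothInto D.Ig θ.g
  h : Telegraph.SmoothInto D.Ih θ.h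
  H : Telegraph.SmoothInto D.IH θ.H
  K : Telegraph.SmoothInto D.IK θ.K

theorem ArbitraryElements.SmoothInto.val_mem {θ : ArbitraryElements} {D : Box}
    (hθ : θ.SmoothInto D) (p : Base) : θ.val p ∈ D.elem :=
  ⟨hθ.f.mem _, hθ.g.mem _, hθ.h.mem _, hθ.H.mem _, hθ.K.mem _⟩

/-- On a regular box the nonvanishing conditions are automatic, and only nonlinearity needs care.
This is why the tuples constructed below contain a `K` with derivative 1 at some point. -/
theorem ArbitraryElements.SmoothInto.inClass {θ : ArbitraryElements} {D : Box}
    (hθ : θ.SmoothInto D) (hD : D.Regular) {u d : ℝ} (hu : u ∈ D.Iu) (hd : d ≠ 0)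
    (hK : HasDerivAt θ.K d u) : θ.InClass D.Ix D.Iu where
  smooth_f := hθ.f.smooth.contDiffOn
  smooth_g := hθ.g.smooth.contDiffOn
  smooth_h := hθ.h.smooth.contDiffOn
  smooth_H := hθ.H.smooth.contDiffOn
  smooth_K := hθ.K.smooth.contDiffOn
  f_ne_zero := fun _ _ => hD.f_ne _ (hθ.f.mem _)
  g_ne_zero := fun _ _ => hD.g_ne _ (hθ.g.mem _)
  H_ne_zero := fun _ _ => hD.H_ne _ (hθ.H.mem _)
  nonlinear := ⟨u, hu, Or.inr (by rwa [hK.deriv])⟩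

/-! ### The structure of the transformation components -/

/-- The values of the arbitrary elements that are functions of `x`. -/
def fgh (e : Elem) : ℝ × ℝ × ℝ := (e.1, e.2.1, e.2.2.1)

/-- The values of the arbitrary elements that are functions of `u`. -/
def HK (e : Elem) : ℝ × ℝ := e.2.2.2

namespace IsUsualEquivalenceTransformation

variable {D : Box} {T : ProjectibleMap}

theorem hasFDerivAt_total (hT : IsUsualEquivalenceTransformation D T) {p : Base} {e : Elem}
    (hp : p ∈ D.base) (he : e ∈ D.elem) :
    HasFDerivAt T.total (fderiv ℝ T.total (p, e)) (p, e) :=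
  ((hT.smooth.contDiffAt ((D.isOpen_base.prod D.isOpen_elem).mem_nhds ⟨hp, he⟩)).differentiableAt
    (by simp)).hasFDerivAt

theorem fderiv_injective (hT : IsUsualEquivalenceTransformation D T) {p : Base} {e : Elem}
    (hp : p ∈ D.base) (he : e ∈ D.elem) {w : Base × Elem}
    (hw : fderiv ℝ T.total (p, e) w = 0) : w = 0 := by
  by_contra hne
  exact hT.nondegenerate (p, e) ⟨hp, he⟩ (LinearMap.det_eq_zero_iff_ker_ne_bot.2
    fun hker => hne ((LinearMap.ker_eq_bot'.1 hker) w hw))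

theorem contDiffAt_base (hT : IsUsualEquivalenceTransformation D T) {p : Base}
    (hp : p ∈ D.base) : ContDiffAt ℝ ∞ T.base p := by
  obtain ⟨f, hf⟩ := D.isOpenInterval_f.1
  obtain ⟨g, hg⟩ := D.isOpenInterval_g.1
  obtain ⟨h, hh⟩ := D.isOpenInterval_h.1
  obtain ⟨H, hH⟩ := D.isOpenInterval_H.1
  obtain ⟨K, hK⟩ := D.isOpenInterval_K.1
  have he := Box.mem_elem hf hg hh hH hK
  have h1 : ContDiffAt ℝ ∞ T.total (p, (f, g, h, H, K)) :=
    hT.smooth.contDiffAt ((D.isOpen_base.prod D.isOpen_elem).mem_nhds ⟨hp, he⟩)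
  have h2 : ContDiffAt ℝ ∞ (fun q : Base => (q, ((f, g, h, H, K) : Elem))) p := by fun_prop
  exact (ContDiffAt.comp p h1 h2).fst

theorem contDiffAt_elem (hT : IsUsualEquivalenceTransformation D T) {p : Base} {e : Elem}
    (hp : p ∈ D.base) (he : e ∈ D.elem) :
    ContDiffAt ℝ ∞ (fun q : Base × Elem => T.elem q.1 q.2) (p, e) :=
  (hT.smooth.contDiffAt ((D.isOpen_base.prod D.isOpen_elem).mem_nhds ⟨hp, he⟩)).snd

theorem fgh_eq_of_newX_eq (hT : IsUsualEquivalenceTransformation D T) {θ : ArbitraryElements}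
    (hθ : θ.InClass D.Ix D.Iu) (hD : ∀ p ∈ D.base, θ.val p ∈ D.elem) {p p' : Base}
    (hp : p ∈ D.base) (hp' : p' ∈ D.base) (h : (T.base p).2.1 = (T.base p').2.1) :
    fgh (T.elem p (θ.val p)) = fgh (T.elem p' (θ.val p')) := by
  obtain ⟨θ', -, hval, -⟩ := hT.preserves θ hθ hD
  rw [← hval p hp, ← hval p' hp']
  simp only [ArbitraryElements.val, fgh, h]

theorem HK_eq_of_newU_eq (hT : IsUsualEquivalenceTransformation D T) {θ : ArbitraryElements}
    (hθ : θ.InClass D.Ix D.Iu) (hD : ∀ p ∈ D.base, θ.val p ∈ D.elem) {p p' : Base}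
    (hp : p ∈ D.base) (hp' : p' ∈ D.base) (h : (T.base p).2.2 = (T.base p').2.2) :
    HK (T.elem p (θ.val p)) = HK (T.elem p' (θ.val p')) := by
  obtain ⟨θ', -, hval, -⟩ := hT.preserves θ hθ hD
  rw [← hval p hp, ← hval p' hp']
  simp only [ArbitraryElements.val, HK, h]

/-- The new `f, g, h` at a given point are not independent of `f, g, h`. -/
theorem not_fgh_const (hT : IsUsualEquivalenceTransformation D T) {p : Base} (hp : p ∈ D.base)
    {H K : ℝ} (hH : H ∈ D.IH) (hK : K ∈ D.IK) (c : ℝ × ℝ × ℝ)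
    (hc : ∀ f ∈ D.If, ∀ g ∈ D.Ig, ∀ h ∈ D.Ih, fgh (T.elem p (f, g, h, H, K)) = c) : False := by
  obtain ⟨f, hf⟩ := D.isOpenInterval_f.1
  obtain ⟨g, hg⟩ := D.isOpenInterval_g.1
  obtain ⟨h, hh⟩ := D.isOpenInterval_h.1
  have he := Box.mem_elem hf hg hh hH hK
  let ℓ : ℝ × ℝ × ℝ →L[ℝ] Base × Elem :=
    (0 : ℝ × ℝ × ℝ →L[ℝ] Base).prod ((ContinuousLinearMap.fst ℝ ℝ (ℝ × ℝ)).prod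
      (((ContinuousLinearMap.fst ℝ ℝ ℝ).comp (ContinuousLinearMap.snd ℝ ℝ (ℝ × ℝ))).prod
        (((ContinuousLinearMap.snd ℝ ℝ ℝ).comp (ContinuousLinearMap.snd ℝ ℝ (ℝ × ℝ))).prod
          (0 : ℝ × ℝ × ℝ →L[ℝ] ℝ × ℝ))))
  have hι : HasFDerivAt (fun v : ℝ × ℝ × ℝ => ((p, (v.1, v.2.1, v.2.2, H, K)) : Base × Elem)) ℓ
      (f, g, h) := by
    refine (hasFDerivAt_const p _).prodMk (hasFDerivAt_fst.prodMk
      ((hasFDerivAt_fst.comp (f, g, h) hasFDerivAt_snd).prodMk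
        ((hasFDerivAt_snd.comp (f, g, h) hasFDerivAt_snd).prodMk (hasFDerivAt_const (H, K) _))))
  set L := fderiv ℝ T.total (p, (f, g, h, H, K)) with hL
  have hΨ : HasFDerivAt (fun v : ℝ × ℝ × ℝ => T.total (p, (v.1, v.2.1, v.2.2, H, K)))
      (L.comp ℓ) (f, g, h) :=
    HasFDerivAt.comp (g := T.total) (g' := L) (f, g, h) (hT.hasFDerivAt_total hp he) hι
  have hbase : ∀ v, (L (ℓ v)).1 = 0 := fun v => by
    have h1 := hΨ.fst.unique (hasFDerivAt_const (T.base p) (f, g, h))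
    exact congrArg (fun A : ℝ × ℝ × ℝ →L[ℝ] Base => A v) h1
  have hfgh : ∀ v, fgh (L (ℓ v)).2 = 0 := fun v => by
    have hs := hΨ.snd
    have h1 := hs.fst.prodMk (hs.snd.fst.prodMk hs.snd.snd.fst)
    have h2 : HasFDerivAt (fun v : ℝ × ℝ × ℝ => fgh (T.elem p (v.1, v.2.1, v.2.2, H, K)))
        (0 : ℝ × ℝ × ℝ →L[ℝ] ℝ × ℝ × ℝ) (f, g, h) := by
      refine (hasFDerivAt_const c _).congr_of_eventuallyEq ?_
      filter_upwards [(D.isOpenInterval_f.2.1.prod (D.isOpenInterval_g.2.1.prod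
        D.isOpenInterval_h.2.1)).mem_nhds (show (f, g, h) ∈ _ from ⟨hf, hg, hh⟩)] with v hv
      exact hc v.1 hv.1 v.2.1 hv.2.1 v.2.2 hv.2.2
    exact congrArg (fun A : ℝ × ℝ × ℝ →L[ℝ] ℝ × ℝ × ℝ => A v) (h1.unique h2)
  -- In the three directions of `f, g, h` the derivative of the map has only the two components of
  -- the new `H, K` left. Nondegeneracy would embed a three-dimensional space in a two-dimensional
  -- one.
  let π : ℝ × ℝ × ℝ →ₗ[ℝ] ℝ × ℝ :=
    { toFun := fun v => HK (L (ℓ v)).2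
      map_add' := fun v w => by simp [HK]
      map_smul' := fun a v => by simp [HK] }
  have hπ : Function.Injective π := by
    rw [← LinearMap.ker_eq_bot, LinearMap.ker_eq_bot']
    intro v hv
    have hv' : (L (ℓ v)).2.2.2.2 = 0 := hv
    have hf' := hfgh v
    simp only [fgh, Prod.ext_iff, Prod.fst_zero, Prod.snd_zero] at hf'
    have h0 : L (ℓ v) = 0 :=
      Prod.ext (hbase v) (Prod.ext hf'.1 (Prod.ext hf'.2.1 (Prod.ext hf'.2.2 hv')))
    have h1 := congrArg Prod.snd (hT.fderiv_injective hp he h0)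
    exact Prod.ext (congrArg (fun e : Elem => e.1) h1)
      (Prod.ext (congrArg (fun e : Elem => e.2.1) h1) (congrArg (fun e : Elem => e.2.2.1) h1))
  have := LinearMap.finrank_le_finrank_of_injective hπ
  simp at this

/-- The new arbitrary elements at a given point are not independent of `H`. -/
theorem not_elem_const_H (hT : IsUsualEquivalenceTransformation D T) {p : Base} (hp : p ∈ D.base)
    {f g h K : ℝ} (hf : f ∈ D.If) (hg : g ∈ D.Ig) (hh : h ∈ D.Ih) (hK : K ∈ D.IK) (c : Elem)
    (hc : ∀ H ∈ D.IH, T.elem p (f, g, h, H, K) = c) : False := by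
  obtain ⟨H, hH⟩ := D.isOpenInterval_H.1
  have he := Box.mem_elem hf hg hh hH hK
  have hι : HasDerivAt (fun s : ℝ => ((p, (f, g, h, s, K)) : Base × Elem))
      (0, (0, 0, 0, 1, 0)) H :=
    (hasDerivAt_const H p).prodMk ((hasDerivAt_const H f).prodMk ((hasDerivAt_const H g).prodMk
      ((hasDerivAt_const H h).prodMk ((hasDerivAt_id H).prodMk (hasDerivAt_const H K)))))
  have hΨ := (hT.hasFDerivAt_total hp he).comp_hasDerivAt H hι
  have hconst : HasDerivAt (T.total ∘ fun s : ℝ => ((p, (f, g, h, s, K)) : Base × Elem)) 0 H := by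
    refine (hasDerivAt_const H (T.base p, c)).congr_of_eventuallyEq ?_
    filter_upwards [D.isOpenInterval_H.2.1.mem_nhds hH] with s hs
    exact Prod.ext rfl (hc s hs)
  have h0 := hT.fderiv_injective hp he (hΨ.unique hconst)
  simpa using congrArg (fun w : Base × Elem => w.2.2.2.2.1) h0

/-- If the images had the same new `x`, the new `f, g, h` at `p` would equal those at `p'`. The old
values at `p'` can be kept fixed while those at `p` vary arbitrarily, which contradicts
`not_fgh_const`. -/
theorem newX_ne (hT : IsUsualEquivalenceTransformation D T) (hD : D.Regular) {p p' : Base}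
    (hp : p ∈ D.base) (hp' : p' ∈ D.base) (hx : p.2.1 ≠ p'.2.1) :
    (T.base p).2.1 ≠ (T.base p').2.1 := by
  intro heq
  obtain ⟨f₀, hf₀⟩ := D.isOpenInterval_f.1
  obtain ⟨g₀, hg₀⟩ := D.isOpenInterval_g.1
  obtain ⟨h₀, hh₀⟩ := D.isOpenInterval_h.1
  obtain ⟨H, hH⟩ := D.isOpenInterval_H.1
  obtain ⟨K, hK⟩ := D.isOpenInterval_K.1
  obtain ⟨κ, hκ, hκ1, hκ2⟩ := D.isOpenInterval_K.exists_jet p.2.2 hK 1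
  refine hT.not_fgh_const hp hH hK (fgh (T.elem p' (f₀, g₀, h₀, H, κ p'.2.2))) ?_
  intro f hf g hg h hh
  obtain ⟨φ, hφ, hφ1, -, hφ2⟩ := D.isOpenInterval_f.exists_interpolation hx hf hf₀ 0
  obtain ⟨γ, hγ, hγ1, -, hγ2⟩ := D.isOpenInterval_g.exists_interpolation hx hg hg₀ 0
  obtain ⟨χ, hχ, hχ1, -, hχ2⟩ := D.isOpenInterval_h.exists_interpolation hx hh hh₀ 0
  let θ : ArbitraryElements := ⟨φ, γ, χ, fun _ => H, κ⟩
  have hθ : θ.SmoothInto D := ⟨hφ, hγ, hχ, SmoothInto.const hH, hκ⟩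
  have := hT.fgh_eq_of_newX_eq (hθ.inClass hD hp.2.2 one_ne_zero hκ2)
    (fun p _ => hθ.val_mem p) hp hp' heq
  simpa only [ArbitraryElements.val, θ, hφ1, hφ2, hγ1, hγ2, hχ1, hχ2, hκ1] using this

/-- By `newX_ne` different `x` produce disjoint sets of new `x`; as `(t, u)` ranges over a connected
set, `eq_of_disjoint_values` shrinks each of these sets to a point. -/
theorem newX_eq (hT : IsUsualEquivalenceTransformation D T) (hD : D.Regular) {p p' : Base}
    (hp : p ∈ D.base) (hp' : p' ∈ D.base) (hx : p.2.1 = p'.2.1) :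
    (T.base p).2.1 = (T.base p').2.1 := by
  obtain ⟨t, x, u⟩ := p
  obtain ⟨t', x', u'⟩ := p'
  simp only at hx
  subst hx
  have hcont : ∀ {t x u}, (t, x, u) ∈ D.base → ContinuousAt (fun q => (T.base q).2.1) (t, x, u) :=
    fun h => (hT.contDiffAt_base h).snd.fst.continuousAt
  refine eq_of_disjoint_values (F := fun x (z : ℝ × ℝ) => (T.base (z.1, x, z.2)).2.1)
    (S := D.It ×ˢ D.Iu) D.isOpenInterval_x.2.1
    (D.isOpenInterval_t.2.2.isPreconnected.prod D.isOpenInterval_u.2.2.isPreconnected)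
    ?_ ?_ ?_ x hp.2.1 (t, u) ⟨hp.1, hp.2.2⟩ (t', u') ⟨hp'.1, hp'.2.2⟩
  · intro x hx z hz
    refine ContinuousAt.continuousWithinAt ?_
    exact ContinuousAt.comp (f := fun z : ℝ × ℝ => (z.1, x, z.2)) (hcont ⟨hz.1, hx, hz.2⟩)
      (by fun_prop)
  · intro x hx z hz
    exact ContinuousAt.comp (f := fun x : ℝ => (z.1, x, z.2)) (hcont ⟨hz.1, hx, hz.2⟩)
      (by fun_prop)
  · intro x hx x' hx' hne z hz z' hz'
    exact hT.newX_ne hD ⟨hz.1, hx, hz.2⟩ ⟨hz'.1, hx', hz'.2⟩ hne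

/-- The new `f, g, h` depend on `x, f, g, h` only. -/
theorem fgh_eq (hT : IsUsualEquivalenceTransformation D T) (hD : D.Regular) {p p' : Base}
    {e e' : Elem} (hp : p ∈ D.base) (hp' : p' ∈ D.base) (he : e ∈ D.elem) (he' : e' ∈ D.elem)
    (hx : p.2.1 = p'.2.1) (hee : fgh e = fgh e') : fgh (T.elem p e) = fgh (T.elem p' e') := by
  -- Different values of `H` and `K` can be prescribed at the two points only if their `u` differ.
  -- The general case passes through a third value of `u`.
  have key : ∀ {p p' : Base} {e e' : Elem}, p ∈ D.base → p' ∈ D.base → e ∈ D.elem →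
      e' ∈ D.elem → p.2.1 = p'.2.1 → fgh e = fgh e' → p.2.2 ≠ p'.2.2 →
      fgh (T.elem p e) = fgh (T.elem p' e') := by
    intro p p' e e' hp hp' he he' hx hee hu
    obtain ⟨f, g, h, H, K⟩ := e
    obtain ⟨f', g', h', H', K'⟩ := e'
    simp only [fgh, Prod.mk.injEq] at hee
    obtain ⟨rfl, rfl, rfl⟩ := hee
    obtain ⟨hf, hg, hh, hH, hK⟩ := he
    obtain ⟨-, -, -, hH', hK'⟩ := he'
    obtain ⟨η, hη, hη1, -, hη2⟩ := D.isOpenInterval_H.exists_interpolation hu hH hH' 0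
    obtain ⟨κ, hκ, hκ1, hκ', hκ2⟩ := D.isOpenInterval_K.exists_interpolation hu hK hK' 1
    let θ : ArbitraryElements := ⟨fun _ => f, fun _ => g, fun _ => h, η, κ⟩
    have hθ : θ.SmoothInto D :=
      ⟨SmoothInto.const hf, SmoothInto.const hg, SmoothInto.const hh, hη, hκ⟩
    have := hT.fgh_eq_of_newX_eq (hθ.inClass hD hp.2.2 one_ne_zero hκ')
      (fun p _ => hθ.val_mem p) hp hp' (hT.newX_eq hD hp hp' hx)
    simpa only [ArbitraryElements.val, θ, hη1, hη2, hκ1, hκ2] using this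
  obtain ⟨u, hu, h1, h2⟩ := D.isOpenInterval_u.exists_ne_ne p.2.2 p'.2.2
  have hp'' : (p.1, p.2.1, u) ∈ D.base := ⟨hp.1, hp.2.1, hu⟩
  exact (key hp hp'' he he rfl rfl h1.symm).trans (key hp'' hp' he he' hx hee h2)

/-- The new `H, K` depend on `H, K` only, at points with the same `u`. -/
theorem HK_eq_of_newU (hT : IsUsualEquivalenceTransformation D T) (hD : D.Regular) {p p' : Base}
    {e e' : Elem} (hp : p ∈ D.base) (hp' : p' ∈ D.base) (he : e ∈ D.elem) (he' : e' ∈ D.elem)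
    (hU : (T.base p).2.2 = (T.base p').2.2) (hu : p.2.2 = p'.2.2)
    (hx : p.2.1 ≠ p'.2.1) (hee : HK e = HK e') : HK (T.elem p e) = HK (T.elem p' e') := by
  obtain ⟨f, g, h, H, K⟩ := e
  obtain ⟨f', g', h', H', K'⟩ := e'
  simp only [HK, Prod.mk.injEq] at hee
  obtain ⟨rfl, rfl⟩ := hee
  obtain ⟨hf, hg, hh, hH, hK⟩ := he
  obtain ⟨hf', hg', hh', -, -⟩ := he'
  obtain ⟨φ, hφ, hφ1, -, hφ2⟩ := D.isOpenInterval_f.exists_interpolation hx hf hf' 0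
  obtain ⟨γ, hγ, hγ1, -, hγ2⟩ := D.isOpenInterval_g.exists_interpolation hx hg hg' 0
  obtain ⟨χ, hχ, hχ1, -, hχ2⟩ := D.isOpenInterval_h.exists_interpolation hx hh hh' 0
  obtain ⟨κ, hκ, hκ1, hκ'⟩ := D.isOpenInterval_K.exists_jet p.2.2 hK 1
  let θ : ArbitraryElements := ⟨φ, γ, χ, fun _ => H, κ⟩
  have hθ : θ.SmoothInto D := ⟨hφ, hγ, hχ, SmoothInto.const hH, hκ⟩
  have := hT.HK_eq_of_newU_eq (hθ.inClass hD hp.2.2 one_ne_zero hκ')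
    (fun p _ => hθ.val_mem p) hp hp' hU
  simpa only [ArbitraryElements.val, θ, hφ1, hφ2, hγ1, hγ2, hχ1, hχ2, ← hu, hκ1] using this

/-- The dimension count used for `x` fails here, since two directions fit into three components.
Instead, `fgh_eq` already frees the new `f, g, h` from `H`, so equal images would make all the new
elements independent of `H`. -/
theorem newU_ne (hT : IsUsualEquivalenceTransformation D T) (hD : D.Regular) {p p' : Base}
    (hp : p ∈ D.base) (hp' : p' ∈ D.base) (hu : p.2.2 ≠ p'.2.2) :
    (T.base p).2.2 ≠ (T.base p').2.2 := by
  intro heq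
  obtain ⟨f, hf⟩ := D.isOpenInterval_f.1
  obtain ⟨g, hg⟩ := D.isOpenInterval_g.1
  obtain ⟨h, hh⟩ := D.isOpenInterval_h.1
  obtain ⟨H₀, hH₀⟩ := D.isOpenInterval_H.1
  obtain ⟨K, hK⟩ := D.isOpenInterval_K.1
  obtain ⟨κ, hκ, hκ1, hκ2⟩ := D.isOpenInterval_K.exists_jet p.2.2 hK 1
  have h1 : ∀ H ∈ D.IH, HK (T.elem p (f, g, h, H, K)) =
      HK (T.elem p' (f, g, h, H₀, κ p'.2.2)) := by
    intro H hH
    obtain ⟨η, hη, hη1, -, hη2⟩ := D.isOpenInterval_H.exists_interpolation hu hH hH₀ 0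
    let θ : ArbitraryElements := ⟨fun _ => f, fun _ => g, fun _ => h, η, κ⟩
    have hθ : θ.SmoothInto D :=
      ⟨SmoothInto.const hf, SmoothInto.const hg, SmoothInto.const hh, hη, hκ⟩
    have := hT.HK_eq_of_newU_eq (hθ.inClass hD hp.2.2 one_ne_zero hκ2)
      (fun p _ => hθ.val_mem p) hp hp' heq
    simpa only [ArbitraryElements.val, θ, hη1, hη2, hκ1] using this
  have h2 : ∀ H ∈ D.IH, fgh (T.elem p (f, g, h, H, K)) = fgh (T.elem p (f, g, h, H₀, K)) :=
    fun H hH => hT.fgh_eq hD hp hp (Box.mem_elem hf hg hh hH hK)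
      (Box.mem_elem hf hg hh hH₀ hK) rfl rfl
  refine hT.not_elem_const_H hp hf hg hh hK (T.elem p (f, g, h, H₀, K)) fun H hH => ?_
  have h3 := h2 H hH
  have h4 := (h1 H hH).trans (h1 H₀ hH₀).symm
  simp only [fgh, Prod.ext_iff] at h3
  exact Prod.ext h3.1 (Prod.ext h3.2.1 (Prod.ext h3.2.2 h4))

theorem newU_eq (hT : IsUsualEquivalenceTransformation D T) (hD : D.Regular) {p p' : Base}
    (hp : p ∈ D.base) (hp' : p' ∈ D.base) (hu : p.2.2 = p'.2.2) :
    (T.base p).2.2 = (T.base p').2.2 := by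
  obtain ⟨t, x, u⟩ := p
  obtain ⟨t', x', u'⟩ := p'
  simp only at hu
  subst hu
  have hcont : ∀ {t x u}, (t, x, u) ∈ D.base → ContinuousAt (fun q => (T.base q).2.2) (t, x, u) :=
    fun h => (hT.contDiffAt_base h).snd.snd.continuousAt
  refine eq_of_disjoint_values (F := fun u (z : ℝ × ℝ) => (T.base (z.1, z.2, u)).2.2)
    (S := D.It ×ˢ D.Ix) D.isOpenInterval_u.2.1
    (D.isOpenInterval_t.2.2.isPreconnected.prod D.isOpenInterval_x.2.2.isPreconnected)
    ?_ ?_ ?_ u hp.2.2 (t, x) ⟨hp.1, hp.2.1⟩ (t', x') ⟨hp'.1, hp'.2.1⟩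
  · intro u hu z hz
    refine ContinuousAt.continuousWithinAt ?_
    exact ContinuousAt.comp (f := fun z : ℝ × ℝ => (z.1, z.2, u)) (hcont ⟨hz.1, hz.2, hu⟩)
      (by fun_prop)
  · intro u hu z hz
    exact ContinuousAt.comp (f := fun u : ℝ => (z.1, z.2, u)) (hcont ⟨hz.1, hz.2, hu⟩)
      (by fun_prop)
  · intro u hu u' hu' hne z hz z' hz'
    exact hT.newU_ne hD ⟨hz.1, hz.2, hu⟩ ⟨hz'.1, hz'.2, hu'⟩ hne

/-- The new `H, K` depend on `u, H, K` only. -/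
theorem HK_eq (hT : IsUsualEquivalenceTransformation D T) (hD : D.Regular) {p p' : Base}
    {e e' : Elem} (hp : p ∈ D.base) (hp' : p' ∈ D.base) (he : e ∈ D.elem) (he' : e' ∈ D.elem)
    (hu : p.2.2 = p'.2.2) (hee : HK e = HK e') : HK (T.elem p e) = HK (T.elem p' e') := by
  obtain ⟨x, hx, h1, h2⟩ := D.isOpenInterval_x.exists_ne_ne p.2.1 p'.2.1
  have hp'' : (p.1, x, p.2.2) ∈ D.base := ⟨hp.1, hx, hp.2.2⟩
  exact (hT.HK_eq_of_newU hD hp hp'' he he (hT.newU_eq hD hp hp'' rfl) rfl h1.symm rfl).trans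
    (hT.HK_eq_of_newU hD hp'' hp' he he' (hT.newU_eq hD hp'' hp' hu) hu h2 hee)

/-- The transformation of the variables `t, x, u` is nondegenerate. -/
theorem fderiv_base_injective (hT : IsUsualEquivalenceTransformation D T) {p : Base}
    (hp : p ∈ D.base) {w : Base} (hw : fderiv ℝ T.base p w = 0) : w = 0 := by
  obtain ⟨f, hf⟩ := D.isOpenInterval_f.1
  obtain ⟨g, hg⟩ := D.isOpenInterval_g.1
  obtain ⟨h, hh⟩ := D.isOpenInterval_h.1
  obtain ⟨H, hH⟩ := D.isOpenInterval_H.1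
  obtain ⟨K, hK⟩ := D.isOpenInterval_K.1
  have he := Box.mem_elem hf hg hh hH hK
  set L := fderiv ℝ T.total (p, (f, g, h, H, K)) with hL
  have hd : HasFDerivAt T.total L (p, (f, g, h, H, K)) := hT.hasFDerivAt_total hp he
  have hb : HasFDerivAt T.base (fderiv ℝ T.base p) p :=
    ((hT.contDiffAt_base hp).differentiableAt (by simp)).hasFDerivAt
  have hfst : ∀ v, (L v).1 = fderiv ℝ T.base p v.1 := fun v => by
    have h1 : HasFDerivAt (fun q : Base × Elem => T.base q.1)
        ((fderiv ℝ T.base p).comp (ContinuousLinearMap.fst ℝ Base Elem)) (p, (f, g, h, H, K)) :=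
      HasFDerivAt.comp (p, (f, g, h, H, K)) hb hasFDerivAt_fst
    exact congrArg (fun A : Base × Elem →L[ℝ] Base => A v) (hd.fst.unique h1)
  let C : Elem →ₗ[ℝ] Elem := ((ContinuousLinearMap.snd ℝ Base Elem).comp
    (L.comp (ContinuousLinearMap.inr ℝ Base Elem))).toLinearMap
  have hC : Function.Injective C := by
    rw [← LinearMap.ker_eq_bot, LinearMap.ker_eq_bot']
    intro e hCe
    have h0 : L (0, e) = 0 := Prod.ext (by rw [hfst]; simp) hCe
    exact congrArg Prod.snd (hT.fderiv_injective hp he h0)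
  -- The Jacobian is block triangular. Its block for the arbitrary elements is injective, hence
  -- surjective, so a kernel vector `w` of the base block extends to a kernel vector `(w, e)` of the
  -- whole.
  obtain ⟨e, hCe⟩ := LinearMap.injective_iff_surjective.1 hC (-(L (w, 0)).2)
  have h0 : L (w, e) = 0 := by
    refine Prod.ext (by rw [hfst]; exact hw) ?_
    have h1 : L (w, e) = L (w, 0) + L (0, e) := by rw [← map_add]; simp
    have h2 : (L (0, e)).2 = -(L (w, 0)).2 := hCe
    rw [h1, Prod.snd_add, h2, add_neg_cancel, Prod.snd_zero]
  exact congrArg Prod.fst (hT.fderiv_injective hp he h0)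

end IsUsualEquivalenceTransformation

/-! ### Transformation of test functions -/

/-- On the box, the new `x` and the new `u` are the functions `X` of `x` and `U` of `u`. -/
structure Splits (D : Box) (T : ProjectibleMap) (X U : ℝ → ℝ) : Prop where
  newX : ∀ p ∈ D.base, (T.base p).2.1 = X p.2.1
  newU : ∀ p ∈ D.base, (T.base p).2.2 = U p.2.2

theorem IsUsualEquivalenceTransformation.exists_splits {D : Box} {T : ProjectibleMap}
    (hT : IsUsualEquivalenceTransformation D T) (hD : D.Regular) : ∃ X U, Splits D T X U := by
  obtain ⟨t, ht⟩ := D.isOpenInterval_t.1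
  obtain ⟨x, hx⟩ := D.isOpenInterval_x.1
  obtain ⟨u, hu⟩ := D.isOpenInterval_u.1
  exact ⟨fun y => (T.base (t, y, u)).2.1, fun w => (T.base (t, x, w)).2.2,
    fun p hp => hT.newX_eq hD hp ⟨ht, hp.2.1, hu⟩ rfl,
    fun p hp => hT.newU_eq hD hp ⟨ht, hx, hp.2.2⟩ rfl⟩

/-- The second-degree polynomial in `t - s₀` and `x - y₀` with the given coefficients. -/
noncomputable def quadraticFunction (s₀ y₀ v₀ α β γ c κ : ℝ) (s y : ℝ) : ℝ :=
  v₀ + (β * (s - s₀) + γ * (y - y₀)) +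
    (α / 2 * ((s - s₀) * (s - s₀)) + c / 2 * ((y - y₀) * (y - y₀)) + κ * ((s - s₀) * (y - y₀)))

theorem contDiff_quadraticFunction (s₀ y₀ v₀ α β γ c κ : ℝ) :
    ContDiff ℝ ∞ (fun z : ℝ × ℝ => quadraticFunction s₀ y₀ v₀ α β γ c κ z.1 z.2) := by
  unfold quadraticFunction
  fun_prop

theorem hasJetAt_quadraticFunction_left (s₀ y₀ v₀ α β γ c κ : ℝ) :
    HasJetAt (fun s => quadraticFunction s₀ y₀ v₀ α β γ c κ s y₀) s₀ β α := by
  have := HasJetAt.quadratic (HasJetAt.const s₀ 0) ((HasJetAt.id s₀).sub_const s₀) rfl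
    (sub_self _) v₀ α β γ c κ
  convert this using 1
  · funext s
    simp [quadraticFunction]
  · ring
  · ring

theorem hasJetAt_quadraticFunction_right (s₀ y₀ v₀ α β γ c κ : ℝ) :
    HasJetAt (fun y => quadraticFunction s₀ y₀ v₀ α β γ c κ s₀ y) y₀ γ c := by
  have := HasJetAt.quadratic ((HasJetAt.id y₀).sub_const y₀) (HasJetAt.const y₀ 0)
    (sub_self _) rfl v₀ α β γ c κ
  convert this using 1
  · funext y
    simp [quadraticFunction]
  · ring
  · ring

theorem quadraticFunction_self (s₀ y₀ v₀ α β γ c κ : ℝ) :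
    quadraticFunction s₀ y₀ v₀ α β γ c κ s₀ y₀ = v₀ := by
  simp [quadraticFunction]

namespace Splits

variable {D : Box} {T : ProjectibleMap} {X U : ℝ → ℝ}

theorem contDiffAt_X (hs : Splits D T X U) (hT : IsUsualEquivalenceTransformation D T) {x : ℝ}
    (hx : x ∈ D.Ix) : ContDiffAt ℝ ∞ X x := by
  obtain ⟨t, ht⟩ := D.isOpenInterval_t.1
  obtain ⟨u, hu⟩ := D.isOpenInterval_u.1
  have h1 : ContDiffAt ℝ ∞ (fun y : ℝ => ((t, y, u) : Base)) x := by fun_prop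
  have h2 := (ContDiffAt.comp x (hT.contDiffAt_base (Box.mem_base ht hx hu)) h1).snd.fst
  refine h2.congr_of_eventuallyEq ?_
  filter_upwards [D.isOpenInterval_x.2.1.mem_nhds hx] with y hy
  exact (hs.newX (t, y, u) ⟨ht, hy, hu⟩).symm

theorem contDiffAt_U (hs : Splits D T X U) (hT : IsUsualEquivalenceTransformation D T) {u : ℝ}
    (hu : u ∈ D.Iu) : ContDiffAt ℝ ∞ U u := by
  obtain ⟨t, ht⟩ := D.isOpenInterval_t.1
  obtain ⟨x, hx⟩ := D.isOpenInterval_x.1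
  have h1 : ContDiffAt ℝ ∞ (fun w : ℝ => ((t, x, w) : Base)) u := by fun_prop
  have h2 := (ContDiffAt.comp u (hT.contDiffAt_base (Box.mem_base ht hx hu)) h1).snd.snd
  refine h2.congr_of_eventuallyEq ?_
  filter_upwards [D.isOpenInterval_u.2.1.mem_nhds hu] with y hy
  exact (hs.newU (t, x, y) ⟨ht, hx, hy⟩).symm

theorem contDiffAt_newT (hT : IsUsualEquivalenceTransformation D T) {p : Base} (hp : p ∈ D.base) :
    ContDiffAt ℝ ∞ (fun q => (T.base q).1) p := (hT.contDiffAt_base hp).fst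

theorem hasDerivAt_X (hs : Splits D T X U) (hT : IsUsualEquivalenceTransformation D T) {x : ℝ}
    (hx : x ∈ D.Ix) : HasDerivAt X (deriv X x) x :=
  ((hs.contDiffAt_X hT hx).differentiableAt (by simp)).hasDerivAt

theorem hasDerivAt_U (hs : Splits D T X U) (hT : IsUsualEquivalenceTransformation D T) {u : ℝ}
    (hu : u ∈ D.Iu) : HasDerivAt U (deriv U u) u :=
  ((hs.contDiffAt_U hT hu).differentiableAt (by simp)).hasDerivAt

theorem hasFDerivAt_newT (hT : IsUsualEquivalenceTransformation D T) {p : Base}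
    (hp : p ∈ D.base) :
    HasFDerivAt (fun q => (T.base q).1) (fderiv ℝ (fun q => (T.base q).1) p) p :=
  ((contDiffAt_newT hT hp).differentiableAt (by simp)).hasFDerivAt

theorem fderiv_base_apply (hs : Splits D T X U) (hT : IsUsualEquivalenceTransformation D T)
    {p : Base} (hp : p ∈ D.base) (w : Base) :
    fderiv ℝ T.base p w = (fderiv ℝ (fun q => (T.base q).1) p w,
      deriv X p.2.1 * w.2.1, deriv U p.2.2 * w.2.2) := by
  have hb : HasFDerivAt T.base (fderiv ℝ T.base p) p :=
    ((hT.contDiffAt_base hp).differentiableAt (by simp)).hasFDerivAt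
  have hnhds := D.isOpen_base.mem_nhds hp
  have h2 : HasFDerivAt (fun q : Base => (T.base q).2.1) _ p :=
    (HasDerivAt.comp_hasFDerivAt p (hs.hasDerivAt_X hT hp.2.1)
      ((hasFDerivAt_fst (𝕜 := ℝ) (E := ℝ) (F := ℝ)).comp p
        (hasFDerivAt_snd (𝕜 := ℝ) (E := ℝ) (F := ℝ × ℝ)))).congr_of_eventuallyEq
      (by filter_upwards [hnhds] with q hq using hs.newX q hq)
  have h3 : HasFDerivAt (fun q : Base => (T.base q).2.2) _ p :=
    (HasDerivAt.comp_hasFDerivAt p (hs.hasDerivAt_U hT hp.2.2)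
      ((hasFDerivAt_snd (𝕜 := ℝ) (E := ℝ) (F := ℝ)).comp p
        (hasFDerivAt_snd (𝕜 := ℝ) (E := ℝ) (F := ℝ × ℝ)))).congr_of_eventuallyEq
      (by filter_upwards [hnhds] with q hq using hs.newU q hq)
  refine Prod.ext ?_ (Prod.ext ?_ ?_)
  · exact congrArg (fun A : Base →L[ℝ] ℝ => A w) (hb.fst.unique (hasFDerivAt_newT hT hp))
  · exact congrArg (fun A : Base →L[ℝ] ℝ => A w) (hb.snd.fst.unique h2)
  · exact congrArg (fun A : Base →L[ℝ] ℝ => A w) (hb.snd.snd.unique h3)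

theorem newT_t_ne_zero (hs : Splits D T X U) (hT : IsUsualEquivalenceTransformation D T)
    {p : Base} (hp : p ∈ D.base) : fderiv ℝ (fun q => (T.base q).1) p (1, 0, 0) ≠ 0 := by
  intro h
  have h0 := hT.fderiv_base_injective hp (w := (1, 0, 0))
    (by rw [hs.fderiv_base_apply hT hp, h]; simp)
  simpa using congrArg Prod.fst h0

theorem deriv_X_ne_zero (hs : Splits D T X U) (hT : IsUsualEquivalenceTransformation D T)
    {x : ℝ} (hx : x ∈ D.Ix) : deriv X x ≠ 0 := by
  intro h
  obtain ⟨t, ht⟩ := D.isOpenInterval_t.1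
  obtain ⟨u, hu⟩ := D.isOpenInterval_u.1
  have hp := Box.mem_base ht hx hu
  set A := fderiv ℝ (fun q => (T.base q).1) (t, x, u) with hA
  have hA0 : A (1, 0, 0) ≠ 0 := hs.newT_t_ne_zero hT hp
  -- This combination of the `x`- and `t`-directions annihilates the new `t`; if `X' = 0` it
  -- annihilates the new `x` as well, and it does not move `u`.
  have hw : ((-(A (0, 1, 0) / A (1, 0, 0)), 1, 0) : Base) =
      (-(A (0, 1, 0) / A (1, 0, 0))) • ((1, 0, 0) : Base) + (0, 1, 0) := by simp
  have h0 := hT.fderiv_base_injective hp (w := (-(A (0, 1, 0) / A (1, 0, 0)), 1, 0)) (by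
    rw [hs.fderiv_base_apply hT hp, h, ← hA, hw, map_add, map_smul, smul_eq_mul, neg_mul,
      div_mul_cancel₀ _ hA0]
    simp)
  simpa using congrArg (fun w : Base => w.2.1) h0

theorem deriv_U_ne_zero (hs : Splits D T X U) (hT : IsUsualEquivalenceTransformation D T)
    {u : ℝ} (hu : u ∈ D.Iu) : deriv U u ≠ 0 := by
  intro h
  obtain ⟨t, ht⟩ := D.isOpenInterval_t.1
  obtain ⟨x, hx⟩ := D.isOpenInterval_x.1
  have hp := Box.mem_base ht hx hu
  set A := fderiv ℝ (fun q => (T.base q).1) (t, x, u) with hA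
  have hA0 : A (1, 0, 0) ≠ 0 := hs.newT_t_ne_zero hT hp
  have hw : ((-(A (0, 0, 1) / A (1, 0, 0)), 0, 1) : Base) =
      (-(A (0, 0, 1) / A (1, 0, 0))) • ((1, 0, 0) : Base) + (0, 0, 1) := by simp
  have h0 := hT.fderiv_base_injective hp (w := (-(A (0, 0, 1) / A (1, 0, 0)), 0, 1)) (by
    rw [hs.fderiv_base_apply hT hp, h, ← hA, hw, map_add, map_smul, smul_eq_mul, neg_mul,
      div_mul_cancel₀ _ hA0]
    simp)
  simpa using congrArg (fun w : Base => w.2.2) h0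

/-- The new elements are known to be smooth only on the images of the box. Being neighbourhoods,
these images give genuine differentiability at the points considered. -/
theorem image_newX_mem_nhds (hs : Splits D T X U) (hT : IsUsualEquivalenceTransformation D T)
    {x : ℝ} (hx : x ∈ D.Ix) : (fun p => (T.base p).2.1) '' D.base ∈ 𝓝 (X x) := by
  obtain ⟨t, ht⟩ := D.isOpenInterval_t.1
  obtain ⟨u, hu⟩ := D.isOpenInterval_u.1
  have h := ((hs.contDiffAt_X hT hx).hasStrictDerivAt (by simp)).map_nhds_eq
    (hs.deriv_X_ne_zero hT hx)
  rw [← h, Filter.mem_map]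
  filter_upwards [D.isOpenInterval_x.2.1.mem_nhds hx] with y hy
  exact ⟨(t, y, u), ⟨ht, hy, hu⟩, hs.newX (t, y, u) ⟨ht, hy, hu⟩⟩

theorem image_newU_mem_nhds (hs : Splits D T X U) (hT : IsUsualEquivalenceTransformation D T)
    {u : ℝ} (hu : u ∈ D.Iu) : (fun p => (T.base p).2.2) '' D.base ∈ 𝓝 (U u) := by
  obtain ⟨t, ht⟩ := D.isOpenInterval_t.1
  obtain ⟨x, hx⟩ := D.isOpenInterval_x.1
  have h := ((hs.contDiffAt_U hT hu).hasStrictDerivAt (by simp)).map_nhds_eq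
    (hs.deriv_U_ne_zero hT hu)
  rw [← h, Filter.mem_map]
  filter_upwards [D.isOpenInterval_u.2.1.mem_nhds hu] with y hy
  exact ⟨(t, x, y), ⟨ht, hx, hy⟩, hs.newU (t, x, y) ⟨ht, hx, hy⟩⟩

/-- The jet of the solution of `U u = v (T, X)` for a second-degree polynomial `v`. -/
theorem exists_preimage (hs : Splits D T X U) (hT : IsUsualEquivalenceTransformation D T)
    {t₀ x₀ u₀ : ℝ} (hp : (t₀, x₀, u₀) ∈ D.base) (α β γ c κ : ℝ)
    (hβ : deriv U u₀ - β * fderiv ℝ (fun q => (T.base q).1) (t₀, x₀, u₀) (0, 0, 1) ≠ 0) :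
    ∃ (u : ℝ → ℝ → ℝ) (σ₁ σ₂ ρ₁ ρ₂ u₁ u₁₁ u₂ u₂₂ : ℝ), u t₀ x₀ = u₀ ∧
      ContDiffAt ℝ ∞ (fun z : ℝ × ℝ => u z.1 z.2) (t₀, x₀) ∧
      (∀ᶠ z in 𝓝 (t₀, x₀), quadraticFunction (T.base (t₀, x₀, u₀)).1 (X x₀) (U u₀) α β γ c κ
        (T.newIndep u z).1 (T.newIndep u z).2 = T.newDep u z) ∧
      HasJetAt (fun s => u s x₀) t₀ u₁ u₁₁ ∧ HasJetAt (fun y => u t₀ y) x₀ u₂ u₂₂ ∧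
      HasJetAt (fun s => (T.base (s, x₀, u s x₀)).1) t₀ σ₁ σ₂ ∧
      HasJetAt (fun y => (T.base (t₀, y, u t₀ y)).1) x₀ ρ₁ ρ₂ ∧
      σ₁ = fderiv ℝ (fun q => (T.base q).1) (t₀, x₀, u₀) (1, 0, 0) +
        u₁ * fderiv ℝ (fun q => (T.base q).1) (t₀, x₀, u₀) (0, 0, 1) ∧
      ρ₁ = fderiv ℝ (fun q => (T.base q).1) (t₀, x₀, u₀) (0, 1, 0) +
        u₂ * fderiv ℝ (fun q => (T.base q).1) (t₀, x₀, u₀) (0, 0, 1) ∧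
      deriv U u₀ * u₁ = β * σ₁ ∧
      deriv (deriv U) u₀ * u₁ ^ 2 + deriv U u₀ * u₁₁ = β * σ₂ + α * σ₁ ^ 2 ∧
      deriv U u₀ * u₂ = β * ρ₁ + γ * deriv X x₀ ∧
      deriv (deriv U) u₀ * u₂ ^ 2 + deriv U u₀ * u₂₂ = β * ρ₂ + γ * deriv (deriv X) x₀
        + α * ρ₁ ^ 2 + c * deriv X x₀ ^ 2 + 2 * κ * ρ₁ * deriv X x₀ := by
  set τ : Base → ℝ := fun q => (T.base q).1 with hτ
  set A := fderiv ℝ τ (t₀, x₀, u₀) with hA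
  set v := quadraticFunction (τ (t₀, x₀, u₀)) (X x₀) (U u₀) α β γ c κ with hv
  have hτc : ContDiffAt ℝ ∞ τ (t₀, x₀, u₀) := contDiffAt_newT hT hp
  have hτd : HasFDerivAt τ A (t₀, x₀, u₀) := hasFDerivAt_newT hT hp
  -- The graph of `v` pulls back to the zero set of `F`, and `hβ` says that the derivative of `F` in
  -- `u` is nonzero at the point.
  let F : (ℝ × ℝ) × ℝ → ℝ := fun q => U q.2 - v (τ (q.1.1, q.1.2, q.2)) (X q.1.2)
  have hF0 : F ((t₀, x₀), u₀) = 0 := by simp [F, hv, quadraticFunction]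
  have hFc : ContDiffAt ℝ ∞ F ((t₀, x₀), u₀) := by
    have h1 : ContDiffAt ℝ ∞ (fun q : (ℝ × ℝ) × ℝ => τ (q.1.1, q.1.2, q.2)) ((t₀, x₀), u₀) :=
      ContDiffAt.comp (g := τ) (f := fun q : (ℝ × ℝ) × ℝ => (q.1.1, q.1.2, q.2)) ((t₀, x₀), u₀)
        hτc (by fun_prop)
    have h2 : ContDiffAt ℝ ∞ (fun q : (ℝ × ℝ) × ℝ => X q.1.2) ((t₀, x₀), u₀) :=
      ContDiffAt.comp (g := X) (f := fun q : (ℝ × ℝ) × ℝ => q.1.2) ((t₀, x₀), u₀)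
        (hs.contDiffAt_X hT hp.2.1) (by fun_prop)
    have h3 : ContDiffAt ℝ ∞ (fun q : (ℝ × ℝ) × ℝ => U q.2) ((t₀, x₀), u₀) :=
      ContDiffAt.comp (g := U) (f := fun q : (ℝ × ℝ) × ℝ => q.2) ((t₀, x₀), u₀)
        (hs.contDiffAt_U hT hp.2.2) (by fun_prop)
    exact h3.sub (ContDiffAt.comp (g := fun z : ℝ × ℝ => v z.1 z.2) ((t₀, x₀), u₀)
      (contDiff_quadraticFunction _ _ _ _ _ _ _ _).contDiffAt (h1.prodMk h2))
  have hUd := hs.hasDerivAt_U hT hp.2.2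
  have hFd : HasDerivAt (fun s => F ((t₀, x₀), s)) (deriv U u₀ - β * A (0, 0, 1)) u₀ := by
    have hτu : HasDerivAt (fun s => τ (t₀, x₀, s)) (A (0, 0, 1)) u₀ :=
      hτd.comp_hasDerivAt (f := fun s => (t₀, x₀, s)) u₀
        ((hasDerivAt_const u₀ t₀).prodMk ((hasDerivAt_const u₀ x₀).prodMk (hasDerivAt_id u₀)))
    have h1 := hτu.sub_const (τ (t₀, x₀, u₀))
    have h2 := hUd.sub (((h1.const_mul β).const_add (U u₀)).add ((h1.mul h1).const_mul (α / 2)))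
    refine (h2.congr_of_eventuallyEq (Filter.Eventually.of_forall fun s => ?_)).congr_deriv ?_
    · simp [F, hv, quadraticFunction]
    · simp
  obtain ⟨w, hw0, hwc, hwF⟩ := exists_implicit_function hFc hFd hβ
  let u : ℝ → ℝ → ℝ := fun s y => w (s, y)
  have hu0 : u t₀ x₀ = u₀ := hw0
  have hwb : ∀ᶠ z in 𝓝 (t₀, x₀), ((z.1, z.2, w z) : Base) ∈ D.base := by
    have : ContinuousAt (fun z : ℝ × ℝ => ((z.1, z.2, w z) : Base)) (t₀, x₀) :=
      continuousAt_fst.prodMk (continuousAt_snd.prodMk hwc.continuousAt)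
    exact this.eventually_mem (D.isOpen_base.mem_nhds (by simpa only [hw0] using hp))
  have hUw : ∀ᶠ z in 𝓝 (t₀, x₀), v (τ (z.1, z.2, w z)) (X z.2) = U (w z) := by
    filter_upwards [hwF] with z hz
    rw [hF0] at hz
    exact (sub_eq_zero.1 hz).symm
  have hct : ContDiffAt ℝ ∞ (fun s => u s x₀) t₀ :=
    ContDiffAt.comp (g := w) (f := fun s => (s, x₀)) t₀ hwc (by fun_prop)
  have hcx : ContDiffAt ℝ ∞ (fun y => u t₀ y) x₀ :=
    ContDiffAt.comp (g := w) (f := fun y => (t₀, y)) x₀ hwc (by fun_prop)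
  have hτc' : ContDiffAt ℝ ∞ τ (t₀, x₀, u t₀ x₀) := by rwa [hu0]
  have hτd' : HasFDerivAt τ A (t₀, x₀, u t₀ x₀) := by rwa [hu0]
  have hcσ : ContDiffAt ℝ ∞ (fun s => τ (s, x₀, u s x₀)) t₀ :=
    ContDiffAt.comp (g := τ) (f := fun s => (s, x₀, u s x₀)) t₀ hτc' (by fun_prop)
  have hcρ : ContDiffAt ℝ ∞ (fun y => τ (t₀, y, u t₀ y)) x₀ :=
    ContDiffAt.comp (g := τ) (f := fun y => (t₀, y, u t₀ y)) x₀ hτc' (by fun_prop)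
  have ju := HasJetAt.of_contDiffAt hct
  have jx := HasJetAt.of_contDiffAt hcx
  have jσ := HasJetAt.of_contDiffAt hcσ
  have jρ := HasJetAt.of_contDiffAt hcρ
  have jX := HasJetAt.of_contDiffAt (hs.contDiffAt_X hT hp.2.1)
  have jU : HasJetAt U u₀ (deriv U u₀) (deriv (deriv U) u₀) :=
    HasJetAt.of_contDiffAt (hs.contDiffAt_U hT hp.2.2)
  generalize deriv (fun s => u s x₀) t₀ = u₁ at ju
  generalize deriv (deriv (fun s => u s x₀)) t₀ = u₁₁ at ju
  generalize deriv (fun y => u t₀ y) x₀ = u₂ at jx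
  generalize deriv (deriv (fun y => u t₀ y)) x₀ = u₂₂ at jx
  generalize deriv (fun s => τ (s, x₀, u s x₀)) t₀ = σ₁ at jσ
  generalize deriv (deriv (fun s => τ (s, x₀, u s x₀))) t₀ = σ₂ at jσ
  generalize deriv (fun y => τ (t₀, y, u t₀ y)) x₀ = ρ₁ at jρ
  generalize deriv (deriv (fun y => τ (t₀, y, u t₀ y))) x₀ = ρ₂ at jρ
  have hsplit : ∀ a b d : ℝ, A (a, b, d) = a * A (1, 0, 0) + b * A (0, 1, 0) + d * A (0, 0, 1) := by
    intro a b d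
    have : ((a, b, d) : Base) = a • (1, 0, 0) + b • (0, 1, 0) + d • (0, 0, 1) := by simp
    rw [this]
    simp only [map_add, map_smul, smul_eq_mul]
  have hσ₁ : σ₁ = A (1, 0, 0) + u₁ * A (0, 0, 1) := by
    have h1 : HasDerivAt (fun s => τ (s, x₀, u s x₀)) (A (1, 0, u₁)) t₀ :=
      hτd'.comp_hasDerivAt (f := fun s => (s, x₀, u s x₀)) t₀
        ((hasDerivAt_id t₀).prodMk ((hasDerivAt_const t₀ x₀).prodMk ju.hasDerivAt))
    rw [jσ.hasDerivAt.unique h1, hsplit]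
    ring
  have hρ₁ : ρ₁ = A (0, 1, 0) + u₂ * A (0, 0, 1) := by
    have h1 : HasDerivAt (fun y => τ (t₀, y, u t₀ y)) (A (0, 1, u₂)) x₀ :=
      hτd'.comp_hasDerivAt (f := fun y => (t₀, y, u t₀ y)) x₀
        ((hasDerivAt_const x₀ t₀).prodMk ((hasDerivAt_id x₀).prodMk jx.hasDerivAt))
    rw [jρ.hasDerivAt.unique h1, hsplit]
    ring
  have jUu : HasJetAt (fun s => U (u s x₀)) t₀ (deriv U u₀ * u₁)
      (deriv (deriv U) u₀ * u₁ ^ 2 + deriv U u₀ * u₁₁) :=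
    HasJetAt.comp (φ := fun s => u s x₀) (by simpa only [hu0] using jU) ju
  have jUx : HasJetAt (fun y => U (u t₀ y)) x₀ (deriv U u₀ * u₂)
      (deriv (deriv U) u₀ * u₂ ^ 2 + deriv U u₀ * u₂₂) :=
    HasJetAt.comp (φ := fun y => u t₀ y) (by simpa only [hu0] using jU) jx
  have hUt : (fun s => U (u s x₀)) =ᶠ[𝓝 t₀] fun s => v (τ (s, x₀, u s x₀)) (X x₀) := by
    have : ContinuousAt (fun s : ℝ => (s, x₀)) t₀ := by fun_prop
    exact (this.eventually hUw).mono fun s hs => hs.symm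
  have hUy : (fun y => U (u t₀ y)) =ᶠ[𝓝 x₀] fun y => v (τ (t₀, y, u t₀ y)) (X y) := by
    have : ContinuousAt (fun y : ℝ => (t₀, y)) x₀ := by fun_prop
    exact (this.eventually hUw).mono fun s hs => hs.symm
  -- Both sides of `U u = v (τ, X)` are differentiated twice along each axis. Along `t` the new `x`
  -- is constant, so `γ`, `c` and `κ` drop out; along `x` the mixed coefficient `κ` survives with
  -- the factor `ρ₁`.
  have jvt := (HasJetAt.quadratic (HasJetAt.const t₀ 0) (jσ.sub_const (τ (t₀, x₀, u₀))) rfl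
    (by simp only [hu0, sub_self]) (U u₀) α β γ c κ).congr (hUt.trans
      (Filter.Eventually.of_forall fun s => by simp [hv, quadraticFunction]))
  have jvx := (HasJetAt.quadratic (jX.sub_const (X x₀)) (jρ.sub_const (τ (t₀, x₀, u₀)))
    (sub_self _) (by simp only [hu0, sub_self]) (U u₀) α β γ c κ).congr (hUy.trans
      (Filter.Eventually.of_forall fun s => by simp [hv, quadraticFunction]))
  refine ⟨u, σ₁, σ₂, ρ₁, ρ₂, u₁, u₁₁, u₂, u₂₂, hu0, hwc, ?_, ju, jx, jσ, jρ, hσ₁, hρ₁, ?_, ?_,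
    ?_, ?_⟩
  · filter_upwards [hUw, hwb] with z hz hzb
    have h1 := hs.newX _ hzb
    have h2 := hs.newU _ hzb
    simp only [ProjectibleMap.newIndep, ProjectibleMap.newDep, u] at h1 h2 ⊢
    rw [h1, h2]
    exact hz
  · rw [jUu.fst_unique jvt]; ring
  · rw [jUu.snd_unique jvt]; ring
  · exact jUx.fst_unique jvx
  · exact jUx.snd_unique jvx

end Splits

/-- Since the new `x` is locally a function of `x`, the Jacobian is triangular with diagonal entries
`σ₁` and `X₁`. -/
theorem ProjectibleMap.det_fderiv_newIndep_ne_zero {T : ProjectibleMap} {u : ℝ → ℝ → ℝ}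
    {X : ℝ → ℝ} {t x σ₁ X₁ : ℝ} (hd : DifferentiableAt ℝ (T.newIndep u) (t, x))
    (hσ : HasDerivAt (fun s => (T.base (s, x, u s x)).1) σ₁ t) (hσ0 : σ₁ ≠ 0)
    (hX : ∀ᶠ z in 𝓝 (t, x), (T.newIndep u z).2 = X z.2) (hX₁ : HasDerivAt X X₁ x)
    (hX0 : X₁ ≠ 0) : (fderiv ℝ (T.newIndep u) (t, x)).det ≠ 0 := by
  have h := hd.hasFDerivAt
  set B := fderiv ℝ (T.newIndep u) (t, x) with hB
  have h2 : ∀ w, (B w).2 = X₁ * w.2 := fun w => by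
    have h3 : HasFDerivAt (fun z => (T.newIndep u z).2) _ (t, x) :=
      (HasDerivAt.comp_hasFDerivAt (t, x) hX₁
        (hasFDerivAt_snd (𝕜 := ℝ) (E := ℝ) (F := ℝ))).congr_of_eventuallyEq hX
    exact congrArg (fun A : ℝ × ℝ →L[ℝ] ℝ => A w) (h.snd.unique h3)
  have h1 : (B (1, 0)).1 = σ₁ := by
    have h3 : HasDerivAt (fun s => (T.newIndep u (s, x)).1) (B (1, 0)).1 t :=
      (HasFDerivAt.comp_hasDerivAt (f := fun s => (s, x)) t h
        ((hasDerivAt_id t).prodMk (hasDerivAt_const t x))).fst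
    exact h3.unique hσ
  intro hdet
  refine LinearMap.det_eq_zero_iff_ker_ne_bot.1 hdet (LinearMap.ker_eq_bot'.2 fun w hw => ?_)
  have hw' : B w = 0 := hw
  obtain ⟨a, b⟩ := w
  have hb : b = 0 := by
    have h3 := h2 (a, b)
    rw [hw'] at h3
    exact (mul_eq_zero.1 h3.symm).resolve_left hX0
  subst hb
  have ha : B (a, 0) = a • B (1, 0) := by rw [← map_smul]; simp
  rw [ha] at hw'
  have h3 := congrArg Prod.fst hw'
  rw [Prod.smul_fst, h1, smul_eq_mul, Prod.fst_zero] at h3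
  simp [(mul_eq_zero.1 h3).resolve_right hσ0]

/-- Smooth arbitrary elements of the class with prescribed values and derivatives at a point. -/
theorem Box.Regular.exists_arbitraryElements {D : Box} (hD : D.Regular) {t x u : ℝ}
    (hp : (t, x, u) ∈ D.base) {f g h H K : ℝ} (he : (f, g, h, H, K) ∈ D.elem) (a b d : ℝ) :
    ∃ θ : ArbitraryElements, θ.SmoothInto D ∧ θ.InClass D.Ix D.Iu ∧
      θ.val (t, x, u) = (f, g, h, H, K) ∧ HasDerivAt θ.f a x ∧ HasDerivAt θ.g b x ∧
      HasDerivAt θ.h d x ∧ HasDerivAt θ.H 0 u := by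
  obtain ⟨hf, hg, hh, hH, hK⟩ := he
  obtain ⟨φ, hφ, hφ1, hφ2⟩ := D.isOpenInterval_f.exists_jet x hf a
  obtain ⟨γ, hγ, hγ1, hγ2⟩ := D.isOpenInterval_g.exists_jet x hg b
  obtain ⟨χ, hχ, hχ1, hχ2⟩ := D.isOpenInterval_h.exists_jet x hh d
  obtain ⟨κ, hκ, hκ1, hκ2⟩ := D.isOpenInterval_K.exists_jet u hK 1
  let θ : ArbitraryElements := ⟨φ, γ, χ, fun _ => H, κ⟩
  have hθ : θ.SmoothInto D := ⟨hφ, hγ, hχ, SmoothInto.const hH, hκ⟩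
  refine ⟨θ, hθ, hθ.inClass hD hp.2.2 one_ne_zero hκ2, ?_, hφ2, hγ2, hχ2, hasDerivAt_const u H⟩
  simp only [ArbitraryElements.val, θ, hφ1, hγ1, hχ1, hκ1]

/-! ### Equations for test functions; the new `t` does not depend on `x` and `u` -/

namespace Splits

variable {D : Box} {T : ProjectibleMap} {X U : ℝ → ℝ}

/-- The equations for a second-degree polynomial in the new variables and for its preimage. -/
theorem exists_preimage_equation (hs : Splits D T X U) (hT : IsUsualEquivalenceTransformation D T)
    {t₀ x₀ u₀ : ℝ} (hp : (t₀, x₀, u₀) ∈ D.base) {θ θ' : ArbitraryElements}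
    (hθ : θ.InClass D.Ix D.Iu) (hθ' : θ'.InClass ((fun p => (T.base p).2.1) '' D.base)
      ((fun p => (T.base p).2.2) '' D.base))
    (htr : T.TransformsEquation D θ θ') (α β γ c κ : ℝ)
    (hβ : deriv U u₀ - β * fderiv ℝ (fun q => (T.base q).1) (t₀, x₀, u₀) (0, 0, 1) ≠ 0) :
    ∃ (u : ℝ → ℝ → ℝ) (σ₁ σ₂ ρ₁ ρ₂ u₁ u₁₁ u₂ u₂₂ : ℝ), u t₀ x₀ = u₀ ∧
      HasJetAt (fun s => u s x₀) t₀ u₁ u₁₁ ∧ HasJetAt (fun y => u t₀ y) x₀ u₂ u₂₂ ∧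
      HasJetAt (fun s => (T.base (s, x₀, u s x₀)).1) t₀ σ₁ σ₂ ∧
      HasJetAt (fun y => (T.base (t₀, y, u t₀ y)).1) x₀ ρ₁ ρ₂ ∧
      ρ₁ = fderiv ℝ (fun q => (T.base q).1) (t₀, x₀, u₀) (0, 1, 0) +
        u₂ * fderiv ℝ (fun q => (T.base q).1) (t₀, x₀, u₀) (0, 0, 1) ∧
      deriv U u₀ * u₁ = β * σ₁ ∧
      deriv (deriv U) u₀ * u₁ ^ 2 + deriv U u₀ * u₁₁ = β * σ₂ + α * σ₁ ^ 2 ∧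
      deriv U u₀ * u₂ = β * ρ₁ + γ * deriv X x₀ ∧
      deriv (deriv U) u₀ * u₂ ^ 2 + deriv U u₀ * u₂₂ = β * ρ₂ + γ * deriv (deriv X) x₀
        + α * ρ₁ ^ 2 + c * deriv X x₀ ^ 2 + 2 * κ * ρ₁ * deriv X x₀ ∧
      (θ.f x₀ * u₁₁ = θ.g x₀ * θ.H u₀ * u₂₂
          + (deriv θ.g x₀ * θ.H u₀ + θ.h x₀ * θ.K u₀) * u₂
          + θ.g x₀ * deriv θ.H u₀ * u₂ ^ 2 ↔
        θ'.f (X x₀) * α = θ'.g (X x₀) * θ'.H (U u₀) * c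
          + (deriv θ'.g (X x₀) * θ'.H (U u₀) + θ'.h (X x₀) * θ'.K (U u₀)) * γ
          + θ'.g (X x₀) * deriv θ'.H (U u₀) * γ ^ 2) := by
  obtain ⟨u, σ₁, σ₂, ρ₁, ρ₂, u₁, u₁₁, u₂, u₂₂, hu0, huc, huv, ju, jx, jσ, jρ, hσ₁, hρ₁, e1, e2,
    e3, e4⟩ := hs.exists_preimage hT hp α β γ c κ hβ
  refine ⟨u, σ₁, σ₂, ρ₁, ρ₂, u₁, u₁₁, u₂, u₂₂, hu0, ju, jx, jσ, jρ, hρ₁, e1, e2, e3, e4, ?_⟩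
  have hp' : (t₀, x₀, u t₀ x₀) ∈ D.base := by rwa [hu0]
  have hind : T.newIndep u (t₀, x₀) = ((T.base (t₀, x₀, u₀)).1, X x₀) := by
    simp only [ProjectibleMap.newIndep, hu0]
    exact Prod.ext rfl (hs.newX _ hp)
  have hgraph : ContDiffAt ℝ ∞ (fun z : ℝ × ℝ => ((z.1, z.2, u z.1 z.2) : Base)) (t₀, x₀) :=
    contDiffAt_fst.prodMk (contDiffAt_snd.prodMk huc)
  have hgb : ContDiffAt ℝ ∞ (fun z : ℝ × ℝ => T.base (z.1, z.2, u z.1 z.2)) (t₀, x₀) :=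
    ContDiffAt.comp (g := T.base) (f := fun z : ℝ × ℝ => (z.1, z.2, u z.1 z.2)) (t₀, x₀)
      (hT.contDiffAt_base hp') hgraph
  -- If the new `t` were stationary along the graph in `t`, `e1` would give `u₁ = 0`, and the
  -- partial derivative of the new `t` in `t` would vanish.
  have hσ0 : σ₁ ≠ 0 := by
    intro h0
    have hu1 : u₁ = 0 := by
      rw [h0, mul_zero] at e1
      exact (mul_eq_zero.1 e1).resolve_left (hs.deriv_U_ne_zero hT hp.2.2)
    rw [h0, hu1, zero_mul, add_zero] at hσ₁
    exact hs.newT_t_ne_zero hT hp hσ₁.symm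
  have hdet : (fderiv ℝ (T.newIndep u) (t₀, x₀)).det ≠ 0 := by
    refine ProjectibleMap.det_fderiv_newIndep_ne_zero
      ((hgb.fst.prodMk hgb.snd.fst).differentiableAt (by simp)) jσ.hasDerivAt hσ0 ?_
      (hs.hasDerivAt_X hT hp.2.1) (hs.deriv_X_ne_zero hT hp.2.1)
    filter_upwards [hgraph.continuousAt.eventually_mem (D.isOpen_base.mem_nhds hp')] with z hz
    exact hs.newX _ hz
  have hiff := htr u _ t₀ x₀ hp' huc hdet
    (contDiff_quadraticFunction _ _ _ _ _ _ _ _).contDiffAt huv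
  rw [hind] at hiff
  have hg : DifferentiableAt ℝ θ.g x₀ := (hθ.smooth_g.contDiffAt
    (D.isOpenInterval_x.2.1.mem_nhds hp.2.1)).differentiableAt (by simp)
  have hH : DifferentiableAt ℝ θ.H u₀ := (hθ.smooth_H.contDiffAt
    (D.isOpenInterval_u.2.1.mem_nhds hp.2.2)).differentiableAt (by simp)
  have hg' : DifferentiableAt ℝ θ'.g (X x₀) :=
    (hθ'.smooth_g.contDiffAt (hs.image_newX_mem_nhds hT hp.2.1)).differentiableAt (by simp)
  have hH' : DifferentiableAt ℝ θ'.H (U u₀) :=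
    (hθ'.smooth_H.contDiffAt (hs.image_newU_mem_nhds hT hp.2.2)).differentiableAt (by simp)
  rw [ArbitraryElements.holdsAt_iff hg (by rwa [hu0]) ju jx,
    ArbitraryElements.holdsAt_iff hg' (by rwa [quadraticFunction_self])
      (hasJetAt_quadraticFunction_left _ _ _ _ _ _ _ _)
      (hasJetAt_quadraticFunction_right _ _ _ _ _ _ _ _), quadraticFunction_self, hu0] at hiff
  exact hiff

theorem _root_.Telegraph.Box.exists_mem_elem (D : Box) :
    ∃ f g h H K, ((f, g, h, H, K) : Elem) ∈ D.elem := by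
  obtain ⟨f, hf⟩ := D.isOpenInterval_f.1
  obtain ⟨g, hg⟩ := D.isOpenInterval_g.1
  obtain ⟨h, hh⟩ := D.isOpenInterval_h.1
  obtain ⟨H, hH⟩ := D.isOpenInterval_H.1
  obtain ⟨K, hK⟩ := D.isOpenInterval_K.1
  exact ⟨f, g, h, H, K, Box.mem_elem hf hg hh hH hK⟩

theorem newX_mem (hs : Splits D T X U) {t x u : ℝ} (hp : (t, x, u) ∈ D.base) :
    X x ∈ (fun p => (T.base p).2.1) '' D.base := ⟨(t, x, u), hp, hs.newX _ hp⟩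

theorem newU_mem (hs : Splits D T X U) {t x u : ℝ} (hp : (t, x, u) ∈ D.base) :
    U u ∈ (fun p => (T.base p).2.2) '' D.base := ⟨(t, x, u), hp, hs.newU _ hp⟩

/-- The coefficient `κ` of the mixed term is invisible to the new equation, but it changes the
`u_xx` of the preimage by a multiple of `ρ₁ = τx + u_x * τu`. Since the old equation fixes `u_xx`,
this `ρ₁` vanishes for every slope. -/
theorem fderiv_newT (hs : Splits D T X U) (hT : IsUsualEquivalenceTransformation D T)
    (hD : D.Regular) {t₀ x₀ u₀ : ℝ} (hp : (t₀, x₀, u₀) ∈ D.base) :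
    fderiv ℝ (fun q => (T.base q).1) (t₀, x₀, u₀) (0, 1, 0) = 0 ∧
      fderiv ℝ (fun q => (T.base q).1) (t₀, x₀, u₀) (0, 0, 1) = 0 := by
  obtain ⟨f, g, h, H, K, he⟩ := D.exists_mem_elem
  obtain ⟨θ, hθs, hθ, -⟩ := hD.exists_arbitraryElements hp he 0 0 0
  obtain ⟨θ', hθ', -, htr⟩ := hT.preserves θ hθ fun p _ => hθs.val_mem p
  set τx := fderiv ℝ (fun q => (T.base q).1) (t₀, x₀, u₀) (0, 1, 0) with hτx
  set τu := fderiv ℝ (fun q => (T.base q).1) (t₀, x₀, u₀) (0, 0, 1) with hτu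
  have hU := hs.deriv_U_ne_zero hT hp.2.2
  have hX := hs.deriv_X_ne_zero hT hp.2.1
  have hgH : θ.g x₀ * θ.H u₀ ≠ 0 := mul_ne_zero (hθ.g_ne_zero _ hp.2.1) (hθ.H_ne_zero _ hp.2.2)
  have hgH' : θ'.g (X x₀) * θ'.H (U u₀) ≠ 0 :=
    mul_ne_zero (hθ'.g_ne_zero _ (hs.newX_mem hp)) (hθ'.H_ne_zero _ (hs.newU_mem hp))
  have key : ∀ γ : ℝ, τx + γ * deriv X x₀ / deriv U u₀ * τu = 0 := by
    intro γ
    -- `c` is chosen so that the polynomial with `α = β = 0` and slope `γ` satisfies the new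
    -- equation at the point, whatever `κ` is.
    obtain ⟨c, hc⟩ : ∃ c, 0 = θ'.g (X x₀) * θ'.H (U u₀) * c
        + (deriv θ'.g (X x₀) * θ'.H (U u₀) + θ'.h (X x₀) * θ'.K (U u₀)) * γ
        + θ'.g (X x₀) * deriv θ'.H (U u₀) * γ ^ 2 := by
      refine ⟨-((deriv θ'.g (X x₀) * θ'.H (U u₀) + θ'.h (X x₀) * θ'.K (U u₀)) * γ
        + θ'.g (X x₀) * deriv θ'.H (U u₀) * γ ^ 2) / (θ'.g (X x₀) * θ'.H (U u₀)), ?_⟩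
      rw [mul_div_cancel₀ _ hgH']
      ring
    have h : ∀ κ : ℝ, ∃ u₂₂ : ℝ,
        0 = θ.g x₀ * θ.H u₀ * u₂₂
          + (deriv θ.g x₀ * θ.H u₀ + θ.h x₀ * θ.K u₀) * (γ * deriv X x₀ / deriv U u₀)
          + θ.g x₀ * deriv θ.H u₀ * (γ * deriv X x₀ / deriv U u₀) ^ 2 ∧
        deriv (deriv U) u₀ * (γ * deriv X x₀ / deriv U u₀) ^ 2 + deriv U u₀ * u₂₂ =
          γ * deriv (deriv X) x₀ + c * deriv X x₀ ^ 2
          + 2 * κ * (τx + γ * deriv X x₀ / deriv U u₀ * τu) * deriv X x₀ := by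
      intro κ
      obtain ⟨u, σ₁, σ₂, ρ₁, ρ₂, u₁, u₁₁, u₂, u₂₂, -, -, -, -, -, hρ₁, e1, e2, e3, e4, hiff⟩ :=
        hs.exists_preimage_equation hT hp hθ hθ' htr 0 0 γ c κ (by simpa using hU)
      have hu₂ : u₂ = γ * deriv X x₀ / deriv U u₀ := by
        field_simp
        linear_combination e3
      have hu₁ : u₁ = 0 := by simpa [hU] using e1
      have hu₁₁ : u₁₁ = 0 := by simpa [hU, hu₁] using e2
      have h1 := hiff.2 (by rw [mul_zero]; exact hc)
      rw [hu₁₁, mul_zero, hu₂] at h1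
      refine ⟨u₂₂, h1, ?_⟩
      rw [← hτx, ← hτu] at hρ₁
      rw [← hu₂, ← hρ₁]
      linear_combination e4
    -- The old equation determines `u₂₂` from the slope, so the choices `κ = 0` and `κ = 1` give the
    -- same value.
    obtain ⟨a, ha1, ha2⟩ := h 0
    obtain ⟨b, hb1, hb2⟩ := h 1
    have hab : a = b := by
      have : θ.g x₀ * θ.H u₀ * (a - b) = 0 := by linear_combination hb1 - ha1
      exact sub_eq_zero.1 ((mul_eq_zero.1 this).resolve_left hgH)
    subst hab
    have : (τx + γ * deriv X x₀ / deriv U u₀ * τu) * (2 * deriv X x₀) = 0 := by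
      linear_combination ha2 - hb2
    exact (mul_eq_zero.1 this).resolve_right (mul_ne_zero two_ne_zero hX)
  have h0 : τx = 0 := by simpa using key 0
  refine ⟨h0, ?_⟩
  have h1 := key 1
  rw [h0, zero_add, one_mul] at h1
  exact (mul_eq_zero.1 h1).resolve_left (div_ne_zero hX hU)

theorem newT_eq (hs : Splits D T X U) (hT : IsUsualEquivalenceTransformation D T)
    (hD : D.Regular) {p p' : Base} (hp : p ∈ D.base) (hp' : p' ∈ D.base) (ht : p.1 = p'.1) :
    (T.base p).1 = (T.base p').1 := by
  obtain ⟨t, z⟩ := p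
  obtain ⟨t', z'⟩ := p'
  simp only at ht
  subst ht
  have hO : IsOpen (D.Ix ×ˢ D.Iu) := D.isOpenInterval_x.2.1.prod D.isOpenInterval_u.2.1
  have hpc : IsPreconnected (D.Ix ×ˢ D.Iu) :=
    D.isOpenInterval_x.2.2.isPreconnected.prod D.isOpenInterval_u.2.2.isPreconnected
  have hd : ∀ z ∈ D.Ix ×ˢ D.Iu, HasFDerivAt (fun z : ℝ × ℝ => (T.base (t, z)).1)
      (0 : ℝ × ℝ →L[ℝ] ℝ) z := by
    intro z hz
    have hq : (t, z) ∈ D.base := ⟨hp.1, hz⟩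
    have h1 : HasFDerivAt (fun z : ℝ × ℝ => (T.base (t, z)).1) _ z :=
      HasFDerivAt.comp (g := fun q : Base => (T.base q).1) z (hasFDerivAt_newT hT hq)
        (hasFDerivAt_prodMk_right t z)
    obtain ⟨h2, h3⟩ := hs.fderiv_newT hT hD hq
    refine h1.congr_fderiv ?_
    ext
    · simpa using h2
    · simpa using h3
  exact hO.is_const_of_fderiv_eq_zero hpc
    (fun z hz => (hd z hz).differentiableAt.differentiableWithinAt)
    (fun z hz => (hd z hz).fderiv) hp.2 hp'.2

end Splits

/-! ### Affine dependence on `t` and `u`, and the relations between coefficients -/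

theorem IsOpenInterval.exists_eq_affine {I : Set ℝ} (hI : IsOpenInterval I) {φ : ℝ → ℝ}
    (hφ : ∀ x ∈ I, ContDiffAt ℝ ∞ φ x) (h : ∀ x ∈ I, deriv (deriv φ) x = 0) :
    ∃ a b, ∀ x ∈ I, φ x = a * x + b ∧ deriv φ x = a := by
  obtain ⟨a, ha⟩ := hI.2.1.exists_is_const_of_deriv_eq_zero hI.2.2.isPreconnected
    (fun x hx => ((hφ x hx).deriv_infty.differentiableAt (by simp)).differentiableWithinAt) h
  obtain ⟨b, hb⟩ := hI.2.1.exists_eq_add_of_deriv_eq (g := fun x => a * x) hI.2.2.isPreconnected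
    (fun x hx => ((hφ x hx).differentiableAt (by simp)).differentiableWithinAt)
    (by fun_prop) (fun x hx => by rw [ha x hx, deriv_const_mul _ differentiableAt_id]; simp)
  exact ⟨a, b, fun x hx => ⟨hb hx, ha x hx⟩⟩

/-- On the box, the new `t`, `x` and `u` are functions of `t`, `x` and `u`, respectively. -/
structure Separates (D : Box) (T : ProjectibleMap) (S X U : ℝ → ℝ) : Prop
    extends Splits D T X U where
  newT : ∀ p ∈ D.base, (T.base p).1 = S p.1

theorem IsUsualEquivalenceTransformation.exists_separates {D : Box} {T : ProjectibleMap}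
    (hT : IsUsualEquivalenceTransformation D T) (hD : D.Regular) :
    ∃ S X U, Separates D T S X U := by
  obtain ⟨X, U, hs⟩ := hT.exists_splits hD
  obtain ⟨x, hx⟩ := D.isOpenInterval_x.1
  obtain ⟨u, hu⟩ := D.isOpenInterval_u.1
  exact ⟨fun t => (T.base (t, x, u)).1, X, U, hs,
    fun p hp => hs.newT_eq hT hD hp ⟨hp.1, hx, hu⟩ rfl⟩

namespace Separates

variable {D : Box} {T : ProjectibleMap} {S X U : ℝ → ℝ}

theorem contDiffAt_S (hs : Separates D T S X U) (hT : IsUsualEquivalenceTransformation D T)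
    {t : ℝ} (ht : t ∈ D.It) : ContDiffAt ℝ ∞ S t := by
  obtain ⟨x, hx⟩ := D.isOpenInterval_x.1
  obtain ⟨u, hu⟩ := D.isOpenInterval_u.1
  have h1 : ContDiffAt ℝ ∞ (fun s : ℝ => ((s, x, u) : Base)) t := by fun_prop
  have h2 := (ContDiffAt.comp t (hT.contDiffAt_base (Box.mem_base ht hx hu)) h1).fst
  refine h2.congr_of_eventuallyEq ?_
  filter_upwards [D.isOpenInterval_t.2.1.mem_nhds ht] with s hst
  exact (hs.newT (s, x, u) ⟨hst, hx, hu⟩).symm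

theorem deriv_S_ne_zero (hs : Separates D T S X U) (hT : IsUsualEquivalenceTransformation D T)
    {t : ℝ} (ht : t ∈ D.It) : deriv S t ≠ 0 := by
  obtain ⟨x, hx⟩ := D.isOpenInterval_x.1
  obtain ⟨u, hu⟩ := D.isOpenInterval_u.1
  have h1 : HasDerivAt (fun s : ℝ => (T.base (s, x, u)).1) _ t :=
    (Splits.hasFDerivAt_newT hT (Box.mem_base ht hx hu)).comp_hasDerivAt
      (f := fun s => (s, x, u)) t ((hasDerivAt_id t).prodMk (hasDerivAt_const t (x, u)))
  have h2 : S =ᶠ[𝓝 t] fun s : ℝ => (T.base (s, x, u)).1 := by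
    filter_upwards [D.isOpenInterval_t.2.1.mem_nhds ht] with s hst
    exact (hs.newT (s, x, u) ⟨hst, hx, hu⟩).symm
  rw [(h1.congr_of_eventuallyEq h2).deriv]
  exact hs.newT_t_ne_zero hT (Box.mem_base ht hx hu)

/-- The equations for a second-degree polynomial in the new variables and for its preimage. -/
theorem exists_equation (hs : Separates D T S X U) (hT : IsUsualEquivalenceTransformation D T)
    (hD : D.Regular) {t₀ x₀ u₀ : ℝ} (hp : (t₀, x₀, u₀) ∈ D.base) {θ θ' : ArbitraryElements}
    (hθ : θ.InClass D.Ix D.Iu) (hθ' : θ'.InClass ((fun p => (T.base p).2.1) '' D.base)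
      ((fun p => (T.base p).2.2) '' D.base))
    (htr : T.TransformsEquation D θ θ') (α β γ c : ℝ) :
    ∃ u₁ u₁₁ u₂ u₂₂ : ℝ, deriv U u₀ * u₁ = β * deriv S t₀ ∧
      deriv (deriv U) u₀ * u₁ ^ 2 + deriv U u₀ * u₁₁ =
        β * deriv (deriv S) t₀ + α * deriv S t₀ ^ 2 ∧
      deriv U u₀ * u₂ = γ * deriv X x₀ ∧
      deriv (deriv U) u₀ * u₂ ^ 2 + deriv U u₀ * u₂₂ =
        γ * deriv (deriv X) x₀ + c * deriv X x₀ ^ 2 ∧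
      (θ.f x₀ * u₁₁ = θ.g x₀ * θ.H u₀ * u₂₂
          + (deriv θ.g x₀ * θ.H u₀ + θ.h x₀ * θ.K u₀) * u₂
          + θ.g x₀ * deriv θ.H u₀ * u₂ ^ 2 ↔
        θ'.f (X x₀) * α = θ'.g (X x₀) * θ'.H (U u₀) * c
          + (deriv θ'.g (X x₀) * θ'.H (U u₀) + θ'.h (X x₀) * θ'.K (U u₀)) * γ
          + θ'.g (X x₀) * deriv θ'.H (U u₀) * γ ^ 2) := by
  have hβ : deriv U u₀ - β * fderiv ℝ (fun q => (T.base q).1) (t₀, x₀, u₀) (0, 0, 1) ≠ 0 := by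
    rw [(hs.fderiv_newT hT hD hp).2, mul_zero, sub_zero]
    exact hs.deriv_U_ne_zero hT hp.2.2
  obtain ⟨u, σ₁, σ₂, ρ₁, ρ₂, u₁, u₁₁, u₂, u₂₂, hu0, ju, jx, jσ, jρ, -, e1, e2, e3, e4, hiff⟩ :=
    hs.exists_preimage_equation hT hp hθ hθ' htr α β γ c 0 hβ
  have jS := HasJetAt.of_contDiffAt (hs.contDiffAt_S hT hp.1)
  have jσ' : HasJetAt (fun s => (T.base (s, x₀, u s x₀)).1) t₀ (deriv S t₀)
      (deriv (deriv S) t₀) := by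
    refine jS.congr ?_
    have hu := ju.hasDerivAt.continuousAt.eventually_mem
      (D.isOpenInterval_u.2.1.mem_nhds (by simpa only [hu0] using hp.2.2))
    filter_upwards [hu, D.isOpenInterval_t.2.1.mem_nhds hp.1] with s hsu hst
    exact hs.newT (s, x₀, u s x₀) ⟨hst, hp.2.1, hsu⟩
  have jρ' : HasJetAt (fun y => (T.base (t₀, y, u t₀ y)).1) x₀ 0 0 := by
    refine (HasJetAt.const x₀ (S t₀)).congr ?_
    have hu := jx.hasDerivAt.continuousAt.eventually_mem
      (D.isOpenInterval_u.2.1.mem_nhds (by simpa only [hu0] using hp.2.2))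
    filter_upwards [hu, D.isOpenInterval_x.2.1.mem_nhds hp.2.1] with y hyu hyx
    exact hs.newT (t₀, y, u t₀ y) ⟨hp.1, hyx, hyu⟩
  obtain rfl := jσ.fst_unique jσ'
  obtain rfl := jσ.snd_unique jσ'
  obtain rfl := jρ.fst_unique jρ'
  obtain rfl := jρ.snd_unique jρ'
  exact ⟨u₁, u₁₁, u₂, u₂₂, e1, e2, by linear_combination e3, by linear_combination e4, hiff⟩

/-- A polynomial linear in the new `t` satisfies the new equation for every slope `β`, and the old
equation then forces `u_tt = 0`. In the resulting identity `key` one side is even in `β` and the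
other odd, so both vanish. -/
theorem deriv_deriv_eq_zero (hs : Separates D T S X U)
    (hT : IsUsualEquivalenceTransformation D T) (hD : D.Regular) {t₀ x₀ u₀ : ℝ}
    (hp : (t₀, x₀, u₀) ∈ D.base) : deriv (deriv S) t₀ = 0 ∧ deriv (deriv U) u₀ = 0 := by
  obtain ⟨f, g, h, H, K, he⟩ := D.exists_mem_elem
  obtain ⟨θ, hθs, hθ, -⟩ := hD.exists_arbitraryElements hp he 0 0 0
  obtain ⟨θ', hθ', -, htr⟩ := hT.preserves θ hθ fun p _ => hθs.val_mem p
  have hU := hs.deriv_U_ne_zero hT hp.2.2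
  have hS := hs.deriv_S_ne_zero hT hp.1
  have key : ∀ β, deriv (deriv U) u₀ * (β * deriv S t₀) ^ 2 =
      β * deriv (deriv S) t₀ * deriv U u₀ ^ 2 := by
    intro β
    obtain ⟨u₁, u₁₁, u₂, u₂₂, e1, e2, e3, e4, hiff⟩ :=
      hs.exists_equation hT hD hp hθ hθ' htr 0 β 0 0
    have hu₂ : u₂ = 0 := by simpa [hU] using e3
    have hu₂₂ : u₂₂ = 0 := by simpa [hU, hu₂] using e4
    have h1 := hiff.2 (by ring)
    rw [hu₂, hu₂₂] at h1
    have hu₁₁ : u₁₁ = 0 := by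
      have : θ.f x₀ * u₁₁ = 0 := by linear_combination h1
      exact (mul_eq_zero.1 this).resolve_left (hθ.f_ne_zero _ hp.2.1)
    rw [← e1]
    rw [hu₁₁] at e2
    linear_combination deriv U u₀ ^ 2 * e2
  have h1 := key 1
  have h2 := key (-1)
  constructor
  · have : deriv (deriv S) t₀ * (2 * deriv U u₀ ^ 2) = 0 := by linear_combination h2 - h1
    exact (mul_eq_zero.1 this).resolve_right (by positivity)
  · have : deriv (deriv U) u₀ * (2 * deriv S t₀ ^ 2) = 0 := by linear_combination h2 + h1
    exact (mul_eq_zero.1 this).resolve_right (by positivity)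

/-- The relation between the coefficients of the second-order derivatives. -/
theorem principal_relation (hs : Separates D T S X U)
    (hT : IsUsualEquivalenceTransformation D T) (hD : D.Regular) {t₀ x₀ u₀ : ℝ}
    (hp : (t₀, x₀, u₀) ∈ D.base) {θ θ' : ArbitraryElements} (hθ : θ.InClass D.Ix D.Iu)
    (hθ' : θ'.InClass ((fun p => (T.base p).2.1) '' D.base)
      ((fun p => (T.base p).2.2) '' D.base))
    (htr : T.TransformsEquation D θ θ') :
    θ.f x₀ * deriv S t₀ ^ 2 * (θ'.g (X x₀) * θ'.H (U u₀)) =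
      θ.g x₀ * θ.H u₀ * θ'.f (X x₀) * deriv X x₀ ^ 2 := by
  have hU := hs.deriv_U_ne_zero hT hp.2.2
  -- With zero slopes the new equation is a balance of two second-order terms; these values of `α`
  -- and `c` satisfy it without any division.
  obtain ⟨u₁, u₁₁, u₂, u₂₂, e1, e2, e3, e4, hiff⟩ :=
    hs.exists_equation hT hD hp hθ hθ' htr (θ'.g (X x₀) * θ'.H (U u₀)) 0 0 (θ'.f (X x₀))
  have hu₂ : u₂ = 0 := by simpa [hU] using e3
  have hu₁ : u₁ = 0 := by simpa [hU] using e1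
  have h1 := hiff.2 (by ring)
  rw [hu₂] at h1 e4
  rw [hu₁] at e2
  linear_combination deriv U u₀ * h1 - θ.f x₀ * e2 + θ.g x₀ * θ.H u₀ * e4

/-- The relation between the coefficients of the first-order derivative. -/
theorem subprincipal_relation (hs : Separates D T S X U)
    (hT : IsUsualEquivalenceTransformation D T) (hD : D.Regular) {t₀ x₀ u₀ : ℝ}
    (hp : (t₀, x₀, u₀) ∈ D.base) {θ θ' : ArbitraryElements} (hθ : θ.InClass D.Ix D.Iu)
    (hθ' : θ'.InClass ((fun p => (T.base p).2.1) '' D.base)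
      ((fun p => (T.base p).2.2) '' D.base))
    (htr : T.TransformsEquation D θ θ') :
    (deriv θ'.g (X x₀) * θ'.H (U u₀) + θ'.h (X x₀) * θ'.K (U u₀)) *
        (θ.g x₀ * θ.H u₀ * deriv X x₀ ^ 2) =
      θ'.g (X x₀) * θ'.H (U u₀) * (θ.g x₀ * θ.H u₀ * deriv (deriv X) x₀ +
        (deriv θ.g x₀ * θ.H u₀ + θ.h x₀ * θ.K u₀) * deriv X x₀) := by
  have hU := hs.deriv_U_ne_zero hT hp.2.2
  have hU2 := (hs.deriv_deriv_eq_zero hT hD hp).2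
  have hG : θ'.g (X x₀) * θ'.H (U u₀) ≠ 0 :=
    mul_ne_zero (hθ'.g_ne_zero _ (hs.newX_mem hp)) (hθ'.H_ne_zero _ (hs.newU_mem hp))
  set G := θ'.g (X x₀) * θ'.H (U u₀) with hGdef
  set A := deriv θ'.g (X x₀) * θ'.H (U u₀) + θ'.h (X x₀) * θ'.K (U u₀) with hA
  set P := deriv θ.g x₀ * θ.H u₀ + θ.h x₀ * θ.K u₀ with hP
  have key : ∀ γ, ∃ c u₂ u₂₂, G * c = -(A * γ + θ'.g (X x₀) * deriv θ'.H (U u₀) * γ ^ 2) ∧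
      deriv U u₀ * u₂ = γ * deriv X x₀ ∧
      deriv U u₀ * u₂₂ = γ * deriv (deriv X) x₀ + c * deriv X x₀ ^ 2 ∧
      0 = θ.g x₀ * θ.H u₀ * u₂₂ + P * u₂ + θ.g x₀ * deriv θ.H u₀ * u₂ ^ 2 := by
    intro γ
    obtain ⟨c, hc⟩ : ∃ c, G * c = -(A * γ + θ'.g (X x₀) * deriv θ'.H (U u₀) * γ ^ 2) :=
      ⟨-(A * γ + θ'.g (X x₀) * deriv θ'.H (U u₀) * γ ^ 2) / G, mul_div_cancel₀ _ hG⟩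
    obtain ⟨u₁, u₁₁, u₂, u₂₂, e1, e2, e3, e4, hiff⟩ :=
      hs.exists_equation hT hD hp hθ hθ' htr 0 0 γ c
    have hu₁ : u₁ = 0 := by simpa [hU] using e1
    have hu₁₁ : u₁₁ = 0 := by simpa [hU, hu₁] using e2
    have h1 := hiff.2 (by linear_combination -hc)
    rw [hu₁₁, mul_zero] at h1
    rw [hU2, zero_mul, zero_add] at e4
    exact ⟨c, u₂, u₂₂, hc, e3, e4, h1⟩
  -- The terms with the derivatives of `H` are quadratic in `γ`. Subtracting the cases `γ = 1` and
  -- `γ = -1` cancels them and isolates the part linear in `γ`.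
  obtain ⟨c, u₂, u₂₂, h1, h2, h3, h4⟩ := key 1
  obtain ⟨c', u₂', u₂₂', h1', h2', h3', h4'⟩ := key (-1)
  have hu : u₂' = -u₂ := mul_left_cancel₀ hU (by linear_combination h2' + h2)
  subst hu
  linear_combination (-1 / 2 : ℝ) * deriv U u₀ * G * (h4' - h4)
    + (1 / 2 : ℝ) * (θ.g x₀ * θ.H u₀ * deriv X x₀ ^ 2) * (h1 - h1')
    + (-1 / 2 : ℝ) * (θ.g x₀ * θ.H u₀ * G) * (h3' - h3)
    + P * G * h2

end Separates

/-! ### The form of the equivalence transformations -/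

/-- The transformation `T` is given on the box `D` by the formulas with the function `X` and the
constants `δ₁, …, δ₄, ε₁, ε₂, ε₃`. -/
structure HasForm (D : Box) (T : ProjectibleMap) (δ₁ δ₂ δ₃ δ₄ ε₁ ε₂ ε₃ : ℝ) (X : ℝ → ℝ) :
    Prop where
  ne_zero : δ₁ * δ₃ * ε₁ * ε₂ * ε₃ ≠ 0
  smooth_X : ContDiffOn ℝ ∞ X D.Ix
  deriv_X : ∀ x ∈ D.Ix, deriv X x ≠ 0
  base : ∀ t x u : ℝ, (t, x, u) ∈ D.base → T.base (t, x, u) = (δ₁ * t + δ₂, X x, δ₃ * u + δ₄)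
  elem : ∀ t x u f g h H K : ℝ, (t, x, u) ∈ D.base → (f, g, h, H, K) ∈ D.elem →
    T.elem (t, x, u) (f, g, h, H, K) =
      (ε₁ * δ₁ ^ 2 / deriv X x * f, ε₁ * ε₂⁻¹ * deriv X x * g, ε₁ * ε₃⁻¹ * h, ε₂ * H, ε₃ * K)

theorem IsOpenInterval.eq_of_hasDerivAt_zero {I : Set ℝ} (hI : IsOpenInterval I) {φ : ℝ → ℝ}
    (h : ∀ x ∈ I, HasDerivAt φ 0 x) {x y : ℝ} (hx : x ∈ I) (hy : y ∈ I) : φ x = φ y :=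
  hI.2.1.is_const_of_deriv_eq_zero hI.2.2.isPreconnected
    (fun x hx => (h x hx).differentiableAt.differentiableWithinAt) (fun x hx => (h x hx).deriv)
    hx hy

/-! ### Identities in the values of the arbitrary elements; the form of the new `g` -/

namespace Separates

variable {D : Box} {T : ProjectibleMap} {S X U : ℝ → ℝ}

theorem _root_.Telegraph.IsUsualEquivalenceTransformation.elem_g_H_ne_zero
    (hT : IsUsualEquivalenceTransformation D T) (hD : D.Regular) {p : Base} (hp : p ∈ D.base)
    {e : Elem} (he : e ∈ D.elem) :
    (T.elem p e).2.1 ≠ 0 ∧ (T.elem p e).2.2.2.1 ≠ 0 := by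
  obtain ⟨t, x, u⟩ := p
  obtain ⟨f, g, h, H, K⟩ := e
  obtain ⟨θ, hθs, hθ, hθe, -⟩ := hD.exists_arbitraryElements hp he 0 0 0
  obtain ⟨θ', hθ', hval, -⟩ := hT.preserves θ hθ fun p _ => hθs.val_mem p
  have hv := hval _ hp
  rw [hθe] at hv
  rw [← hv]
  exact ⟨hθ'.g_ne_zero _ ⟨_, hp, rfl⟩, hθ'.H_ne_zero _ ⟨_, hp, rfl⟩⟩

/-- Every point of `D.elem` is the value at `p` of some tuple of the class, so `principal_relation`
becomes an identity in the independent variables `f, g, h, H, K`. -/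
theorem principal_eq (hs : Separates D T S X U) (hT : IsUsualEquivalenceTransformation D T)
    (hD : D.Regular) {t x u f g h H K : ℝ} (hp : (t, x, u) ∈ D.base)
    (he : (f, g, h, H, K) ∈ D.elem) :
    f * deriv S t ^ 2 * ((T.elem (t, x, u) (f, g, h, H, K)).2.1 *
        (T.elem (t, x, u) (f, g, h, H, K)).2.2.2.1) =
      g * H * (T.elem (t, x, u) (f, g, h, H, K)).1 * deriv X x ^ 2 := by
  obtain ⟨θ, hθs, hθ, hθe, -⟩ := hD.exists_arbitraryElements hp he 0 0 0
  obtain ⟨θ', hθ', hval, htr⟩ := hT.preserves θ hθ fun p _ => hθs.val_mem p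
  have h1 := hs.principal_relation hT hD hp hθ hθ' htr
  have hv := hval _ hp
  rw [hθe] at hv
  rw [← hv]
  simp only [ArbitraryElements.val, Prod.mk.injEq] at hθe
  obtain ⟨rfl, rfl, rfl, rfl, rfl⟩ := hθe
  simp only [ArbitraryElements.val]
  rw [hs.newX _ hp, hs.newU _ hp]
  exact h1

/-- Along a given tuple with `t` and `u` fixed, the new `g` composed with `X` is the `g`-component
of the map on the curve of values. Its derivative is taken in the direction whose `f, g, h`
components `a, b, d` are the derivatives of the tuple, and these are free. -/
theorem subprincipal_eq (hs : Separates D T S X U) (hT : IsUsualEquivalenceTransformation D T)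
    (hD : D.Regular) {t x u f g h H K : ℝ} (hp : (t, x, u) ∈ D.base)
    (he : (f, g, h, H, K) ∈ D.elem) (a b d : ℝ) :
    (fderiv ℝ (fun q : Base × Elem => (T.elem q.1 q.2).2.1) ((t, x, u), (f, g, h, H, K))
          ((0, 1, 0), (a, b, d, 0, 0)) * (T.elem (t, x, u) (f, g, h, H, K)).2.2.2.1 +
        (T.elem (t, x, u) (f, g, h, H, K)).2.2.1 * (T.elem (t, x, u) (f, g, h, H, K)).2.2.2.2 *
          deriv X x) * (g * H * deriv X x) =
      (T.elem (t, x, u) (f, g, h, H, K)).2.1 * (T.elem (t, x, u) (f, g, h, H, K)).2.2.2.1 *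
        (g * H * deriv (deriv X) x + (b * H + h * K) * deriv X x) := by
  obtain ⟨θ, hθs, hθ, hθe, hfd, hgd, hhd, -⟩ := hD.exists_arbitraryElements hp he a b d
  obtain ⟨θ', hθ', hval, htr⟩ := hT.preserves θ hθ fun p _ => hθs.val_mem p
  have h1 := hs.subprincipal_relation hT hD hp hθ hθ' htr
  have hv := hval _ hp
  rw [hθe] at hv
  have hTg : HasFDerivAt (fun q : Base × Elem => (T.elem q.1 q.2).2.1)
      (fderiv ℝ (fun q : Base × Elem => (T.elem q.1 q.2).2.1) ((t, x, u), (f, g, h, H, K)))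
      ((t, x, u), θ.val (t, x, u)) := by
    rw [hθe]
    exact ((hT.contDiffAt_elem hp he).snd.fst.differentiableAt (by simp)).hasFDerivAt
  have hcurve : HasDerivAt (fun y => (((t, y, u), θ.val (t, y, u)) : Base × Elem))
      ((0, 1, 0), (a, b, d, 0, 0)) x :=
    ((hasDerivAt_const x t).prodMk ((hasDerivAt_id x).prodMk (hasDerivAt_const x u))).prodMk
      (hfd.prodMk (hgd.prodMk (hhd.prodMk ((hasDerivAt_const x (θ.H u)).prodMk
        (hasDerivAt_const x (θ.K u))))))
  have h2 := hTg.comp_hasDerivAt (f := fun y => (((t, y, u), θ.val (t, y, u)) : Base × Elem)) x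
    hcurve
  have hg' : DifferentiableAt ℝ θ'.g (X x) :=
    (hθ'.smooth_g.contDiffAt (hs.image_newX_mem_nhds hT hp.2.1)).differentiableAt (by simp)
  have h3 := (hg'.hasDerivAt.comp x (hs.hasDerivAt_X hT hp.2.1)).congr_of_eventuallyEq
    (f₁ := (fun q : Base × Elem => (T.elem q.1 q.2).2.1) ∘
      fun y => (((t, y, u), θ.val (t, y, u)) : Base × Elem)) (by
      filter_upwards [D.isOpenInterval_x.2.1.mem_nhds hp.2.1] with y hy
      have hq : (t, y, u) ∈ D.base := ⟨hp.1, hy, hp.2.2⟩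
      simp only [Function.comp]
      rw [← hval _ hq, ← hs.newX _ hq]
      rfl)
  rw [h2.unique h3]
  rw [← hv]
  simp only [ArbitraryElements.val, Prod.mk.injEq] at hθe
  obtain ⟨rfl, rfl, rfl, rfl, rfl⟩ := hθe
  simp only [ArbitraryElements.val]
  rw [hs.newX _ hp, hs.newU _ hp]
  rw [hgd.deriv] at h1
  linear_combination h1

/-- `subprincipal_eq` is an identity of first degree in the free parameters `a, b, d`, and their
coefficients are compared one at a time. -/
theorem fderiv_elem_g (hs : Separates D T S X U) (hT : IsUsualEquivalenceTransformation D T)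
    (hD : D.Regular) {t x u f g h H K : ℝ} (hp : (t, x, u) ∈ D.base)
    (he : (f, g, h, H, K) ∈ D.elem) :
    fderiv ℝ (fun q : Base × Elem => (T.elem q.1 q.2).2.1) ((t, x, u), (f, g, h, H, K))
        (0, (1, 0, 0, 0, 0)) = 0 ∧
      fderiv ℝ (fun q : Base × Elem => (T.elem q.1 q.2).2.1) ((t, x, u), (f, g, h, H, K))
        (0, (0, 1, 0, 0, 0)) * g = (T.elem (t, x, u) (f, g, h, H, K)).2.1 ∧
      fderiv ℝ (fun q : Base × Elem => (T.elem q.1 q.2).2.1) ((t, x, u), (f, g, h, H, K))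
        (0, (0, 0, 1, 0, 0)) = 0 := by
  have key := fun a b d => hs.subprincipal_eq hT hD hp he a b d
  set L := fderiv ℝ (fun q : Base × Elem => (T.elem q.1 q.2).2.1) ((t, x, u), (f, g, h, H, K))
  have hsplit : ∀ a b d : ℝ, L ((0, 1, 0), (a, b, d, 0, 0)) = L ((0, 1, 0), 0) +
      a * L (0, (1, 0, 0, 0, 0)) + b * L (0, (0, 1, 0, 0, 0)) + d * L (0, (0, 0, 1, 0, 0)) := by
    intro a b d
    have : (((0, 1, 0), (a, b, d, 0, 0)) : Base × Elem) = ((0, 1, 0), 0) +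
        a • (0, (1, 0, 0, 0, 0)) + b • (0, (0, 1, 0, 0, 0)) + d • (0, (0, 0, 1, 0, 0)) := by
      simp
    rw [this]
    simp only [map_add, map_smul, smul_eq_mul]
  simp only [hsplit] at key
  have hg := hD.g_ne _ he.2.1
  have hH := hD.H_ne _ he.2.2.2.1
  have hX := hs.deriv_X_ne_zero hT hp.2.1
  have hE := (hT.elem_g_H_ne_zero hD hp he).2
  have hne : (T.elem (t, x, u) (f, g, h, H, K)).2.2.2.1 * (g * H * deriv X x) ≠ 0 :=
    mul_ne_zero hE (mul_ne_zero (mul_ne_zero hg hH) hX)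
  have hne' : (T.elem (t, x, u) (f, g, h, H, K)).2.2.2.1 * (H * deriv X x) ≠ 0 :=
    mul_ne_zero hE (mul_ne_zero hH hX)
  refine ⟨?_, ?_, ?_⟩
  · refine (mul_eq_zero.1 ?_).resolve_right hne
    linear_combination key 1 0 0 - key 0 0 0
  · refine mul_right_cancel₀ hne' ?_
    linear_combination key 0 1 0 - key 0 0 0
  · refine (mul_eq_zero.1 ?_).resolve_right hne
    linear_combination key 0 0 1 - key 0 0 0

/-- By `fderiv_elem_g` the new `g` is constant in `f` and `h`, and its quotient by `g` is constant
in `g`; by `fgh_eq` it ignores `t, u, H, K`. Hence this quotient depends on `x` alone. -/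
theorem elem_g_mul (hs : Separates D T S X U) (hT : IsUsualEquivalenceTransformation D T)
    (hD : D.Regular) {p p' : Base} (hp : p ∈ D.base) (hp' : p' ∈ D.base) {e e' : Elem}
    (he : e ∈ D.elem) (he' : e' ∈ D.elem) (hx : p.2.1 = p'.2.1) :
    (T.elem p e).2.1 * e'.2.1 = (T.elem p' e').2.1 * e.2.1 := by
  obtain ⟨t, x, u⟩ := p
  obtain ⟨f, g, h, H, K⟩ := e
  obtain ⟨f', g', h', H', K'⟩ := e'
  have hd : ∀ {f g h : ℝ}, (f, g, h, H, K) ∈ D.elem → HasFDerivAt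
      (fun q : Base × Elem => (T.elem q.1 q.2).2.1)
      (fderiv ℝ (fun q : Base × Elem => (T.elem q.1 q.2).2.1) ((t, x, u), (f, g, h, H, K)))
      ((t, x, u), (f, g, h, H, K)) := fun he =>
    ((hT.contDiffAt_elem hp he).snd.fst.differentiableAt (by simp)).hasFDerivAt
  obtain ⟨hf, hg, hh, hH, hK⟩ := he
  obtain ⟨hf', hg', hh', hH', hK'⟩ := he'
  let E : ℝ → ℝ → ℝ → ℝ := fun f g h => (T.elem (t, x, u) (f, g, h, H, K)).2.1
  have h1 : E f g h = E f' g h := by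
    refine D.isOpenInterval_f.eq_of_hasDerivAt_zero (φ := fun s => E s g h) (fun s hs' => ?_) hf hf'
    have he := Box.mem_elem hs' hg hh hH hK
    refine ((hd he).comp_hasDerivAt (f := fun s => ((t, x, u), (s, g, h, H, K))) s
      ((hasDerivAt_const s _).prodMk ((hasDerivAt_id s).prodMk (hasDerivAt_const s _)))).congr_deriv
      ?_
    exact (hs.fderiv_elem_g hT hD hp he).1
  have h2 : E f' g h = E f' g h' := by
    refine D.isOpenInterval_h.eq_of_hasDerivAt_zero (φ := fun s => E f' g s) (fun s hs' => ?_)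
      hh hh'
    have he := Box.mem_elem hf' hg hs' hH hK
    refine ((hd he).comp_hasDerivAt (f := fun s => ((t, x, u), (f', g, s, H, K))) s
      ((hasDerivAt_const s _).prodMk ((hasDerivAt_const s _).prodMk ((hasDerivAt_const s _).prodMk
        ((hasDerivAt_id s).prodMk (hasDerivAt_const s _)))))).congr_deriv ?_
    exact (hs.fderiv_elem_g hT hD hp he).2.2
  have h3 : E f' g h' / g = E f' g' h' / g' := by
    refine D.isOpenInterval_g.eq_of_hasDerivAt_zero (φ := fun s => E f' s h' / s)
      (fun s hs' => ?_) hg hg'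
    have he := Box.mem_elem hf' hs' hh' hH hK
    have hE := (hd he).comp_hasDerivAt (f := fun s => ((t, x, u), (f', s, h', H, K))) s
      ((hasDerivAt_const s _).prodMk ((hasDerivAt_const s _).prodMk ((hasDerivAt_id s).prodMk
        (hasDerivAt_const s _))))
    refine (hE.div (hasDerivAt_id s) (hD.g_ne s hs')).congr_deriv ?_
    have h4 := (hs.fderiv_elem_g hT hD hp he).2.1
    have hzero : ((0 : Base), ((0, 1, 0) : ℝ × ℝ × (ℝ × ℝ × ℝ))) = (0, (0, 1, 0, 0, 0)) := rfl
    simp only [Function.comp, _root_.id, mul_one, hzero]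
    rw [h4, sub_self, zero_div]
  have h4 : E f' g' h' = (T.elem p' (f', g', h', H', K')).2.1 := by
    have := hT.fgh_eq hD hp hp' (Box.mem_elem hf' hg' hh' hH hK) (Box.mem_elem hf' hg' hh' hH' hK')
      hx rfl
    exact congrArg (fun v : ℝ × ℝ × ℝ => v.2.1) this
  rw [div_eq_div_iff (hD.g_ne g hg) (hD.g_ne g' hg')] at h3
  change E f g h * g' = _ * g
  rw [h1, h2, h3, h4]

end Separates

namespace Separates

variable {D : Box} {T : ProjectibleMap} {S X U : ℝ → ℝ}

/-- The function `k` is the quotient of the new and old `g` with all arguments except `x` frozen.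
Its derivative is recorded because it is the term of `subprincipal_eq` left when `a = b = d = 0`. -/
theorem exists_elem_g_eq (hs : Separates D T S X U) (hT : IsUsualEquivalenceTransformation D T)
    (hD : D.Regular) : ∃ k k' : ℝ → ℝ, ∀ t x u f g h H K, (t, x, u) ∈ D.base →
      (f, g, h, H, K) ∈ D.elem → HasDerivAt k (k' x) x ∧ k x ≠ 0 ∧
      (T.elem (t, x, u) (f, g, h, H, K)).2.1 = k x * g ∧
      fderiv ℝ (fun q : Base × Elem => (T.elem q.1 q.2).2.1) ((t, x, u), (f, g, h, H, K))
        ((0, 1, 0), 0) = k' x * g := by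
  obtain ⟨t₀, ht₀⟩ := D.isOpenInterval_t.1
  obtain ⟨u₀, hu₀⟩ := D.isOpenInterval_u.1
  obtain ⟨f₀, g₀, h₀, H₀, K₀, he₀⟩ := D.exists_mem_elem
  have hg₀ := hD.g_ne _ he₀.2.1
  let k : ℝ → ℝ := fun y => (T.elem (t₀, y, u₀) (f₀, g₀, h₀, H₀, K₀)).2.1 / g₀
  have hd : ∀ {t x u : ℝ} {e : Elem}, (t, x, u) ∈ D.base → e ∈ D.elem →
      HasDerivAt (fun y => (T.elem (t, y, u) e).2.1)
        (fderiv ℝ (fun q : Base × Elem => (T.elem q.1 q.2).2.1) ((t, x, u), e)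
          ((0, 1, 0), 0)) x := by
    intro t x u e hp he
    exact ((hT.contDiffAt_elem hp he).snd.fst.differentiableAt
      (by simp)).hasFDerivAt.comp_hasDerivAt (f := fun y => (((t, y, u), e) : Base × Elem)) x
        (((hasDerivAt_const x t).prodMk ((hasDerivAt_id x).prodMk (hasDerivAt_const x u))).prodMk
          (hasDerivAt_const x e))
  have hk : ∀ {t x u : ℝ} {f g h H K : ℝ}, (t, x, u) ∈ D.base → (f, g, h, H, K) ∈ D.elem →
      (T.elem (t, x, u) (f, g, h, H, K)).2.1 = k x * g := by
    intro t x u f g h H K hp he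
    have h1 := hs.elem_g_mul hT hD hp (Box.mem_base ht₀ hp.2.1 hu₀) he he₀ rfl
    simp only [k]
    rw [div_mul_eq_mul_div, eq_div_iff hg₀]
    exact h1
  refine ⟨k, deriv k, fun t x u f g h H K hp he => ?_⟩
  have hkd : HasDerivAt k (deriv k x) x :=
    ((hd (Box.mem_base ht₀ hp.2.1 hu₀) he₀).div_const g₀).differentiableAt.hasDerivAt
  refine ⟨hkd, ?_, hk hp he, ?_⟩
  · exact div_ne_zero (hT.elem_g_H_ne_zero hD (Box.mem_base ht₀ hp.2.1 hu₀) he₀).1 hg₀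
  · refine (hd hp he).unique ((hkd.mul_const g).congr_of_eventuallyEq ?_)
    filter_upwards [D.isOpenInterval_x.2.1.mem_nhds hp.2.1] with y hy
    exact hk ⟨hp.1, hy, hp.2.2⟩ he

end Separates

/-- The form of the equivalence transformations on boxes where `f`, `g` and `H` do not vanish. -/
theorem IsUsualEquivalenceTransformation.exists_hasForm_of_regular {D : Box} {T : ProjectibleMap}
    (hT : IsUsualEquivalenceTransformation D T) (hD : D.Regular) :
    ∃ δ₁ δ₂ δ₃ δ₄ ε₁ ε₂ ε₃ X, HasForm D T δ₁ δ₂ δ₃ δ₄ ε₁ ε₂ ε₃ X := by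
  obtain ⟨S, X, U, hs⟩ := hT.exists_separates hD
  obtain ⟨t₀, ht₀⟩ := D.isOpenInterval_t.1
  obtain ⟨x₀, hx₀⟩ := D.isOpenInterval_x.1
  obtain ⟨u₀, hu₀⟩ := D.isOpenInterval_u.1
  obtain ⟨δ₁, δ₂, hS⟩ := D.isOpenInterval_t.exists_eq_affine (φ := S)
    (fun t ht => hs.contDiffAt_S hT ht)
    (fun t ht => (hs.deriv_deriv_eq_zero hT hD (Box.mem_base ht hx₀ hu₀)).1)
  obtain ⟨δ₃, δ₄, hU⟩ := D.isOpenInterval_u.exists_eq_affine (φ := U)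
    (fun u hu => hs.contDiffAt_U hT hu)
    (fun u hu => (hs.deriv_deriv_eq_zero hT hD (Box.mem_base ht₀ hx₀ hu)).2)
  have hδ₁ : δ₁ ≠ 0 := (hS t₀ ht₀).2 ▸ hs.deriv_S_ne_zero hT ht₀
  have hδ₃ : δ₃ ≠ 0 := (hU u₀ hu₀).2 ▸ hs.deriv_U_ne_zero hT hu₀
  obtain ⟨k, k', hk⟩ := hs.exists_elem_g_eq hT hD
  obtain ⟨f₀, g₀, h₀', H₀, K₀', he₀⟩ := D.exists_mem_elem
  obtain ⟨hf₀, hg₀, hh₀', hH₀, hK₀'⟩ := he₀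
  -- Nonzero reference values of `h` and `K` ensure later that the new `h` and `K` at the reference
  -- point do not vanish.
  obtain ⟨h₀, hh₀, hh₀0⟩ := D.isOpenInterval_h.exists_ne 0
  obtain ⟨K₀, hK₀, hK₀0⟩ := D.isOpenInterval_K.exists_ne 0
  have hp₀ := Box.mem_base ht₀ hx₀ hu₀
  have he₀ := Box.mem_elem hf₀ hg₀ hh₀ hH₀ hK₀
  have hf_ne := hD.f_ne
  have hg_ne := hD.g_ne
  have hH_ne := hD.H_ne
  have hX := fun x hx => hs.deriv_X_ne_zero hT (x := x) hx
  -- the ratio of the new and the old values of `H`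
  have hprin : ∀ t x u f g h H K, (t, x, u) ∈ D.base → (f, g, h, H, K) ∈ D.elem →
      f * δ₁ ^ 2 * k x * (T.elem (t, x, u) (f, g, h, H, K)).2.2.2.1 =
        H * (T.elem (t, x, u) (f, g, h, H, K)).1 * deriv X x ^ 2 := by
    intro t x u f g h H K hp he
    have h1 := hs.principal_eq hT hD hp he
    rw [(hk t x u f g h H K hp he).2.2.1, (hS t hp.1).2] at h1
    refine mul_left_cancel₀ (hg_ne g he.2.1) ?_
    linear_combination h1
  set ε₂ := (T.elem (t₀, x₀, u₀) (f₀, g₀, h₀, H₀, K₀)).2.2.2.1 / H₀ with hε₂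
  have hε₂0 : ε₂ ≠ 0 := div_ne_zero (hT.elem_g_H_ne_zero hD hp₀ he₀).2 (hH_ne _ hH₀)
  have hEH : ∀ t x u f g h H K, (t, x, u) ∈ D.base → (f, g, h, H, K) ∈ D.elem →
      (T.elem (t, x, u) (f, g, h, H, K)).2.2.2.1 = ε₂ * H := by
    intro t x u f g h H K hp he
    -- With `x, f, g, h` moved to the reference values the new `H` does not change, while the new
    -- `f` becomes a constant; the second-order relation then makes the new `H` proportional to `H`.
    have hp₁ : (t₀, x₀, u) ∈ D.base := ⟨ht₀, hx₀, hp.2.2⟩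
    have he₁ : (f₀, g₀, h₀, H, K) ∈ D.elem := ⟨hf₀, hg₀, hh₀, he.2.2.2.1, he.2.2.2.2⟩
    have h1 := congrArg Prod.fst (hT.HK_eq hD hp hp₁ he he₁ rfl rfl)
    have h2 := congrArg Prod.fst (hT.fgh_eq hD hp₁ hp₀ he₁ he₀ rfl rfl)
    simp only [HK, fgh] at h1 h2
    rw [h1]
    have h3 := hprin _ _ _ _ _ _ _ _ hp₁ he₁
    have h4 := hprin _ _ _ _ _ _ _ _ hp₀ he₀
    rw [h2] at h3
    have hne : f₀ * δ₁ ^ 2 * k x₀ ≠ 0 :=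
      mul_ne_zero (mul_ne_zero (hf_ne _ hf₀) (pow_ne_zero 2 hδ₁)) (hk _ _ _ _ _ _ _ _ hp₀ he₀).2.1
    rw [hε₂, div_mul_eq_mul_div, eq_div_iff (hH_ne _ hH₀)]
    refine mul_left_cancel₀ hne ?_
    linear_combination H₀ * h3 - H * h4
  have hsub : ∀ t x u f g h H K, (t, x, u) ∈ D.base → (f, g, h, H, K) ∈ D.elem →
      (T.elem (t, x, u) (f, g, h, H, K)).2.2.1 * (T.elem (t, x, u) (f, g, h, H, K)).2.2.2.2 *
        deriv X x ^ 2 = k x * ε₂ * deriv X x * (h * K) +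
          ε₂ * g * H * (k x * deriv (deriv X) x - k' x * deriv X x) := by
    intro t x u f g h H K hp he
    have h1 := hs.subprincipal_eq hT hD hp he 0 0 0
    obtain ⟨-, -, h2, h3⟩ := hk t x u f g h H K hp he
    have hz : (((0, 1, 0), (0, 0, 0, 0, 0)) : Base × Elem) = ((0, 1, 0), 0) := rfl
    rw [hz, h3, h2, hEH t x u f g h H K hp he] at h1
    refine mul_left_cancel₀ (mul_ne_zero (hg_ne g he.2.1) (hH_ne H he.2.2.2.1)) ?_
    linear_combination h1
  have hEh : ∀ {t x u f g h H K t' u' H' K'}, (t, x, u) ∈ D.base → (f, g, h, H, K) ∈ D.elem →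
      (t', x, u') ∈ D.base → (f, g, h, H', K') ∈ D.elem →
      (T.elem (t, x, u) (f, g, h, H, K)).2.2.1 = (T.elem (t', x, u') (f, g, h, H', K')).2.2.1 :=
    fun hp he hp' he' => congrArg (fun v : ℝ × ℝ × ℝ => v.2.2) (hT.fgh_eq hD hp hp' he he' rfl rfl)
  have hEK : ∀ {t x u f g h H K t' x' f' g' h'}, (t, x, u) ∈ D.base → (f, g, h, H, K) ∈ D.elem →
      (t', x', u) ∈ D.base → (f', g', h', H, K) ∈ D.elem →
      (T.elem (t, x, u) (f, g, h, H, K)).2.2.2.2 =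
        (T.elem (t', x', u) (f', g', h', H, K)).2.2.2.2 :=
    fun hp he hp' he' => congrArg Prod.snd (hT.HK_eq hD hp hp' he he' rfl rfl)
  -- With the other variables fixed, the left side of `hsub` is a function of `h` times a function
  -- of `K`, so its 2 by 2 table over two values of each has zero determinant. On the right the
  -- determinant is the coefficient of `h * K` times the free term times `(h₀ - h₁) * (K₀ - K₁)`.
  -- Hence the free term, and with it `B`, vanishes.
  have hkX : ∀ x ∈ D.Ix, k x * deriv (deriv X) x - k' x * deriv X x = 0 := by
    intro x hx
    obtain ⟨h₁, hh₁, hh₁0⟩ := D.isOpenInterval_h.exists_ne h₀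
    obtain ⟨K₁, hK₁, hK₁0⟩ := D.isOpenInterval_K.exists_ne K₀
    have hp := Box.mem_base ht₀ hx hu₀
    have m : ∀ {h K}, h ∈ D.Ih → K ∈ D.IK → (f₀, g₀, h, H₀, K) ∈ D.elem :=
      fun hh hK => Box.mem_elem hf₀ hg₀ hh hH₀ hK
    have h00 := hsub _ _ _ _ _ _ _ _ hp (m hh₀ hK₀)
    have h01 := hsub _ _ _ _ _ _ _ _ hp (m hh₀ hK₁)
    have h10 := hsub _ _ _ _ _ _ _ _ hp (m hh₁ hK₀)
    have h11 := hsub _ _ _ _ _ _ _ _ hp (m hh₁ hK₁)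
    rw [hEh hp (m hh₀ hK₁) hp (m hh₀ hK₀), hEK hp (m hh₀ hK₁) hp (m hh₁ hK₁)] at h01
    rw [hEh hp (m hh₁ hK₀) hp (m hh₁ hK₁), hEK hp (m hh₁ hK₀) hp (m hh₀ hK₀)] at h10
    set B := k x * deriv (deriv X) x - k' x * deriv X x with hB
    have hprod : k x * ε₂ * deriv X x * (ε₂ * g₀ * H₀) * ((h₀ - h₁) * (K₀ - K₁)) * B = 0 := by
      have h5 := congrArg₂ (· * ·) h00 h11
      have h6 := congrArg₂ (· * ·) h01 h10
      linear_combination h6 - h5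
    refine (mul_eq_zero.1 hprod).resolve_left ?_
    refine mul_ne_zero (mul_ne_zero (mul_ne_zero (mul_ne_zero (hk _ _ _ _ _ _ _ _ hp
      (m hh₀ hK₀)).2.1 hε₂0) (hX x hx)) (mul_ne_zero (mul_ne_zero hε₂0 (hg_ne _ hg₀))
      (hH_ne _ hH₀))) (mul_ne_zero (sub_ne_zero.2 hh₁0.symm) (sub_ne_zero.2 hK₁0.symm))
  -- `hkX` says that the quotient `k / X'` has zero derivative.
  have hconst : ∀ x ∈ D.Ix, k x = k x₀ / deriv X x₀ * deriv X x := by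
    intro x hx
    have h1 : k x / deriv X x = k x₀ / deriv X x₀ := by
      refine D.isOpenInterval_x.eq_of_hasDerivAt_zero (φ := fun y => k y / deriv X y)
        (fun y hy => ?_) hx hx₀
      have hk' := (hk _ _ _ _ _ _ _ _ (Box.mem_base ht₀ hy hu₀) he₀).1
      have hX' : HasDerivAt (deriv X) (deriv (deriv X) y) y :=
        (HasJetAt.of_contDiffAt (hs.contDiffAt_X hT hy)).hasDerivAt_deriv
      refine (hk'.div hX' (hX y hy)).congr_deriv ?_
      rw [show k' y * deriv X y - k y * deriv (deriv X) y = 0 by linear_combination -hkX y hy,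
        zero_div]
    rw [← h1, div_mul_cancel₀ _ (hX x hx)]
  set C := k x₀ / deriv X x₀ with hC
  have hC0 : C ≠ 0 := div_ne_zero (hk _ _ _ _ _ _ _ _ hp₀ he₀).2.1 (hX _ hx₀)
  set ε₁ := C * ε₂ with hε₁
  have hε₁0 : ε₁ ≠ 0 := mul_ne_zero hC0 hε₂0
  have hEhK : ∀ t x u f g h H K, (t, x, u) ∈ D.base → (f, g, h, H, K) ∈ D.elem →
      (T.elem (t, x, u) (f, g, h, H, K)).2.2.1 * (T.elem (t, x, u) (f, g, h, H, K)).2.2.2.2 =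
        ε₁ * (h * K) := by
    intro t x u f g h H K hp he
    have h1 := hsub _ _ _ _ _ _ _ _ hp he
    rw [hkX x hp.2.1, hconst x hp.2.1] at h1
    refine mul_right_cancel₀ (pow_ne_zero 2 (hX x hp.2.1)) ?_
    linear_combination h1
  -- The product of the new `h` and `K` is now `ε₁ * (h * K)`. Splitting it leaves one constant
  -- factor free, fixed by letting `ε₃` be the quotient of the new and old `K` at the reference
  -- point.
  set κ := (T.elem (t₀, x₀, u₀) (f₀, g₀, h₀, H₀, K₀)).2.2.2.2 with hκ
  have h00 := hEhK _ _ _ _ _ _ _ _ hp₀ he₀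
  rw [← hκ] at h00
  have hne : (T.elem (t₀, x₀, u₀) (f₀, g₀, h₀, H₀, K₀)).2.2.1 * κ ≠ 0 := by
    rw [h00]
    exact mul_ne_zero hε₁0 (mul_ne_zero hh₀0 hK₀0)
  have hκ0 : κ ≠ 0 := right_ne_zero_of_mul hne
  have hε₃0 : κ / K₀ ≠ 0 := div_ne_zero hκ0 hK₀0
  refine ⟨δ₁, δ₂, δ₃, δ₄, ε₁, ε₂, κ / K₀, X, ?_, ?_, hX, ?_, ?_⟩
  · exact mul_ne_zero (mul_ne_zero (mul_ne_zero (mul_ne_zero hδ₁ hδ₃) hε₁0) hε₂0) hε₃0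
  · exact fun x hx => (hs.contDiffAt_X hT hx).contDiffWithinAt
  · intro t x u hp
    refine Prod.ext ?_ (Prod.ext ?_ ?_)
    · rw [hs.newT _ hp]; exact (hS t hp.1).1
    · rw [hs.newX _ hp]
    · rw [hs.newU _ hp]; exact (hU u hp.2.2).1
  · intro t x u f g h H K hp he
    have hXx := hX x hp.2.1
    have hH := hEH t x u f g h H K hp he
    refine Prod.ext ?_ (Prod.ext ?_ (Prod.ext ?_ (Prod.ext hH ?_)))
    · have h1 := hprin _ _ _ _ _ _ _ _ hp he
      rw [hH, hconst x hp.2.1] at h1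
      have h2 : (T.elem (t, x, u) (f, g, h, H, K)).1 * deriv X x = ε₁ * δ₁ ^ 2 * f := by
        refine mul_left_cancel₀ (mul_ne_zero (hH_ne _ he.2.2.2.1) hXx) ?_
        linear_combination -h1
      simp only
      rw [div_mul_eq_mul_div, eq_div_iff hXx, h2]
    · have h1 := (hk _ _ _ _ _ _ _ _ hp he).2.2.1
      rw [h1, hconst x hp.2.1, hε₁, mul_inv_cancel_right₀ hε₂0]
    · have hp₁ : (t₀, x, u₀) ∈ D.base := ⟨ht₀, hp.2.1, hu₀⟩
      have he₁ : (f, g, h, H₀, K₀) ∈ D.elem := ⟨he.1, he.2.1, he.2.2.1, hH₀, hK₀⟩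
      have h1 := hEhK _ _ _ _ _ _ _ _ hp₁ he₁
      rw [hEh hp₁ he₁ hp he, hEK hp₁ he₁ hp₀ he₀, ← hκ] at h1
      refine mul_right_cancel₀ hκ0 ?_
      rw [h1]
      field_simp
    · have hp₁ : (t₀, x₀, u) ∈ D.base := ⟨ht₀, hx₀, hp.2.2⟩
      have he₁ : (f₀, g₀, h₀, H, K) ∈ D.elem := ⟨hf₀, hg₀, hh₀, he.2.2.2.1, he.2.2.2.2⟩
      have h1 := hEhK _ _ _ _ _ _ _ _ hp₁ he₁
      rw [hEh hp₁ he₁ hp₀ he₀, hEK hp₁ he₁ hp he] at h1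
      refine mul_left_cancel₀ (mul_ne_zero hne hK₀0) ?_
      have h2 : κ / K₀ * K₀ = κ := div_mul_cancel₀ _ hK₀0
      simp only
      linear_combination κ * K₀ * h1 - K * (T.elem (t₀, x₀, u₀) (f₀, g₀, h₀, H₀, K₀)).2.2.1 * κ * h2
        - κ * K * h00

/-! ### Boxes on which `f`, `g` or `H` may vanish -/

/-- The first box is a part of the second one with the same projection on the space of
`(t, x, u)`. -/
structure Box.IsPart (D' D : Box) : Prop where
  t : D'.It = D.It
  x : D'.Ix = D.Ix
  u : D'.Iu = D.Iu
  elem : D'.elem ⊆ D.elem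

theorem Box.IsPart.base {D' D : Box} (h : D'.IsPart D) : D'.base = D.base := by
  simp only [Box.base, h.t, h.x, h.u]

/-- A smaller part admits fewer equations. Since the sides for `t, x, u` are unchanged, the domains
and images in the class conditions stay the same. -/
theorem IsUsualEquivalenceTransformation.of_isPart {D D' : Box} {T : ProjectibleMap}
    (hT : IsUsualEquivalenceTransformation D T) (h : D'.IsPart D) :
    IsUsualEquivalenceTransformation D' T where
  smooth := hT.smooth.mono (Set.prod_mono h.base.le h.elem)
  nondegenerate := fun q hq => hT.nondegenerate q (Set.prod_mono h.base.le h.elem hq)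
  preserves := fun θ hθ hD => by
    rw [h.x, h.u] at hθ
    rw [h.base] at hD
    obtain ⟨θ', h1, h2, h3⟩ := hT.preserves θ hθ fun p hp => h.elem (hD p hp)
    refine ⟨θ', by rwa [h.base], by rwa [h.base], fun u v t x hp => ?_⟩
    rw [h.base] at hp
    exact h3 u v t x hp

/-- Both sides are continuous in the values of the elements, so the formulas extend from the part to
its boundary inside the larger box. -/
theorem HasForm.elem_of_mem_closure {D D' : Box} {T : ProjectibleMap}
    {δ₁ δ₂ δ₃ δ₄ ε₁ ε₂ ε₃ : ℝ} {X : ℝ → ℝ} (hF : HasForm D' T δ₁ δ₂ δ₃ δ₄ ε₁ ε₂ ε₃ X)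
    (hT : IsUsualEquivalenceTransformation D T) (hD : D'.IsPart D) {t x u f g h H K : ℝ}
    (hp : (t, x, u) ∈ D.base) (he : (f, g, h, H, K) ∈ D.elem)
    (he' : (f, g, h, H, K) ∈ closure D'.elem) :
    T.elem (t, x, u) (f, g, h, H, K) =
      (ε₁ * δ₁ ^ 2 / deriv X x * f, ε₁ * ε₂⁻¹ * deriv X x * g, ε₁ * ε₃⁻¹ * h, ε₂ * H, ε₃ * K) := by
  have := mem_closure_iff_nhdsWithin_neBot.1 he'
  have h1 : ContinuousAt (fun e => T.elem (t, x, u) e) (f, g, h, H, K) :=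
    ContinuousAt.comp (g := fun q : Base × Elem => T.elem q.1 q.2)
      (f := fun e : Elem => ((t, x, u), e)) (hT.contDiffAt_elem hp he).continuousAt (by fun_prop)
  have h2 : Continuous (fun e : Elem => ((ε₁ * δ₁ ^ 2 / deriv X x * e.1,
      ε₁ * ε₂⁻¹ * deriv X x * e.2.1, ε₁ * ε₃⁻¹ * e.2.2.1, ε₂ * e.2.2.2.1,
      ε₃ * e.2.2.2.2) : Elem)) := by fun_prop
  refine tendsto_nhds_unique_of_eventuallyEq (l := 𝓝[D'.elem] (f, g, h, H, K))
    (h1.mono_left nhdsWithin_le_nhds)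
    ((h2.tendsto _).mono_left nhdsWithin_le_nhds) ?_
  filter_upwards [self_mem_nhdsWithin] with e hee
  exact hF.elem t x u _ _ _ _ _ (by rwa [hD.base]) hee

/-- The two forms share the base map, hence `δ₁` and `X'`. At one point in both closures, the
`K`-component identifies `ε₃`, then the `h`-component identifies `ε₁`, and whichever of `g`, `H` is
nonzero identifies `ε₂`. The `f`-component is not needed and may vanish there. -/
theorem HasForm.glue {D D' D'' : Box} {T : ProjectibleMap}
    {δ₁ δ₂ δ₃ δ₄ ε₁ ε₂ ε₃ δ₁' δ₂' δ₃' δ₄' ε₁' ε₂' ε₃' : ℝ} {X X' : ℝ → ℝ}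
    (hF' : HasForm D' T δ₁ δ₂ δ₃ δ₄ ε₁ ε₂ ε₃ X)
    (hF'' : HasForm D'' T δ₁' δ₂' δ₃' δ₄' ε₁' ε₂' ε₃' X')
    (hT : IsUsualEquivalenceTransformation D T) (hD' : D'.IsPart D) (hD'' : D''.IsPart D)
    (hcover : ∀ e ∈ D.elem, e ∈ closure D'.elem ∨ e ∈ closure D''.elem)
    {f g h H K : ℝ} (he : (f, g, h, H, K) ∈ D.elem) (he' : (f, g, h, H, K) ∈ closure D'.elem)
    (he'' : (f, g, h, H, K) ∈ closure D''.elem) (hh : h ≠ 0) (hK : K ≠ 0)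
    (hgH : g ≠ 0 ∨ H ≠ 0) : HasForm D T δ₁ δ₂ δ₃ δ₄ ε₁ ε₂ ε₃ X := by
  obtain ⟨t₀, ht₀⟩ := D.isOpenInterval_t.1
  obtain ⟨x₀, hx₀⟩ := D.isOpenInterval_x.1
  obtain ⟨u₀, hu₀⟩ := D.isOpenInterval_u.1
  have hbase : ∀ t x u, (t, x, u) ∈ D.base →
      ((δ₁ * t + δ₂, X x, δ₃ * u + δ₄) : Base) = (δ₁' * t + δ₂', X' x, δ₃' * u + δ₄') :=
    fun t x u hp => (hF'.base t x u (by rwa [hD'.base])).symm.trans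
      (hF''.base t x u (by rwa [hD''.base]))
  have hδ : δ₁ = δ₁' := by
    obtain ⟨t₁, ht₁, hne⟩ := D.isOpenInterval_t.exists_ne t₀
    have h1 := congrArg Prod.fst (hbase t₀ x₀ u₀ ⟨ht₀, hx₀, hu₀⟩)
    have h2 := congrArg Prod.fst (hbase t₁ x₀ u₀ ⟨ht₁, hx₀, hu₀⟩)
    simp only at h1 h2
    exact mul_right_cancel₀ (sub_ne_zero.2 hne) (by linear_combination h2 - h1)
  have hXX : ∀ x ∈ D.Ix, deriv X x = deriv X' x := fun x hx => by
    refine Filter.EventuallyEq.deriv_eq ?_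
    filter_upwards [D.isOpenInterval_x.2.1.mem_nhds hx] with y hy
    exact congrArg (fun p : Base => p.2.1) (hbase t₀ y u₀ ⟨ht₀, hy, hu₀⟩)
  have hX : ∀ x ∈ D.Ix, deriv X x ≠ 0 := fun x hx => hF'.deriv_X x (by rwa [hD'.x])
  have hp₀ := Box.mem_base ht₀ hx₀ hu₀
  have h1 := (hF'.elem_of_mem_closure hT hD' hp₀ he he').symm.trans
    (hF''.elem_of_mem_closure hT hD'' hp₀ he he'')
  simp only [Prod.mk.injEq] at h1
  obtain ⟨-, hg1, hh1, hH1, hK1⟩ := h1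
  have hε₃0 : ε₃ ≠ 0 := right_ne_zero_of_mul hF'.ne_zero
  have hε₂0 : ε₂ ≠ 0 := right_ne_zero_of_mul (left_ne_zero_of_mul hF'.ne_zero)
  have hε₁0 : ε₁ ≠ 0 :=
    right_ne_zero_of_mul (left_ne_zero_of_mul (left_ne_zero_of_mul hF'.ne_zero))
  obtain rfl : ε₃ = ε₃' := mul_right_cancel₀ hK hK1
  obtain rfl : ε₁ = ε₁' :=
    mul_right_cancel₀ (inv_ne_zero hε₃0) (mul_right_cancel₀ hh hh1)
  obtain rfl : ε₂ = ε₂' := by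
    rcases hgH with hg | hH
    · rw [← hXX x₀ hx₀] at hg1
      exact inv_injective (mul_left_cancel₀ hε₁0
        (mul_right_cancel₀ (hX x₀ hx₀) (mul_right_cancel₀ hg hg1)))
    · exact mul_right_cancel₀ hH hH1
  refine ⟨hF'.ne_zero, by rw [← hD'.x]; exact hF'.smooth_X, hX,
    fun t x u hp => hF'.base t x u (by rwa [hD'.base]), fun t x u f g h H K hp he => ?_⟩
  rcases hcover _ he with h1 | h1
  · exact hF'.elem_of_mem_closure hT hD' hp he h1
  · rw [hF''.elem_of_mem_closure hT hD'' hp he h1, hδ, hXX x hp.2.1]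

theorem IsOpenInterval.inter_Ioi {I : Set ℝ} (hI : IsOpenInterval I) (h0 : (0 : ℝ) ∈ I) :
    IsOpenInterval (I ∩ Set.Ioi 0) ∧ (0 : ℝ) ∈ closure (I ∩ Set.Ioi 0) := by
  have hcl : (0 : ℝ) ∈ closure (I ∩ Set.Ioi 0) :=
    hI.2.1.inter_closure ⟨h0, by rw [closure_Ioi]; exact Set.self_mem_Ici⟩
  exact ⟨⟨closure_nonempty_iff.1 ⟨0, hcl⟩, hI.2.1.inter isOpen_Ioi,
    hI.2.2.inter Set.ordConnected_Ioi⟩, hcl⟩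

theorem IsOpenInterval.inter_Iio {I : Set ℝ} (hI : IsOpenInterval I) (h0 : (0 : ℝ) ∈ I) :
    IsOpenInterval (I ∩ Set.Iio 0) ∧ (0 : ℝ) ∈ closure (I ∩ Set.Iio 0) := by
  have hcl : (0 : ℝ) ∈ closure (I ∩ Set.Iio 0) :=
    hI.2.1.inter_closure ⟨h0, by rw [closure_Iio]; exact Set.self_mem_Iic⟩
  exact ⟨⟨closure_nonempty_iff.1 ⟨0, hcl⟩, hI.2.1.inter isOpen_Iio,
    hI.2.2.inter Set.ordConnected_Iio⟩, hcl⟩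

theorem mem_closure_inter_Ioi_or_Iio {I : Set ℝ} (hI : IsOpenInterval I) (h0 : (0 : ℝ) ∈ I)
    {a : ℝ} (ha : a ∈ I) : a ∈ closure (I ∩ Set.Ioi 0) ∨ a ∈ closure (I ∩ Set.Iio 0) := by
  rcases lt_trichotomy a 0 with h | rfl | h
  · exact Or.inr (subset_closure ⟨ha, h⟩)
  · exact Or.inl (hI.inter_Ioi h0).2
  · exact Or.inl (subset_closure ⟨ha, h⟩)

theorem Box.mem_closure_elem {D : Box} {f g h H K : ℝ} (hf : f ∈ closure D.If)
    (hg : g ∈ closure D.Ig) (hh : h ∈ closure D.Ih) (hH : H ∈ closure D.IH)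
    (hK : K ∈ closure D.IK) : (f, g, h, H, K) ∈ closure D.elem := by
  simp only [Box.elem, closure_prod_eq]
  exact ⟨hf, hg, hh, hH, hK⟩

/-- The box with another side for `H`. -/
def Box.withH (D : Box) (s : Set ℝ) (hs : IsOpenInterval s) : Box :=
  { D with IH := s, isOpenInterval_H := hs }

/-- The box with another side for `g`. -/
def Box.withG (D : Box) (s : Set ℝ) (hs : IsOpenInterval s) : Box :=
  { D with Ig := s, isOpenInterval_g := hs }

/-- The box with another side for `f`. -/
def Box.withF (D : Box) (s : Set ℝ) (hs : IsOpenInterval s) : Box :=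
  { D with If := s, isOpenInterval_f := hs }

theorem Box.isPart_withH (D : Box) {s : Set ℝ} (hs : IsOpenInterval s) (h : s ⊆ D.IH) :
    (D.withH s hs).IsPart D :=
  ⟨rfl, rfl, rfl, fun _ he => ⟨he.1, he.2.1, he.2.2.1, h he.2.2.2.1, he.2.2.2.2⟩⟩

theorem Box.isPart_withG (D : Box) {s : Set ℝ} (hs : IsOpenInterval s) (h : s ⊆ D.Ig) :
    (D.withG s hs).IsPart D :=
  ⟨rfl, rfl, rfl, fun _ he => ⟨he.1, h he.2.1, he.2.2⟩⟩

theorem Box.isPart_withF (D : Box) {s : Set ℝ} (hs : IsOpenInterval s) (h : s ⊆ D.If) :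
    (D.withF s hs).IsPart D :=
  ⟨rfl, rfl, rfl, fun _ he => ⟨h he.1, he.2⟩⟩

namespace IsUsualEquivalenceTransformation

variable {D : Box} {T : ProjectibleMap}

/-- The box is cut at `H = 0` when necessary; on the wall `H` is useless for finding `ε₂`, but `g`
is nonzero. -/
theorem exists_hasForm_of_f_g_ne_zero (hT : IsUsualEquivalenceTransformation D T)
    (hf : ∀ a ∈ D.If, a ≠ 0) (hg : ∀ a ∈ D.Ig, a ≠ 0) :
    ∃ δ₁ δ₂ δ₃ δ₄ ε₁ ε₂ ε₃ X, HasForm D T δ₁ δ₂ δ₃ δ₄ ε₁ ε₂ ε₃ X := by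
  by_cases h0 : (0 : ℝ) ∈ D.IH
  · obtain ⟨hI, hcI⟩ := D.isOpenInterval_H.inter_Ioi h0
    obtain ⟨hJ, hcJ⟩ := D.isOpenInterval_H.inter_Iio h0
    have hP := D.isPart_withH hI Set.inter_subset_left
    have hN := D.isPart_withH hJ Set.inter_subset_left
    obtain ⟨δ₁, δ₂, δ₃, δ₄, ε₁, ε₂, ε₃, X, hF⟩ := (hT.of_isPart hP).exists_hasForm_of_regular
      ⟨hf, hg, fun a ha => ne_of_gt ha.2⟩
    obtain ⟨_, _, _, _, _, _, _, _, hF'⟩ := (hT.of_isPart hN).exists_hasForm_of_regular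
      ⟨hf, hg, fun a ha => ne_of_lt ha.2⟩
    obtain ⟨f, hf1⟩ := D.isOpenInterval_f.1
    obtain ⟨g, hg1⟩ := D.isOpenInterval_g.1
    obtain ⟨h, hh1, hh0⟩ := D.isOpenInterval_h.exists_ne 0
    obtain ⟨K, hK1, hK0⟩ := D.isOpenInterval_K.exists_ne 0
    refine ⟨δ₁, δ₂, δ₃, δ₄, ε₁, ε₂, ε₃, X, hF.glue hF' hT hP hN ?_
      (Box.mem_elem hf1 hg1 hh1 h0 hK1)
      (Box.mem_closure_elem (subset_closure hf1) (subset_closure hg1) (subset_closure hh1) hcI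
        (subset_closure hK1))
      (Box.mem_closure_elem (subset_closure hf1) (subset_closure hg1) (subset_closure hh1) hcJ
        (subset_closure hK1)) hh0 hK0 (Or.inl (hg g hg1))⟩
    rintro ⟨f, g, h, H, K⟩ ⟨hf1, hg1, hh1, hH1, hK1⟩
    exact (mem_closure_inter_Ioi_or_Iio D.isOpenInterval_H h0 hH1).imp
      (fun hc => Box.mem_closure_elem (subset_closure hf1) (subset_closure hg1)
        (subset_closure hh1) hc (subset_closure hK1))
      (fun hc => Box.mem_closure_elem (subset_closure hf1) (subset_closure hg1)
        (subset_closure hh1) hc (subset_closure hK1))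
  · exact hT.exists_hasForm_of_regular ⟨hf, hg, fun a ha h => h0 (h ▸ ha)⟩

/-- The cut is now at `g = 0`, and a nonzero value of `H` on the wall identifies `ε₂`. -/
theorem exists_hasForm_of_f_ne_zero (hT : IsUsualEquivalenceTransformation D T)
    (hf : ∀ a ∈ D.If, a ≠ 0) :
    ∃ δ₁ δ₂ δ₃ δ₄ ε₁ ε₂ ε₃ X, HasForm D T δ₁ δ₂ δ₃ δ₄ ε₁ ε₂ ε₃ X := by
  by_cases h0 : (0 : ℝ) ∈ D.Ig
  · obtain ⟨hI, hcI⟩ := D.isOpenInterval_g.inter_Ioi h0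
    obtain ⟨hJ, hcJ⟩ := D.isOpenInterval_g.inter_Iio h0
    have hP := D.isPart_withG hI Set.inter_subset_left
    have hN := D.isPart_withG hJ Set.inter_subset_left
    obtain ⟨δ₁, δ₂, δ₃, δ₄, ε₁, ε₂, ε₃, X, hF⟩ :=
      (hT.of_isPart hP).exists_hasForm_of_f_g_ne_zero hf fun a ha => ne_of_gt ha.2
    obtain ⟨_, _, _, _, _, _, _, _, hF'⟩ :=
      (hT.of_isPart hN).exists_hasForm_of_f_g_ne_zero hf fun a ha => ne_of_lt ha.2
    obtain ⟨f, hf1⟩ := D.isOpenInterval_f.1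
    obtain ⟨h, hh1, hh0⟩ := D.isOpenInterval_h.exists_ne 0
    obtain ⟨H, hH1, hH0⟩ := D.isOpenInterval_H.exists_ne 0
    obtain ⟨K, hK1, hK0⟩ := D.isOpenInterval_K.exists_ne 0
    refine ⟨δ₁, δ₂, δ₃, δ₄, ε₁, ε₂, ε₃, X, hF.glue hF' hT hP hN ?_
      (Box.mem_elem hf1 h0 hh1 hH1 hK1)
      (Box.mem_closure_elem (subset_closure hf1) hcI (subset_closure hh1) (subset_closure hH1)
        (subset_closure hK1))
      (Box.mem_closure_elem (subset_closure hf1) hcJ (subset_closure hh1) (subset_closure hH1)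
        (subset_closure hK1)) hh0 hK0 (Or.inr hH0)⟩
    rintro ⟨f, g, h, H, K⟩ ⟨hf1, hg1, hh1, hH1, hK1⟩
    exact (mem_closure_inter_Ioi_or_Iio D.isOpenInterval_g h0 hg1).imp
      (fun hc => Box.mem_closure_elem (subset_closure hf1) hc
        (subset_closure hh1) (subset_closure hH1) (subset_closure hK1))
      (fun hc => Box.mem_closure_elem (subset_closure hf1) hc
        (subset_closure hh1) (subset_closure hH1) (subset_closure hK1))
  · exact hT.exists_hasForm_of_f_g_ne_zero hf fun a ha h => h0 (h ▸ ha)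

/-- The form of the equivalence transformations. -/
theorem exists_hasForm (hT : IsUsualEquivalenceTransformation D T) :
    ∃ δ₁ δ₂ δ₃ δ₄ ε₁ ε₂ ε₃ X, HasForm D T δ₁ δ₂ δ₃ δ₄ ε₁ ε₂ ε₃ X := by
  by_cases h0 : (0 : ℝ) ∈ D.If
  · obtain ⟨hI, hcI⟩ := D.isOpenInterval_f.inter_Ioi h0
    obtain ⟨hJ, hcJ⟩ := D.isOpenInterval_f.inter_Iio h0
    have hP := D.isPart_withF hI Set.inter_subset_left
    have hN := D.isPart_withF hJ Set.inter_subset_left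
    obtain ⟨δ₁, δ₂, δ₃, δ₄, ε₁, ε₂, ε₃, X, hF⟩ :=
      (hT.of_isPart hP).exists_hasForm_of_f_ne_zero fun a ha => ne_of_gt ha.2
    obtain ⟨_, _, _, _, _, _, _, _, hF'⟩ :=
      (hT.of_isPart hN).exists_hasForm_of_f_ne_zero fun a ha => ne_of_lt ha.2
    obtain ⟨g, hg1⟩ := D.isOpenInterval_g.1
    obtain ⟨h, hh1, hh0⟩ := D.isOpenInterval_h.exists_ne 0
    obtain ⟨H, hH1, hH0⟩ := D.isOpenInterval_H.exists_ne 0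
    obtain ⟨K, hK1, hK0⟩ := D.isOpenInterval_K.exists_ne 0
    refine ⟨δ₁, δ₂, δ₃, δ₄, ε₁, ε₂, ε₃, X, hF.glue hF' hT hP hN ?_
      (Box.mem_elem h0 hg1 hh1 hH1 hK1)
      (Box.mem_closure_elem hcI (subset_closure hg1) (subset_closure hh1) (subset_closure hH1)
        (subset_closure hK1))
      (Box.mem_closure_elem hcJ (subset_closure hg1) (subset_closure hh1) (subset_closure hH1)
        (subset_closure hK1)) hh0 hK0 (Or.inr hH0)⟩
    rintro ⟨f, g, h, H, K⟩ ⟨hf1, hg1, hh1, hH1, hK1⟩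
    exact (mem_closure_inter_Ioi_or_Iio D.isOpenInterval_f h0 hf1).imp
      (fun hc => Box.mem_closure_elem hc (subset_closure hg1)
        (subset_closure hh1) (subset_closure hH1) (subset_closure hK1))
      (fun hc => Box.mem_closure_elem hc (subset_closure hg1)
        (subset_closure hh1) (subset_closure hH1) (subset_closure hK1))
  · exact hT.exists_hasForm_of_f_ne_zero fun a ha h => h0 (h ▸ ha)

end IsUsualEquivalenceTransformation

/-! ### The transformations of the given form belong to the group -/

/-- Rolle's theorem makes `X` injective on the interval. Near `X x` the global inverse coincides
with the smooth local one, because the latter takes values in `I` there. -/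
theorem IsOpenInterval.exists_inverse {I : Set ℝ} (hI : IsOpenInterval I) {X : ℝ → ℝ}
    (hX : ∀ x ∈ I, ContDiffAt ℝ ∞ X x) (hX0 : ∀ x ∈ I, deriv X x ≠ 0) :
    ∃ Y : ℝ → ℝ, ∀ x ∈ I, Y (X x) = x ∧ ContDiffAt ℝ ∞ Y (X x) := by
  have hlt : ∀ a ∈ I, ∀ b ∈ I, a < b → X a ≠ X b := by
    intro a ha b hb hab heq
    have hsub : Set.Icc a b ⊆ I := hI.2.2.out ha hb
    obtain ⟨c, hc, hc0⟩ := exists_deriv_eq_zero hab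
      (fun x hx => (hX x (hsub hx)).continuousAt.continuousWithinAt) heq
    exact hX0 c (hsub (Set.Ioo_subset_Icc_self hc)) hc0
  have hinj : Set.InjOn X I := by
    intro a ha b hb heq
    rcases lt_trichotomy a b with h | h | h
    · exact absurd heq (hlt a ha b hb h)
    · exact h
    · exact absurd heq.symm (hlt b hb a ha h)
  have hY : ∀ x ∈ I, Function.invFunOn X I (X x) = x := fun x hx => hinj.leftInvOn_invFunOn hx
  refine ⟨Function.invFunOn X I, fun x hx => ⟨hY x hx, ?_⟩⟩
  have hd : HasFDerivAt X ((ContinuousLinearEquiv.unitsEquivAut ℝ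
      (Units.mk0 (deriv X x) (hX0 x hx)) : ℝ ≃L[ℝ] ℝ) : ℝ →L[ℝ] ℝ) x := by
    refine ((hX x hx).differentiableAt (by simp)).hasDerivAt.hasFDerivAt.congr_fderiv ?_
    ext
    simp
  have hg := (hX x hx).to_localInverse hd (by simp)
  have hgx := (hX x hx).localInverse_apply_image hd (by simp)
  refine hg.congr_of_eventuallyEq ?_
  have hr : ∀ᶠ y in 𝓝 (X x), X ((hX x hx).localInverse hd (by simp) y) = y :=
    ((hX x hx).hasStrictFDerivAt' hd (by simp)).eventually_right_inverse
  filter_upwards [hr, hg.continuousAt.eventually_mem (hI.2.1.mem_nhds (by rwa [hgx]))] with y hy hyI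
  conv_lhs => rw [← hy]
  exact hY _ hyI

namespace HasForm

variable {D : Box} {T : ProjectibleMap} {δ₁ δ₂ δ₃ δ₄ ε₁ ε₂ ε₃ : ℝ} {X : ℝ → ℝ}

theorem δ₁_ne_zero (hF : HasForm D T δ₁ δ₂ δ₃ δ₄ ε₁ ε₂ ε₃ X) : δ₁ ≠ 0 := fun h =>
  hF.ne_zero (by rw [h]; ring)

theorem δ₃_ne_zero (hF : HasForm D T δ₁ δ₂ δ₃ δ₄ ε₁ ε₂ ε₃ X) : δ₃ ≠ 0 := fun h =>
  hF.ne_zero (by rw [h]; ring)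

theorem ε₁_ne_zero (hF : HasForm D T δ₁ δ₂ δ₃ δ₄ ε₁ ε₂ ε₃ X) : ε₁ ≠ 0 := fun h =>
  hF.ne_zero (by rw [h]; ring)

theorem ε₂_ne_zero (hF : HasForm D T δ₁ δ₂ δ₃ δ₄ ε₁ ε₂ ε₃ X) : ε₂ ≠ 0 := fun h =>
  hF.ne_zero (by rw [h]; ring)

theorem ε₃_ne_zero (hF : HasForm D T δ₁ δ₂ δ₃ δ₄ ε₁ ε₂ ε₃ X) : ε₃ ≠ 0 := fun h =>
  hF.ne_zero (by rw [h]; ring)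

theorem contDiffAt_X (hF : HasForm D T δ₁ δ₂ δ₃ δ₄ ε₁ ε₂ ε₃ X) {x : ℝ} (hx : x ∈ D.Ix) :
    ContDiffAt ℝ ∞ X x := hF.smooth_X.contDiffAt (D.isOpenInterval_x.2.1.mem_nhds hx)

theorem smooth (hF : HasForm D T δ₁ δ₂ δ₃ δ₄ ε₁ ε₂ ε₃ X) :
    ContDiffOn ℝ ∞ T.total (D.base ×ˢ D.elem) := by
  have hΦ : ContDiffOn ℝ ∞ (fun q : Base × Elem =>
      (((δ₁ * q.1.1 + δ₂, X q.1.2.1, δ₃ * q.1.2.2 + δ₄),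
        (ε₁ * δ₁ ^ 2 / deriv X q.1.2.1 * q.2.1, ε₁ * ε₂⁻¹ * deriv X q.1.2.1 * q.2.2.1,
          ε₁ * ε₃⁻¹ * q.2.2.2.1, ε₂ * q.2.2.2.2.1, ε₃ * q.2.2.2.2.2)) : Base × Elem))
      (D.base ×ˢ D.elem) := by
    rintro q ⟨hq, -⟩
    refine ContDiffAt.contDiffWithinAt ?_
    have h1 : ContDiffAt ℝ ∞ (fun q : Base × Elem => X q.1.2.1) q :=
      ContDiffAt.comp (g := X) (f := fun q : Base × Elem => q.1.2.1) q
        (hF.contDiffAt_X hq.2.1) (by fun_prop)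
    have h2 : ContDiffAt ℝ ∞ (fun q : Base × Elem => deriv X q.1.2.1) q :=
      ContDiffAt.comp (g := deriv X) (f := fun q : Base × Elem => q.1.2.1) q
        (hF.contDiffAt_X hq.2.1).deriv_infty (by fun_prop)
    have h3 : ContDiffAt ℝ ∞ (fun q : Base × Elem => ε₁ * δ₁ ^ 2 / deriv X q.1.2.1) q :=
      contDiffAt_const.div h2 (hF.deriv_X _ hq.2.1)
    refine ContDiffAt.prodMk (ContDiffAt.prodMk (by fun_prop) (h1.prodMk (by fun_prop)))
      (ContDiffAt.prodMk (h3.mul (by fun_prop)) (ContDiffAt.prodMk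
        ((contDiffAt_const.mul h2).mul (by fun_prop)) (by fun_prop)))
  exact hΦ.congr fun q hq => Prod.ext (hF.base _ _ _ hq.1) (hF.elem _ _ _ _ _ _ _ _ hq.1 hq.2)

/-- Instead of computing the determinant, an explicit differentiable left inverse `R` is used: by
the chain rule the derivative of the map has a left inverse, hence trivial kernel. -/
theorem nondegenerate (hF : HasForm D T δ₁ δ₂ δ₃ δ₄ ε₁ ε₂ ε₃ X) {q : Base × Elem}
    (hq : q ∈ D.base ×ˢ D.elem) : (fderiv ℝ T.total q).det ≠ 0 := by
  obtain ⟨Y, hY⟩ := D.isOpenInterval_x.exists_inverse (fun x hx => hF.contDiffAt_X hx) hF.deriv_X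
  have hδ₁ := hF.δ₁_ne_zero
  have hδ₃ := hF.δ₃_ne_zero
  have hε₁ := hF.ε₁_ne_zero
  have hε₂ := hF.ε₂_ne_zero
  have hε₃ := hF.ε₃_ne_zero
  have hnhds : D.base ×ˢ D.elem ∈ 𝓝 q := (D.isOpen_base.prod D.isOpen_elem).mem_nhds hq
  let R : Base × Elem → Base × Elem := fun r =>
    (((r.1.1 - δ₂) / δ₁, Y r.1.2.1, (r.1.2.2 - δ₄) / δ₃),
      (r.2.1 * deriv X (Y r.1.2.1) * (ε₁ * δ₁ ^ 2)⁻¹, r.2.2.1 * (ε₂ / ε₁) * (deriv X (Y r.1.2.1))⁻¹,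
        r.2.2.2.1 * (ε₃ / ε₁), r.2.2.2.2.1 / ε₂, r.2.2.2.2.2 / ε₃))
  have hleft : ∀ r ∈ D.base ×ˢ D.elem, R (T.total r) = r := by
    rintro ⟨⟨t, x, u⟩, f, g, h, H, K⟩ ⟨hp, he⟩
    have hXx := hF.deriv_X x hp.2.1
    simp only [R, ProjectibleMap.total, hF.base t x u hp, hF.elem t x u f g h H K hp he,
      (hY x hp.2.1).1, Prod.mk.injEq]
    refine ⟨⟨?_, trivial, ?_⟩, ?_, ?_, ?_, ?_, ?_⟩ <;> field_simp <;> ring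
  have hRd : DifferentiableAt ℝ R (T.total q) := by
    obtain ⟨⟨t, x, u⟩, e⟩ := q
    have hp : (t, x, u) ∈ D.base := hq.1
    have hx : (T.total ((t, x, u), e)).1.2.1 = X x := by
      simp only [ProjectibleMap.total, hF.base t x u hp]
    have h1 : DifferentiableAt ℝ (fun r : Base × Elem => Y r.1.2.1) (T.total ((t, x, u), e)) :=
      DifferentiableAt.comp (g := Y) (f := fun r : Base × Elem => r.1.2.1) _
        (by rw [hx]; exact (hY x hp.2.1).2.differentiableAt (by simp)) (by fun_prop)
    have h2 : DifferentiableAt ℝ (fun r : Base × Elem => deriv X (Y r.1.2.1))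
        (T.total ((t, x, u), e)) :=
      DifferentiableAt.comp (g := deriv X) (f := fun r : Base × Elem => Y r.1.2.1) _
        (by
          rw [hx, (hY x hp.2.1).1]
          exact (hF.contDiffAt_X hp.2.1).deriv_infty.differentiableAt (by simp)) h1
    have h3 : deriv X (Y (T.total ((t, x, u), e)).1.2.1) ≠ 0 := by
      rw [hx, (hY x hp.2.1).1]
      exact hF.deriv_X x hp.2.1
    have h4 : DifferentiableAt ℝ (fun r : Base × Elem => r.2.1) (T.total ((t, x, u), e)) := by
      fun_prop
    have h5 : DifferentiableAt ℝ (fun r : Base × Elem => r.2.2.1 * (ε₂ / ε₁))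
        (T.total ((t, x, u), e)) := by
      fun_prop
    exact DifferentiableAt.prodMk (DifferentiableAt.prodMk (by fun_prop)
      (h1.prodMk (by fun_prop))) (DifferentiableAt.prodMk ((h4.mul h2).mul_const _)
        (DifferentiableAt.prodMk (h5.mul (h2.inv h3)) (by fun_prop)))
  have hTd : DifferentiableAt ℝ T.total q :=
    (hF.smooth.contDiffAt hnhds).differentiableAt (by simp)
  have hid : (fderiv ℝ R (T.total q)).comp (fderiv ℝ T.total q) =
      ContinuousLinearMap.id ℝ (Base × Elem) := by
    have h1 : HasFDerivAt (fun r => R (T.total r)) _ q :=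
      hRd.hasFDerivAt.comp q hTd.hasFDerivAt
    refine h1.unique ((hasFDerivAt_id q).congr_of_eventuallyEq ?_)
    filter_upwards [hnhds] with r hr using hleft r hr
  intro hdet
  refine LinearMap.det_eq_zero_iff_ker_ne_bot.1 hdet (LinearMap.ker_eq_bot'.2 fun w hw => ?_)
  have hw' : fderiv ℝ T.total q w = 0 := hw
  have h2 := congrArg (fun A : Base × Elem →L[ℝ] Base × Elem => A w) hid
  simpa [hw'] using h2.symm

/-- Substituting `v (δ₁ t + δ₂, X) = δ₃ u + δ₄` turns the new equation into the old one times `ε₁ *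
δ₃ / X'`. The second derivative of `X` coming from `v_xx` cancels against the one from
differentiating the factor `X'` in the new `g`. -/
theorem transformsEquation (hF : HasForm D T δ₁ δ₂ δ₃ δ₄ ε₁ ε₂ ε₃ X) {θ θ' : ArbitraryElements}
    (hθ : θ.InClass D.Ix D.Iu) (hval : ∀ p ∈ D.base, θ'.val (T.base p) =
      (ε₁ * δ₁ ^ 2 / deriv X p.2.1 * θ.f p.2.1, ε₁ * ε₂⁻¹ * deriv X p.2.1 * θ.g p.2.1,
        ε₁ * ε₃⁻¹ * θ.h p.2.1, ε₂ * θ.H p.2.2, ε₃ * θ.K p.2.2))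
    (hg' : ∀ x ∈ D.Ix, DifferentiableAt ℝ θ'.g (X x))
    (hH' : ∀ u ∈ D.Iu, HasDerivAt θ'.H (ε₂ * deriv θ.H u / δ₃) (δ₃ * u + δ₄)) :
    T.TransformsEquation D θ θ' := by
  intro u v t x hp huc _ hvc huv
  have hδ₁ := hF.δ₁_ne_zero
  have hδ₃ := hF.δ₃_ne_zero
  have hε₁ := hF.ε₁_ne_zero
  have hε₂ := hF.ε₂_ne_zero
  have hε₃ := hF.ε₃_ne_zero
  have hX : deriv X x ≠ 0 := hF.deriv_X x hp.2.1
  have hind : T.newIndep u (t, x) = (δ₁ * t + δ₂, X x) := by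
    simp only [ProjectibleMap.newIndep, hF.base _ _ _ hp]
  have hloc : ∀ᶠ z in 𝓝 (t, x), v (δ₁ * z.1 + δ₂) (X z.2) = δ₃ * u z.1 z.2 + δ₄ := by
    have hcont : ContinuousAt (fun z : ℝ × ℝ => ((z.1, z.2, u z.1 z.2) : Base)) (t, x) :=
      continuousAt_fst.prodMk (continuousAt_snd.prodMk huc.continuousAt)
    filter_upwards [huv, hcont.eventually_mem (D.isOpen_base.mem_nhds hp)] with z hz hzb
    simpa only [ProjectibleMap.newIndep, ProjectibleMap.newDep, hF.base _ _ _ hzb] using hz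
  have hv0 : v (δ₁ * t + δ₂) (X x) = δ₃ * u t x + δ₄ := hloc.self_of_nhds
  rw [hind] at hvc ⊢
  have ju := HasJetAt.of_contDiffAt (φ := fun s => u s x) (a := t)
    (ContDiffAt.comp (g := fun z : ℝ × ℝ => u z.1 z.2) (f := fun s => (s, x)) t huc (by fun_prop))
  have jx := HasJetAt.of_contDiffAt (φ := fun y => u t y) (a := x)
    (ContDiffAt.comp (g := fun z : ℝ × ℝ => u z.1 z.2) (f := fun y => (t, y)) x huc (by fun_prop))
  have jv := HasJetAt.of_contDiffAt (φ := fun s => v s (X x)) (a := δ₁ * t + δ₂)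
    (ContDiffAt.comp (g := fun z : ℝ × ℝ => v z.1 z.2) (f := fun s => (s, X x)) _ hvc
      (by fun_prop))
  have jw := HasJetAt.of_contDiffAt (φ := fun y => v (δ₁ * t + δ₂) y) (a := X x)
    (ContDiffAt.comp (g := fun z : ℝ × ℝ => v z.1 z.2) (f := fun y => (δ₁ * t + δ₂, y)) _ hvc
      (by fun_prop))
  have jX : HasJetAt X x (deriv X x) (deriv (deriv X) x) :=
    HasJetAt.of_contDiffAt (hF.contDiffAt_X hp.2.1)
  have jδ : HasJetAt (fun s => δ₁ * s + δ₂) t δ₁ 0 := by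
    simpa using ((HasJetAt.id t).const_mul δ₁).add (HasJetAt.const t δ₂)
  generalize deriv (fun s => u s x) t = u₁ at ju
  generalize deriv (deriv (fun s => u s x)) t = u₁₁ at ju
  generalize deriv (fun y => u t y) x = u₂ at jx
  generalize deriv (deriv (fun y => u t y)) x = u₂₂ at jx
  generalize deriv (fun s => v s (X x)) (δ₁ * t + δ₂) = v₁ at jv
  generalize deriv (deriv (fun s => v s (X x))) (δ₁ * t + δ₂) = v₁₁ at jv
  generalize deriv (fun y => v (δ₁ * t + δ₂) y) (X x) = v₂ at jw
  generalize deriv (deriv (fun y => v (δ₁ * t + δ₂) y)) (X x) = v₂₂ at jw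
  have et : v₁₁ * δ₁ ^ 2 = δ₃ * u₁₁ := by
    have hc : ContinuousAt (fun s : ℝ => (s, x)) t := by fun_prop
    have h1 := ((ju.const_mul δ₃).add (HasJetAt.const t δ₄)).congr (hc.eventually hloc)
    have h2 := HasJetAt.comp (F := fun s => v s (X x)) (φ := fun s => δ₁ * s + δ₂) jv jδ
    linear_combination h2.snd_unique h1
  have hcx : ContinuousAt (fun y : ℝ => (t, y)) x := by fun_prop
  have jx' := ((jx.const_mul δ₃).add (HasJetAt.const x δ₄)).congr (hcx.eventually hloc)
  have jw' := HasJetAt.comp (F := fun y => v (δ₁ * t + δ₂) y) jw jX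
  have ex : v₂ * deriv X x = δ₃ * u₂ := by linear_combination jw'.fst_unique jx'
  have exx : v₂₂ * deriv X x ^ 2 + v₂ * deriv (deriv X) x = δ₃ * u₂₂ := by
    linear_combination jw'.snd_unique jx'
  have hg : DifferentiableAt ℝ θ.g x := (hθ.smooth_g.contDiffAt
    (D.isOpenInterval_x.2.1.mem_nhds hp.2.1)).differentiableAt (by simp)
  have hH : DifferentiableAt ℝ θ.H (u t x) := (hθ.smooth_H.contDiffAt
    (D.isOpenInterval_u.2.1.mem_nhds hp.2.2)).differentiableAt (by simp)
  have hvals := fun y (hy : y ∈ D.Ix) => hval (t, y, u t x) ⟨hp.1, hy, hp.2.2⟩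
  have hvalp := hvals x hp.2.1
  rw [hF.base _ _ _ hp] at hvalp
  simp only [ArbitraryElements.val, Prod.mk.injEq] at hvalp
  obtain ⟨hf1, hg1, hh1, hH1, hK1⟩ := hvalp
  have eg : deriv θ'.g (X x) * deriv X x =
      ε₁ * ε₂⁻¹ * (deriv (deriv X) x * θ.g x + deriv X x * deriv θ.g x) := by
    have h1 := (hg' x hp.2.1).hasDerivAt.comp x jX.hasDerivAt
    have h2 := (jX.hasDerivAt_deriv.const_mul (ε₁ * ε₂⁻¹)).mul hg.hasDerivAt
    have h3 := h2.congr_of_eventuallyEq (f₁ := θ'.g ∘ X) (by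
      filter_upwards [D.isOpenInterval_x.2.1.mem_nhds hp.2.1] with y hy
      have h4 := hvals y hy
      rw [hF.base t y (u t x) ⟨hp.1, hy, hp.2.2⟩] at h4
      exact congrArg (fun e : Elem => e.2.1) h4)
    rw [h1.unique h3]
    ring
  rw [ArbitraryElements.holdsAt_iff hg hH ju jx,
    ArbitraryElements.holdsAt_iff (hg' x hp.2.1)
      (by rw [hv0]; exact (hH' _ hp.2.2).differentiableAt) jv jw, hv0, hf1, hg1, hh1, hH1, hK1,
    (hH' _ hp.2.2).deriv]
  have hv₁₁ : v₁₁ = δ₃ * u₁₁ / δ₁ ^ 2 := by field_simp; linear_combination et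
  have hv₂ : v₂ = δ₃ * u₂ / deriv X x := by field_simp; linear_combination ex
  have hv₂₂ : v₂₂ = (δ₃ * u₂₂ - v₂ * deriv (deriv X) x) / deriv X x ^ 2 := by
    field_simp; linear_combination exx
  have hG : deriv θ'.g (X x) =
      ε₁ * ε₂⁻¹ * (deriv (deriv X) x * θ.g x + deriv X x * deriv θ.g x) / deriv X x := by
    rw [eq_div_iff hX, eg]
  rw [hv₂₂, hv₂, hv₁₁, hG]
  have hc : ε₁ * δ₃ / deriv X x ≠ 0 := div_ne_zero (mul_ne_zero hε₁ hδ₃) hX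
  rw [← mul_right_inj' hc]
  refine Eq.congr ?_ ?_
  · field_simp
  · field_simp
    ring

theorem preserves (hF : HasForm D T δ₁ δ₂ δ₃ δ₄ ε₁ ε₂ ε₃ X) {θ : ArbitraryElements}
    (hθ : θ.InClass D.Ix D.Iu) (hD : ∀ p ∈ D.base, θ.val p ∈ D.elem) :
    ∃ θ' : ArbitraryElements,
      θ'.InClass ((fun p => (T.base p).2.1) '' D.base) ((fun p => (T.base p).2.2) '' D.base) ∧
      (∀ p ∈ D.base, θ'.val (T.base p) = T.elem p (θ.val p)) ∧ T.TransformsEquation D θ θ' := by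
  obtain ⟨Y, hY⟩ := D.isOpenInterval_x.exists_inverse (fun x hx => hF.contDiffAt_X hx) hF.deriv_X
  have hδ₁ := hF.δ₁_ne_zero
  have hδ₃ := hF.δ₃_ne_zero
  have hε₁ := hF.ε₁_ne_zero
  have hε₂ := hF.ε₂_ne_zero
  have hε₃ := hF.ε₃_ne_zero
  -- The formulas are read as functions of the new variables by inserting the inverse `Y` of `X` and
  -- the inverse of the affine map of `u`.
  let θ' : ArbitraryElements :=
    ⟨fun y => ε₁ * δ₁ ^ 2 / deriv X (Y y) * θ.f (Y y),
      fun y => ε₁ * ε₂⁻¹ * deriv X (Y y) * θ.g (Y y), fun y => ε₁ * ε₃⁻¹ * θ.h (Y y),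
      fun w => ε₂ * θ.H ((w - δ₄) / δ₃), fun w => ε₃ * θ.K ((w - δ₄) / δ₃)⟩
  have hVU : ∀ u, (δ₃ * u + δ₄ - δ₄) / δ₃ = u := fun u => by field_simp; ring
  have hval : ∀ p ∈ D.base, θ'.val (T.base p) =
      (ε₁ * δ₁ ^ 2 / deriv X p.2.1 * θ.f p.2.1, ε₁ * ε₂⁻¹ * deriv X p.2.1 * θ.g p.2.1,
        ε₁ * ε₃⁻¹ * θ.h p.2.1, ε₂ * θ.H p.2.2, ε₃ * θ.K p.2.2) := by
    rintro ⟨t, x, u⟩ hp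
    simp only [hF.base t x u hp, ArbitraryElements.val, θ', (hY x hp.2.1).1, hVU]
  have hx' : ∀ y ∈ (fun p => (T.base p).2.1) '' D.base, ∃ x ∈ D.Ix, y = X x := by
    rintro y ⟨⟨t, x, u⟩, hp, rfl⟩
    exact ⟨x, hp.2.1, by simp only [hF.base t x u hp]⟩
  have hu' : ∀ w ∈ (fun p => (T.base p).2.2) '' D.base, ∃ u ∈ D.Iu, w = δ₃ * u + δ₄ := by
    rintro w ⟨⟨t, x, u⟩, hp, rfl⟩
    exact ⟨u, hp.2.2, by simp only [hF.base t x u hp]⟩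
  have hcx : ∀ {φ : ℝ → ℝ} {x : ℝ}, x ∈ D.Ix → ContDiffAt ℝ ∞ φ x →
      ContDiffAt ℝ ∞ (fun y => φ (Y y)) (X x) := fun {φ x} hx hφ =>
    ContDiffAt.comp (g := φ) (X x) (by rwa [(hY x hx).1]) (hY x hx).2
  have hcu : ∀ {φ : ℝ → ℝ} {u : ℝ}, ContDiffAt ℝ ∞ φ u →
      ContDiffAt ℝ ∞ (fun w => φ ((w - δ₄) / δ₃)) (δ₃ * u + δ₄) := fun {φ u} hφ =>
    ContDiffAt.comp (g := φ) (f := fun w => (w - δ₄) / δ₃) (δ₃ * u + δ₄) (by rwa [hVU])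
      (by fun_prop)
  have hX'c : ∀ x ∈ D.Ix, ContDiffAt ℝ ∞ (fun y => deriv X (Y y)) (X x) := fun x hx =>
    hcx hx (hF.contDiffAt_X hx).deriv_infty
  have hfx : ∀ {φ : ℝ → ℝ} {x : ℝ}, x ∈ D.Ix → ContDiffOn ℝ ∞ φ D.Ix → ContDiffAt ℝ ∞ φ x :=
    fun hx hφ => hφ.contDiffAt (D.isOpenInterval_x.2.1.mem_nhds hx)
  have hfu : ∀ {φ : ℝ → ℝ} {u : ℝ}, u ∈ D.Iu → ContDiffOn ℝ ∞ φ D.Iu → ContDiffAt ℝ ∞ φ u :=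
    fun hu hφ => hφ.contDiffAt (D.isOpenInterval_u.2.1.mem_nhds hu)
  have hg'c : ∀ x ∈ D.Ix, ContDiffAt ℝ ∞ θ'.g (X x) := fun x hx =>
    (contDiffAt_const.mul (hX'c x hx)).mul (hcx hx (hfx hx hθ.smooth_g))
  have hderiv : ∀ {φ : ℝ → ℝ} {u : ℝ} (c : ℝ), DifferentiableAt ℝ φ u →
      HasDerivAt (fun w => c * φ ((w - δ₄) / δ₃)) (c * deriv φ u / δ₃) (δ₃ * u + δ₄) := by
    intro φ u c hφ
    have h1 : HasDerivAt (fun w : ℝ => (w - δ₄) / δ₃) (1 / δ₃) (δ₃ * u + δ₄) :=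
      ((hasDerivAt_id _).sub_const δ₄).div_const δ₃
    have h2 : HasDerivAt φ (deriv φ u) ((δ₃ * u + δ₄ - δ₄) / δ₃) := by
      rw [hVU]
      exact hφ.hasDerivAt
    exact ((HasDerivAt.comp (h := fun w : ℝ => (w - δ₄) / δ₃) _ h2 h1).const_mul c).congr_deriv
      (by ring)
  have hH'd : ∀ u ∈ D.Iu, HasDerivAt θ'.H (ε₂ * deriv θ.H u / δ₃) (δ₃ * u + δ₄) := fun u hu =>
    hderiv ε₂ ((hfu hu hθ.smooth_H).differentiableAt (by simp))
  have hK'd : ∀ u ∈ D.Iu, HasDerivAt θ'.K (ε₃ * deriv θ.K u / δ₃) (δ₃ * u + δ₄) := fun u hu =>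
    hderiv ε₃ ((hfu hu hθ.smooth_K).differentiableAt (by simp))
  refine ⟨θ', ?_, fun p hp => ?_, hF.transformsEquation hθ hval
    (fun x hx => (hg'c x hx).differentiableAt (by simp)) hH'd⟩
  · constructor
    · intro y hy
      obtain ⟨x, hx, rfl⟩ := hx' y hy
      refine ((contDiffAt_const.div (hX'c x hx) ?_).mul
        (hcx hx (hfx hx hθ.smooth_f))).contDiffWithinAt
      rw [(hY x hx).1]
      exact hF.deriv_X x hx
    · intro y hy
      obtain ⟨x, hx, rfl⟩ := hx' y hy
      exact (hg'c x hx).contDiffWithinAt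
    · intro y hy
      obtain ⟨x, hx, rfl⟩ := hx' y hy
      exact (contDiffAt_const.mul (hcx hx (hfx hx hθ.smooth_h))).contDiffWithinAt
    · intro w hw
      obtain ⟨u, hu, rfl⟩ := hu' w hw
      exact (contDiffAt_const.mul (hcu (hfu hu hθ.smooth_H))).contDiffWithinAt
    · intro w hw
      obtain ⟨u, hu, rfl⟩ := hu' w hw
      exact (contDiffAt_const.mul (hcu (hfu hu hθ.smooth_K))).contDiffWithinAt
    · intro y hy
      obtain ⟨x, hx, rfl⟩ := hx' y hy
      simp only [θ', (hY x hx).1]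
      exact mul_ne_zero (div_ne_zero (mul_ne_zero hε₁ (pow_ne_zero 2 hδ₁)) (hF.deriv_X x hx))
        (hθ.f_ne_zero x hx)
    · intro y hy
      obtain ⟨x, hx, rfl⟩ := hx' y hy
      simp only [θ', (hY x hx).1]
      exact mul_ne_zero (mul_ne_zero (mul_ne_zero hε₁ (inv_ne_zero hε₂)) (hF.deriv_X x hx))
        (hθ.g_ne_zero x hx)
    · intro w hw
      obtain ⟨u, hu, rfl⟩ := hu' w hw
      simp only [θ', hVU]
      exact mul_ne_zero hε₂ (hθ.H_ne_zero u hu)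
    · obtain ⟨u, hu, hne⟩ := hθ.nonlinear
      obtain ⟨t, ht⟩ := D.isOpenInterval_t.1
      obtain ⟨x, hx⟩ := D.isOpenInterval_x.1
      refine ⟨δ₃ * u + δ₄, ⟨(t, x, u), ⟨ht, hx, hu⟩, by simp only [hF.base t x u ⟨ht, hx, hu⟩]⟩, ?_⟩
      rw [(hH'd u hu).deriv, (hK'd u hu).deriv]
      exact hne.imp (fun h => div_ne_zero (mul_ne_zero hε₂ h) hδ₃)
        (fun h => div_ne_zero (mul_ne_zero hε₃ h) hδ₃)
  · rw [hval p hp]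
    exact (hF.elem _ _ _ _ _ _ _ _ hp (hD p hp)).symm

theorem isUsualEquivalenceTransformation (hF : HasForm D T δ₁ δ₂ δ₃ δ₄ ε₁ ε₂ ε₃ X) :
    IsUsualEquivalenceTransformation D T :=
  ⟨hF.smooth, fun _ hq => hF.nondegenerate hq, fun _ hθ hD => hF.preserves hθ hD⟩

end HasForm

end Telegraph

theorem mainTheorem4 (D : Telegraph.Box) (T : Telegraph.ProjectibleMap) :
    T ∈ Telegraph.usualEquivalenceGroup D ↔
      ∃ (δ₁ δ₂ δ₃ δ₄ ε₁ ε₂ ε₃ : ℝ) (X : ℝ → ℝ),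
        δ₁ * δ₃ * ε₁ * ε₂ * ε₃ ≠ 0 ∧
        ContDiffOn ℝ ∞ X D.Ix ∧ (∀ x ∈ D.Ix, deriv X x ≠ 0) ∧
        (∀ t x u : ℝ, (t, x, u) ∈ D.base →
          T.base (t, x, u) = (δ₁ * t + δ₂, X x, δ₃ * u + δ₄)) ∧
        (∀ t x u f g h H K : ℝ, (t, x, u) ∈ D.base → (f, g, h, H, K) ∈ D.elem →
          T.elem (t, x, u) (f, g, h, H, K) =
            (ε₁ * δ₁ ^ 2 / deriv X x * f,
              ε₁ * ε₂⁻¹ * deriv X x * g,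
              ε₁ * ε₃⁻¹ * h,
              ε₂ * H,
              ε₃ * K)) := by
  constructor
  · intro hT
    obtain ⟨δ₁, δ₂, δ₃, δ₄, ε₁, ε₂, ε₃, X, hF⟩ :=
      Telegraph.IsUsualEquivalenceTransformation.exists_hasForm hT
    exact ⟨δ₁, δ₂, δ₃, δ₄, ε₁, ε₂, ε₃, X, hF.ne_zero, hF.smooth_X, hF.deriv_X, hF.base, hF.elem⟩
  · rintro ⟨δ₁, δ₂, δ₃, δ₄, ε₁, ε₂, ε₃, X, h1, h2, h3, h4, h5⟩
    exact Telegraph.HasForm.isUsualEquivalenceTransformation ⟨h1, h2, h3, h4, h5⟩
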